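/- **Setting.** Let $a>b>c$. For $\mu\in\mathbb R$ let $\mathcal Q_\mu$ be the confocal quadric $\frac{x^2}{\mu+a}+\frac{y^2}{\mu+b}+\frac{z^2}{\mu+c}=1$; for $-b<u<-c$ it is a one-sheeted hyperboloid $\mathcal H_u$. For $-b<u<-c$ and $-b\le v\le -c$ let $$A_{u\mapsto v}(x,y,z)=\Big(\sqrt{\tfrac{v+a}{u+a}}\,x,\ \sqrt{\tfrac{v+b}{u+b}}\,y,\ \sqrt{\tfrac{v+c}{u+c}}\,z\Big),$$ which maps $\mathcal H_u$ onto $\mathcal H_v$ if $v\ne -b,-c$, and into the plane $z=0$ or $y=0$ if $v=-c$ or $v=-b$ respectively. A *$\mathbb Z^2$-grid of lines* consists of two sequences of lines $(\ell_n)_{n\in\mathbb Z}$, $(m_{n'})_{n'\in\mathbb Z}$ with vertices $P_{n,n'}\in \ell_n\cap m_{n'}$ such that any three consecutive lines of either sequence are distinct (a grid may close up, e.g. $\ell_{n+N}=\ell_n$). An *AC-grid* on $\mathcal H_u$ is a $\mathbb Z^2$-grid of asymptotic lines (straight lines contained in $\mathcal H_u$) with $\ell_n$ and $m_{n'}$ from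 different families, such that both pairs of opposite vertices of each elementary quadrilateral, $(P_{n,n'},P_{n+1,n'+1})$ and $(P_{n+1,n'},P_{n,n'+1})$, are connected by lines of curvature of $\mathcal H_u$. Here the lines of curvature are the connected components (in the projective closure) of the intersections of $\mathcal H_u$ with the other quadrics of the confocal system, including the coordinate planes as degenerate quadrics; thus they may pass through infinity. An *IC-net bounded by a conic* is a planar $\mathbb Z^2$-grid of lines which all touch the conic (asymptotes of a hyperbola count as tangents) such that the four lines of each elementary quadrilateral touch a circle of positive radius lying between the consecutive lines, i.e. exactly one of $\ell_n,\ell_{n+1}$ and exactly one of $m_{n'},m_{n'+1}$ separates the circle from a focus of the conic. If $\ell_n$ and $m_{n'}$ coincide, their vertex is the point of contact with the conic, and in each elementary quadrilateral with this vertex the circle touches the line there, unless the two lines through the opposite vertex coincide as well. It is an *IC$_e$-net* if the conic is an ellipse (not a circle), and an *IC$_h$-net* if it is a hyperbola. **Corollary.** Let $a>b>c$, $-b<u<-c$, and consider the deformation $v\mapsto A_{u\mapsto v}$, $v\in[-b,-c]$, which is continuous in $v$ and is the identity for $v=u$. For every AC-grid on $\mathcal H_u$: 1. For each $v\in(-b,-c)$,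 the image of the AC-grid under $A_{u\mapsto v}$ is an AC-grid on $\mathcal H_v$. 2. For each $v\in[-b,-c]$, the map $A_{u\mapsto v}$ preserves the lengths of the edges of the elementary quadrilaterals, while the quadrilaterals are folded: for $v\in(-b,-c)$ the four vertices of each of them are not coplanar, and the length of either diagonal is a strictly monotone function of $v\in[-b,-c]$. 3. For $v=-c$, the grid becomes an IC$_e$-net in the plane $z=0$, bounded by the focal ellipse $\frac{x^2}{a-c}+\frac{y^2}{b-c}=1$. For $v=-b$, it becomes an IC$_h$-net in the plane $y=0$, bounded by the focal hyperbola $\frac{x^2}{a-b}-\frac{z^2}{b-c}=1$. 4. Any IC$_e$-net may be transformed into an IC$_h$-net, and any IC$_h$-net into an IC$_e$-net, by such a deformation: after a planar isometry, there exist $a>b>c$, $u\in(-b,-c)$ and an AC-grid on $\mathcal H_u$ whose image for $v=-c$ (for $v=-b$ respectively) is the given net, whose image for $v=-b$ (for $v=-c$ respectively) is an IC-net of the other kind, which is an AC-grid for all $v\in(-b,-c)$, and along the lines of which the deformation is isometric for all $v\in[-b,-c]$. 5. Let $k_1^2=\frac{a-b}{a-c}$, $k_2^2=\frac{b-c}{a-c}$,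 let $\mathsf K(k)$ be the complete elliptic integral of the first kind, and let, in terms of Jacobi elliptic functions, $$r(s_1,s_2,s_3)=\sqrt{a-c}\begin{pmatrix}\mathrm{sn}(s_1,k_1)\,\mathrm{dn}(s_2,k_2)\,\mathrm{ns}(s_3,k_1)\\ \mathrm{cn}(s_1,k_1)\,\mathrm{cn}(s_2,k_2)\,\mathrm{ds}(s_3,k_1)\\ \mathrm{dn}(s_1,k_1)\,\mathrm{sn}(s_2,k_2)\,\mathrm{cs}(s_3,k_1)\end{pmatrix},\qquad u_2(s_2)=-c-(b-c)\,\mathrm{sn}^2(s_2,k_2).$$ The map $u_2$ is a bijection from $[0,\mathsf K(k_2)]$ onto $[-b,-c]$. Call constants $\delta,s_1^0,s_3^0$ admissible if $\delta\notin \mathsf K(k_1)\mathbb Z$ and $\delta n+s_3^0\notin 2\mathsf K(k_1)\mathbb Z$ for all $n\in\mathbb Z$ (no two of three consecutive lines coincide, and no vertex is at infinity). For every AC-grid on $\mathcal H_u$ there are admissible constants such that, up to interchanging the two sequences and reversing the numbering of one of them, for all $s_2\in[0,\mathsf K(k_2)]$ the vertices of its image under $A_{u\mapsto u_2(s_2)}$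 are the points $r(s_1,s_2,s_3)$ with $$(s_1,s_3)=\delta\,(n_1+n_3,\;n_1-n_3)+(s_1^0,s_3^0),\qquad n_1,n_3\in\mathbb Z .$$ Conversely, for all admissible constants and every $s_2\in(0,\mathsf K(k_2))$, these points are the vertices of an AC-grid on $\mathcal H_{u_2(s_2)}$, and its images under $A_{u_2(s_2)\mapsto u_2(\bar s_2)}$, $\bar s_2\in[0,\mathsf K(k_2)]$, are obtained by replacing $s_2$ by $\bar s_2$. -/

import Mathlib

open Set

noncomputable section

/-- The Euclidean plane. -/
abbrev E2 : Type := EuclideanSpace ℝ (Fin 2)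

/-- Euclidean three-space. -/
abbrev E3 : Type := EuclideanSpace ℝ (Fin 3)

/-! ### Jacobi elliptic functions with real argument and modulus `0 < k < 1` -/

/-- The incomplete elliptic integral of the first kind `F(φ, k)`. -/
def ellipticF (k φ : ℝ) : ℝ := ∫ θ in (0 : ℝ)..φ, 1 / Real.sqrt (1 - k ^ 2 * Real.sin θ ^ 2)

/-- The complete elliptic integral of the first kind, i.e. the real quarter period `K(k)`. -/
def ellipticK (k : ℝ) : ℝ := ellipticF k (Real.pi / 2)

/-- The Jacobi amplitude, the inverse of the bijection `φ ↦ F(φ, k)` of the real line. -/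
def jacobiAm (k s : ℝ) : ℝ := Function.invFun (ellipticF k) s

/-- `sn(s, k)` -/
def jacobiSn (s k : ℝ) : ℝ := Real.sin (jacobiAm k s)

/-- `cn(s, k)` -/
def jacobiCn (s k : ℝ) : ℝ := Real.cos (jacobiAm k s)

/-- `dn(s, k)` -/
def jacobiDn (s k : ℝ) : ℝ := Real.sqrt (1 - k ^ 2 * jacobiSn s k ^ 2)

/-! ### Grids of lines -/

/-- Two sequences of affine subspaces (lines, in all uses below) together with a point for each
pair, which is to be their point of intersection. -/
structure LineGrid (E : Type) [NormedAddCommGroup E] [InnerProductSpace ℝ E] where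
  /-- the lines of the first sequence -/
  fst : ℤ → AffineSubspace ℝ E
  /-- the lines of the second sequence -/
  snd : ℤ → AffineSubspace ℝ E
  /-- the vertices of the grid -/
  vertex : ℤ → ℤ → E

namespace LineGrid

variable {E F : Type} [NormedAddCommGroup E] [InnerProductSpace ℝ E]
  [NormedAddCommGroup F] [InnerProductSpace ℝ F]

/-- The image of a grid under an affine map. -/
def map (G : LineGrid E) (f : E →ᵃ[ℝ] F) : LineGrid F where
  fst n := (G.fst n).map f
  snd n := (G.snd n).map f
  vertex n n' := f (G.vertex n n')

/-- The numbering of the second sequence is reversed. -/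
def reverse (G : LineGrid E) : LineGrid E where
  fst n := G.fst n
  snd n := G.snd (-n)
  vertex n n' := G.vertex n (-n')

/-- The two sequences are interchanged. -/
def swap (G : LineGrid E) : LineGrid E where
  fst n := G.snd n
  snd n := G.fst n
  vertex n n' := G.vertex n' n

/-- The combinatorics of a `ℤ²`-grid: all members are lines, the point `vertex n n'` lies on the
`n`-th line of the first and on the `n'`-th line of the second sequence, and any three consecutive
lines of either sequence are distinct. (Lines further apart may coincide: the grid may close.) -/
structure IsGrid (G : LineGrid E) : Prop where
  line_fst : ∀ n, Module.finrank ℝ (G.fst n).direction = 1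
  line_snd : ∀ n, Module.finrank ℝ (G.snd n).direction = 1
  vertex_fst : ∀ n n', G.vertex n n' ∈ G.fst n
  vertex_snd : ∀ n n', G.vertex n n' ∈ G.snd n'
  fst_ne_one : ∀ n, G.fst n ≠ G.fst (n + 1)
  fst_ne_two : ∀ n, G.fst n ≠ G.fst (n + 2)
  snd_ne_one : ∀ n, G.snd n ≠ G.snd (n + 1)
  snd_ne_two : ∀ n, G.snd n ≠ G.snd (n + 2)

/-- The map `f` is isometric along each line of the grid. -/
def IsometricAlong (G : LineGrid E) (f : E → F) : Prop :=
  (∀ n, ∀ P ∈ G.fst n, ∀ Q ∈ G.fst n, dist (f P) (f Q) = dist P Q) ∧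
  (∀ n, ∀ P ∈ G.snd n, ∀ Q ∈ G.snd n, dist (f P) (f Q) = dist P Q)

end LineGrid

/-! ### Confocal quadrics and AC-grids -/

/-- The confocal quadric `x²/(μ+a) + y²/(μ+b) + z²/(μ+c) = 1`; for `a > b > c` it is a one-sheeted
hyperboloid if `-b < μ < -c`. -/
def confocalQuadric (a b c μ : ℝ) : Set E3 :=
  {P | P 0 ^ 2 / (μ + a) + P 1 ^ 2 / (μ + b) + P 2 ^ 2 / (μ + c) = 1}

/-- The projective closure of the confocal quadric with parameter `μ`, in homogeneous coordinates
and with denominators cleared. For `μ = -a, -b, -c` this is the coordinate plane `x = 0`, `y = 0`,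
`z = 0` respectively. -/
def homQuadric (a b c μ : ℝ) : Set (Fin 4 → ℝ) :=
  {X | (μ + b) * (μ + c) * X 0 ^ 2 + (μ + a) * (μ + c) * X 1 ^ 2 + (μ + a) * (μ + b) * X 2 ^ 2 =
    (μ + a) * (μ + b) * (μ + c) * X 3 ^ 2}

/-- Homogeneous coordinates of a point of three-space. -/
def homCoord (P : E3) : Fin 4 → ℝ := ![P 0, P 1, P 2, 1]

/-- Two points of the one-sheeted hyperboloid with parameter `u` are connected by a line of
curvature. The lines of curvature are the (projectively completed) connected components of the
curves in which the hyperboloid meets the other quadrics of the confocal system, including the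
coordinate planes as the degenerate members. They are real for `-a ≤ μ ≤ -b` and for `-c ≤ μ`;
the intersection is empty for all other `μ ≠ u`. As homogeneous coordinates are determined up to a
factor only, `Q` is represented by `homCoord Q` or by `-homCoord Q`. -/
def CurvatureConnected (a b c u : ℝ) (P Q : E3) : Prop :=
  ∃ μ, μ ≠ u ∧
    (JoinedIn {X | X ≠ 0 ∧ X ∈ homQuadric a b c u ∧ X ∈ homQuadric a b c μ}
        (homCoord P) (homCoord Q) ∨
     JoinedIn {X | X ≠ 0 ∧ X ∈ homQuadric a b c u ∧ X ∈ homQuadric a b c μ}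
        (homCoord P) (-homCoord Q))

/-- AC-grids on the one-sheeted hyperboloid with parameter `u`. The asymptotic lines of the
hyperboloid are the straight lines contained in it; distinct ones intersect only if they belong to
different families, so that the two sequences run through different families. Both pairs of
opposite vertices of each elementary quadrilateral are connected by lines of curvature. -/
structure IsACGrid (a b c u : ℝ) (G : LineGrid E3) : Prop where
  grid : G.IsGrid
  fst_asymptotic : ∀ n, (G.fst n : Set E3) ⊆ confocalQuadric a b c u
  snd_asymptotic : ∀ n, (G.snd n : Set E3) ⊆ confocalQuadric a b c u
  families : ∀ n n', G.fst n ≠ G.snd n'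
  diagonal : ∀ n n', CurvatureConnected a b c u (G.vertex n n') (G.vertex (n + 1) (n' + 1))
  diagonal' : ∀ n n', CurvatureConnected a b c u (G.vertex (n + 1) n') (G.vertex n (n' + 1))

/-- The affine transformation which deforms the one-sheeted hyperboloid with parameter `u`,
where `-b < u < -c`, into the one with parameter `v`. For `v = -c` and `v = -b`, the image is
contained in the plane `z = 0` and `y = 0` respectively. -/
def deform (a b c u v : ℝ) : E3 →ᵃ[ℝ] E3 :=
  LinearMap.toAffineMap
    { toFun := fun P => !₂[Real.sqrt ((v + a) / (u + a)) * P 0,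
        Real.sqrt ((v + b) / (u + b)) * P 1, Real.sqrt ((v + c) / (u + c)) * P 2]
      map_add' := by
        intro P Q
        ext i
        fin_cases i <;> simp [mul_add]
      map_smul' := by
        intro t P
        ext i
        fin_cases i <;> simp [mul_left_comm] }

/-! ### IC-nets -/

/-- The line `L` of the plane touches the conic `x²/A + y²/B = 1`: the equation for the common
points of the conic and the line `P + t V` has zero discriminant. Asymptotes of hyperbolas are
regarded as tangent lines with point of contact at infinity. -/
def TouchesConic (A B : ℝ) (L : AffineSubspace ℝ E2) : Prop :=
  ∀ P ∈ L, ∀ V ∈ L.direction,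
    (P 0 * V 0 / A + P 1 * V 1 / B) ^ 2 =
      (V 0 ^ 2 / A + V 1 ^ 2 / B) * (P 0 ^ 2 / A + P 1 ^ 2 / B - 1)

/-- The elementary quadrilateral of `G` with lower left vertex `vertex n n'` circumscribes a
circle, seen from the point `F`: its four lines touch a circle of positive radius, and this circle
lies "between" the consecutive lines of each of the two sequences, that is, exactly one of the two
lines separates it from `F`. The last clause concerns quadrilaterals which degenerate because two
lines of different sequences coincide: at a vertex at which this happens, the circle touches the
line at that vertex, unless it also happens at the opposite vertex. -/
def Circumscribes (F : E2) (G : LineGrid E2) (n n' : ℤ) : Prop :=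
  ∃ S : EuclideanGeometry.Sphere E2, 0 < S.radius ∧
    S.IsTangent (G.fst n) ∧ S.IsTangent (G.fst (n + 1)) ∧
    S.IsTangent (G.snd n') ∧ S.IsTangent (G.snd (n' + 1)) ∧
    Xor ((G.fst n).SOppSide F S.center) ((G.fst (n + 1)).SOppSide F S.center) ∧
    Xor ((G.snd n').SOppSide F S.center) ((G.snd (n' + 1)).SOppSide F S.center) ∧
    ∀ i ∈ ({n, n + 1} : Set ℤ), ∀ j ∈ ({n', n' + 1} : Set ℤ), G.fst i = G.snd j →
      G.vertex i j ∈ S ∨ G.fst (2 * n + 1 - i) = G.snd (2 * n' + 1 - j)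

/-- IC-nets whose lines touch the conic `x²/A + y²/B = 1`, where `A > 0` and `A > B`, so that
`(√(A - B), 0)` is a focus. A focus is used as reference point since it does not lie on any tangent
line. Lines of different sequences may coincide, in which case their vertex is the point of contact
with the conic. -/
structure IsICNetOn (A B : ℝ) (G : LineGrid E2) : Prop where
  grid : G.IsGrid
  fst_touches : ∀ n, TouchesConic A B (G.fst n)
  snd_touches : ∀ n, TouchesConic A B (G.snd n)
  contact : ∀ n n', G.fst n = G.snd n' →
    (G.vertex n n') 0 ^ 2 / A + (G.vertex n n') 1 ^ 2 / B = 1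
  circle : ∀ n n', Circumscribes !₂[Real.sqrt (A - B), 0] G n n'

/-- IC-nets which are bounded by an ellipse (with distinct semi-axes) in arbitrary position. -/
def IsICeNet (G : LineGrid E2) : Prop :=
  ∃ (A B : ℝ) (ψ : E2 ≃ᵃⁱ[ℝ] E2), 0 < B ∧ B < A ∧
    IsICNetOn A B (G.map ψ.toAffineIsometry.toAffineMap)

/-- IC-nets which are bounded by a hyperbola in arbitrary position. -/
def IsIChNet (G : LineGrid E2) : Prop :=
  ∃ (A B : ℝ) (ψ : E2 ≃ᵃⁱ[ℝ] E2), B < 0 ∧ 0 < A ∧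
    IsICNetOn A B (G.map ψ.toAffineIsometry.toAffineMap)

/-- The plane as the coordinate plane `z = 0` of space. -/
def embXY : E2 →ᵃ[ℝ] E3 :=
  LinearMap.toAffineMap
    { toFun := fun p => !₂[p 0, p 1, 0]
      map_add' := by
        intro P Q
        ext i
        fin_cases i <;> simp
      map_smul' := by
        intro t P
        ext i
        fin_cases i <;> simp }

/-- The plane as the coordinate plane `y = 0` of space. -/
def embXZ : E2 →ᵃ[ℝ] E3 :=
  LinearMap.toAffineMap
    { toFun := fun p => !₂[p 0, 0, p 1]
      map_add' := by
        intro P Q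
        ext i
        fin_cases i <;> simp
      map_smul' := by
        intro t P
        ext i
        fin_cases i <;> simp }

/-- For `a > b > c` and `-b < u < -c`, the AC-grid `G` on the hyperboloid with parameter `u` is
deformed continuously through AC-grids on the confocal hyperboloids, isometrically along its
lines, and the deformation ends in the planar net `N` of the plane `z = 0` for parameter `-c` and
in the planar net `N'` of the plane `y = 0` for parameter `-b`. -/
structure ACDeformation (a b c u : ℝ) (G : LineGrid E3) (N N' : LineGrid E2) : Prop where
  hcb : c < b
  hba : b < a
  hu : u ∈ Ioo (-b) (-c)
  isACGrid : ∀ v ∈ Ioo (-b) (-c), IsACGrid a b c v (G.map (deform a b c u v))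
  start : G.map (deform a b c u u) = G
  continuous : ∀ P : E3, ContinuousOn (fun v => deform a b c u v P) (Icc (-b) (-c))
  isometric : ∀ v ∈ Icc (-b) (-c), G.IsometricAlong (deform a b c u v)
  limit_c : G.map (deform a b c u (-c)) = N.map embXY
  limit_b : G.map (deform a b c u (-b)) = N'.map embXZ

/-! ### The privileged parametrisation -/

/-- The modulus `k₁`. -/
def modulus₁ (a b c : ℝ) : ℝ := Real.sqrt ((a - b) / (a - c))

/-- The modulus `k₂`. -/
def modulus₂ (a b c : ℝ) : ℝ := Real.sqrt ((b - c) / (a - c))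

/-- The point with parameters `(s₁, s₂, s₃)`, namely
`√(a-c) (sn(s₁,k₁) dn(s₂,k₂) ns(s₃,k₁), cn(s₁,k₁) cn(s₂,k₂) ds(s₃,k₁), dn(s₁,k₁) sn(s₂,k₂) cs(s₃,k₁))`. -/
def confocalPoint (a b c s₁ s₂ s₃ : ℝ) : E3 :=
  Real.sqrt (a - c) •
    !₂[jacobiSn s₁ (modulus₁ a b c) * jacobiDn s₂ (modulus₂ a b c) *
          (1 / jacobiSn s₃ (modulus₁ a b c)),
       jacobiCn s₁ (modulus₁ a b c) * jacobiCn s₂ (modulus₂ a b c) *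
          (jacobiDn s₃ (modulus₁ a b c) / jacobiSn s₃ (modulus₁ a b c)),
       jacobiDn s₁ (modulus₁ a b c) * jacobiSn s₂ (modulus₂ a b c) *
          (jacobiCn s₃ (modulus₁ a b c) / jacobiSn s₃ (modulus₁ a b c))]

/-- The confocal parameter `u₂ = -c - (b-c) sn²(s₂,k₂)` of the surface `s₂ = const`. -/
def paramU₂ (a b c s₂ : ℝ) : ℝ := -c - (b - c) * jacobiSn s₂ (modulus₂ a b c) ^ 2

/-- The grid point with labels `n₁, n₃`, that is,
`(s₁, s₃) = δ (n₁ + n₃, n₁ - n₃) + (s₁⁰, s₃⁰)`, on the surface `s₂ = const`. -/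
def gridPoint (a b c δ s₁₀ s₃₀ s₂ : ℝ) (n₁ n₃ : ℤ) : E3 :=
  confocalPoint a b c (δ * ((n₁ : ℝ) + n₃) + s₁₀) s₂ (δ * ((n₁ : ℝ) - n₃) + s₃₀)

/-- The constants are admissible: no grid point is at infinity (where `sn(s₃) = 0`), and no two of
three consecutive lines coincide. -/
def AdmissibleConstants (a b c δ s₃₀ : ℝ) : Prop :=
  (∀ j : ℤ, δ ≠ j * ellipticK (modulus₁ a b c)) ∧
  (∀ n j : ℤ, δ * n + s₃₀ ≠ 2 * j * ellipticK (modulus₁ a b c))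

end

/-!
The hyperboloid with semi-axes `p = √(v+a)`, `q = √(v+b)`, `r = √(-(v+c))` is
`(p X, q Y, r Z)` with `X² + Y² - Z² = 1`. In the coordinates `X, Y, Z` the deformation is the
identity, and each asymptotic line is given by a sign `ε = ±1` and an angle `φ` (`ruling`); it
passes through `(sin φ, cos φ, 0)`. Hence a grid of asymptotic lines is a pair of sequences of angles
for all stages `v` simultaneously, and that lengths along the lines are preserved, while chords which
are not contained in a line change their length monotonically, follows from
`p², q², -r² = v + const`.

The idea is to write the angles as `φ = am(τ, k)` with `k = k₁`. By the addition theorem, the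
intersection of the lines with parameters `τ` and `σ` has the coordinates
`X = sn s dn m / cn m`, `Y = cn s / cn m`, `Z = ∓ dn s sn m / cn m` with `s = (τ + σ) / 2` and
`m = (τ - σ) / 2` (`rulingVertex_eq_jacobi`). In these terms everything reduces to one relation
(`MeshRel`), namely that the differences of the parameters `τ` and `σ` agree up to sign and periods.

* The pencil of the confocal quadrics restricted to the hyperboloid splits into a factor in `s` and a
  factor in `m` (`pencil_factor`), so that the lines of curvature are `s = const` and `m = const`. On
  a line of curvature the product of two of the homogeneous coordinates does not change sign; this
  separates the components, and two vertices are connected by a line of curvature if and only if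
  `MeshRel` holds (`CurvatureConnected.meshRel`, `curvatureConnected_of_meshRel`).
* For `v = -c` and `v = -b` the lines with parameter `τ` become tangents of the focal conic, and the
  signed distance of a point from such a tangent is a linear combination of `1`, `sn τ`, `cn τ`,
  divided by `dn τ` and a constant. That two tangents of either sequence touch a circle which lies
  between them therefore amounts to `A + B sn + G cn = ± ρ dn` at the four parameters (`CircData`).
  With `τ = q ± δ` the left-hand side is `T(q) ± dn(q ± δ) W(q)` (`circM_add`, `circM_sub`), where
  `T` and `W` are trigonometric in `am q`. From this factorisation, the four conditions are solvable
  if and only if `MeshRel` holds (`CircData.meshRel`, `exists_circData_ellipse`,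
  `exists_circData_hyperbola`).

So AC-grids and IC-nets of both kinds are given by the same pairs of sequences (`MeshPair`): any
three consecutive parameters are distinct up to periods, and all steps of both sequences agree up to
sign and periods. A step of opposite sign would undo the previous one, so that the sequences are
arithmetic progressions (`MeshPair.exists_progression`), and this is the representation by elliptic
functions, where `s₁ = s` and `s₃ = m + K`.
-/

noncomputable section

/-! ### Jacobi elliptic functions -/

section Elliptic

variable {k : ℝ}

lemma one_sub_sq_mul_sin_sq_pos (hk : k ∈ Ioo (0 : ℝ) 1) (x : ℝ) :
    0 < 1 - k ^ 2 * Real.sin x ^ 2 := by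
  have h1 := Real.sin_sq_le_one x
  have h2 : k ^ 2 < 1 := by nlinarith [hk.1, hk.2]
  nlinarith [sq_nonneg k]

lemma continuous_ellipticF_integrand (hk : k ∈ Ioo (0 : ℝ) 1) :
    Continuous fun θ : ℝ => 1 / Real.sqrt (1 - k ^ 2 * Real.sin θ ^ 2) := by
  refine continuous_const.div (by fun_prop) fun x => ?_
  exact (Real.sqrt_pos.2 (one_sub_sq_mul_sin_sq_pos hk x)).ne'

lemma hasDerivAt_ellipticF (hk : k ∈ Ioo (0 : ℝ) 1) (x : ℝ) :
    HasDerivAt (ellipticF k) (1 / Real.sqrt (1 - k ^ 2 * Real.sin x ^ 2)) x :=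
  intervalIntegral.integral_hasDerivAt_right
    ((continuous_ellipticF_integrand hk).intervalIntegrable _ _)
    (continuous_ellipticF_integrand hk).stronglyMeasurable.stronglyMeasurableAtFilter
    (continuous_ellipticF_integrand hk).continuousAt

lemma ellipticF_zero : ellipticF k 0 = 0 := by simp [ellipticF]

lemma ellipticF_neg (hk : k ∈ Ioo (0 : ℝ) 1) (x : ℝ) : ellipticF k (-x) = -ellipticF k x := by
  have h : ∀ y, HasDerivAt (fun y => ellipticF k (-y) + ellipticF k y) 0 y := by
    intro y
    have h1 := (hasDerivAt_ellipticF hk (-y)).comp y (hasDerivAt_neg y)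
    exact (h1.add (hasDerivAt_ellipticF hk y)).congr_deriv (by simp)
  have := is_const_of_deriv_eq_zero (fun y => (h y).differentiableAt) (fun y => (h y).deriv) x 0
  simp only [neg_zero, ellipticF_zero, add_zero] at this
  linarith

lemma ellipticF_add_pi (hk : k ∈ Ioo (0 : ℝ) 1) (x : ℝ) :
    ellipticF k (x + Real.pi) = ellipticF k x + 2 * ellipticK k := by
  have h : ∀ y, HasDerivAt (fun y => ellipticF k (y + Real.pi) - ellipticF k y) 0 y := by
    intro y
    have h1 := (hasDerivAt_ellipticF hk (y + Real.pi)).comp_add_const y Real.pi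
    exact (h1.sub (hasDerivAt_ellipticF hk y)).congr_deriv (by simp)
  have := is_const_of_deriv_eq_zero (fun y => (h y).differentiableAt) (fun y => (h y).deriv) x
    (-(Real.pi / 2))
  simp only [ellipticF_neg hk] at this
  rw [show -(Real.pi / 2) + Real.pi = Real.pi / 2 by ring] at this
  unfold ellipticK
  linarith

lemma strictMono_ellipticF (hk : k ∈ Ioo (0 : ℝ) 1) : StrictMono (ellipticF k) := by
  refine strictMono_of_hasDerivAt_pos (hasDerivAt_ellipticF hk) fun x => ?_
  have := Real.sqrt_pos.2 (one_sub_sq_mul_sin_sq_pos hk x)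
  positivity

lemma continuous_ellipticF (hk : k ∈ Ioo (0 : ℝ) 1) : Continuous (ellipticF k) :=
  continuous_iff_continuousAt.2 fun x => (hasDerivAt_ellipticF hk x).continuousAt

lemma ellipticK_pos (hk : k ∈ Ioo (0 : ℝ) 1) : 0 < ellipticK k := by
  have := strictMono_ellipticF hk (show (0 : ℝ) < Real.pi / 2 by positivity)
  rwa [ellipticF_zero] at this

lemma ellipticF_add_nat_mul_pi (hk : k ∈ Ioo (0 : ℝ) 1) (n : ℕ) :
    ellipticF k (n * Real.pi) = 2 * n * ellipticK k := by
  induction n with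
  | zero => simp [ellipticF_zero]
  | succ n ih =>
    push_cast
    rw [add_mul, one_mul, ellipticF_add_pi hk, ih]
    ring

lemma surjective_ellipticF (hk : k ∈ Ioo (0 : ℝ) 1) : Function.Surjective (ellipticF k) := by
  have hK := ellipticK_pos hk
  have htop : Filter.Tendsto (ellipticF k) Filter.atTop Filter.atTop := by
    refine Filter.tendsto_atTop_atTop.2 fun B => ?_
    obtain ⟨n, hn⟩ := exists_nat_gt (B / (2 * ellipticK k))
    rw [div_lt_iff₀ (by positivity)] at hn
    refine ⟨n * Real.pi, fun x hx => ?_⟩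
    have := (strictMono_ellipticF hk).monotone hx
    rw [ellipticF_add_nat_mul_pi hk] at this
    linarith
  refine (continuous_ellipticF hk).surjective htop ?_
  have h2 : ellipticF k = fun x => -ellipticF k (-x) := by
    funext x; rw [ellipticF_neg hk, neg_neg]
  rw [h2]
  exact Filter.tendsto_neg_atTop_atBot.comp (htop.comp Filter.tendsto_neg_atBot_atTop)

lemma ellipticF_jacobiAm (hk : k ∈ Ioo (0 : ℝ) 1) (s : ℝ) : ellipticF k (jacobiAm k s) = s :=
  Function.invFun_eq (surjective_ellipticF hk s)

lemma jacobiAm_ellipticF (hk : k ∈ Ioo (0 : ℝ) 1) (x : ℝ) : jacobiAm k (ellipticF k x) = x :=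
  Function.leftInverse_invFun (strictMono_ellipticF hk).injective x

lemma strictMono_jacobiAm (hk : k ∈ Ioo (0 : ℝ) 1) : StrictMono (jacobiAm k) := by
  intro s t h
  rwa [← (strictMono_ellipticF hk).lt_iff_lt, ellipticF_jacobiAm hk, ellipticF_jacobiAm hk]

lemma continuous_jacobiAm (hk : k ∈ Ioo (0 : ℝ) 1) : Continuous (jacobiAm k) :=
  (strictMono_jacobiAm hk).monotone.continuous_of_surjective
    fun x => ⟨_, jacobiAm_ellipticF hk x⟩

lemma jacobiAm_zero (hk : k ∈ Ioo (0 : ℝ) 1) : jacobiAm k 0 = 0 := by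
  have := jacobiAm_ellipticF hk 0
  rwa [ellipticF_zero] at this

lemma jacobiAm_ellipticK (hk : k ∈ Ioo (0 : ℝ) 1) : jacobiAm k (ellipticK k) = Real.pi / 2 :=
  jacobiAm_ellipticF hk _

lemma jacobiAm_neg (hk : k ∈ Ioo (0 : ℝ) 1) (s : ℝ) : jacobiAm k (-s) = -jacobiAm k s := by
  apply (strictMono_ellipticF hk).injective
  rw [ellipticF_jacobiAm hk, ellipticF_neg hk, ellipticF_jacobiAm hk]

lemma jacobiAm_add_two_K (hk : k ∈ Ioo (0 : ℝ) 1) (s : ℝ) :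
    jacobiAm k (s + 2 * ellipticK k) = jacobiAm k s + Real.pi := by
  apply (strictMono_ellipticF hk).injective
  rw [ellipticF_jacobiAm hk, ellipticF_add_pi hk, ellipticF_jacobiAm hk]

lemma jacobiAm_add_int_mul (hk : k ∈ Ioo (0 : ℝ) 1) (s : ℝ) (j : ℤ) :
    jacobiAm k (s + j * (2 * ellipticK k)) = jacobiAm k s + j * Real.pi := by
  induction j using Int.induction_on with
  | zero => simp
  | succ n ih =>
    push_cast at ih ⊢
    rw [add_mul, one_mul, ← add_assoc, jacobiAm_add_two_K hk, ih]
    ring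
  | pred n ih =>
    push_cast at ih ⊢
    have := jacobiAm_add_two_K hk (s + (-(n : ℝ) - 1) * (2 * ellipticK k))
    rw [show s + (-(n : ℝ) - 1) * (2 * ellipticK k) + 2 * ellipticK k
      = s + -(n : ℝ) * (2 * ellipticK k) by ring, ih] at this
    linarith

lemma jacobiAm_eq_add_int_mul_pi (hk : k ∈ Ioo (0 : ℝ) 1) {s t : ℝ} {j : ℤ}
    (h : jacobiAm k s = jacobiAm k t + j * Real.pi) : s = t + j * (2 * ellipticK k) := by
  rw [← jacobiAm_add_int_mul hk] at h
  exact (strictMono_jacobiAm hk).injective h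

lemma jacobi_sn_sq_add_cn_sq (k s : ℝ) : jacobiSn s k ^ 2 + jacobiCn s k ^ 2 = 1 :=
  Real.sin_sq_add_cos_sq _

lemma jacobiCn_sq (k s : ℝ) : jacobiCn s k ^ 2 = 1 - jacobiSn s k ^ 2 := by
  linarith [jacobi_sn_sq_add_cn_sq k s]

lemma jacobiDn_sq (hk : k ∈ Ioo (0 : ℝ) 1) (s : ℝ) :
    jacobiDn s k ^ 2 = 1 - k ^ 2 * jacobiSn s k ^ 2 :=
  Real.sq_sqrt (one_sub_sq_mul_sin_sq_pos hk _).le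

lemma jacobiDn_pos (hk : k ∈ Ioo (0 : ℝ) 1) (s : ℝ) : 0 < jacobiDn s k :=
  Real.sqrt_pos.2 (one_sub_sq_mul_sin_sq_pos hk _)

lemma hasDerivAt_jacobiAm (hk : k ∈ Ioo (0 : ℝ) 1) (s : ℝ) :
    HasDerivAt (jacobiAm k) (jacobiDn s k) s := by
  have h := HasDerivAt.of_local_left_inverse (f := ellipticF k) (g := jacobiAm k) (a := s)
    (continuous_jacobiAm hk).continuousAt (hasDerivAt_ellipticF hk (jacobiAm k s))
    (by have := (Real.sqrt_pos.2 (one_sub_sq_mul_sin_sq_pos hk (jacobiAm k s))).ne'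
        positivity)
    (Filter.Eventually.of_forall (ellipticF_jacobiAm hk))
  simpa [jacobiDn, jacobiSn] using h

lemma hasDerivAt_jacobiSn (hk : k ∈ Ioo (0 : ℝ) 1) (s : ℝ) :
    HasDerivAt (fun s => jacobiSn s k) (jacobiCn s k * jacobiDn s k) s :=
  (hasDerivAt_jacobiAm hk s).sin

lemma hasDerivAt_jacobiCn (hk : k ∈ Ioo (0 : ℝ) 1) (s : ℝ) :
    HasDerivAt (fun s => jacobiCn s k) (-jacobiSn s k * jacobiDn s k) s :=
  (hasDerivAt_jacobiAm hk s).cos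

lemma hasDerivAt_jacobiDn (hk : k ∈ Ioo (0 : ℝ) 1) (s : ℝ) :
    HasDerivAt (fun s => jacobiDn s k) (-k ^ 2 * jacobiSn s k * jacobiCn s k) s := by
  have h1 := (((hasDerivAt_jacobiSn hk s).pow 2).const_mul (k ^ 2)).const_sub 1
  have h2 := h1.sqrt (one_sub_sq_mul_sin_sq_pos hk _).ne'
  have h3 := (jacobiDn_pos hk s).ne'
  refine h2.congr_deriv ?_
  change _ / (2 * jacobiDn s k) = _
  field_simp
  simp
  ring

lemma continuous_jacobiSn (hk : k ∈ Ioo (0 : ℝ) 1) : Continuous fun s => jacobiSn s k :=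
  Real.continuous_sin.comp (continuous_jacobiAm hk)

lemma continuous_jacobiCn (hk : k ∈ Ioo (0 : ℝ) 1) : Continuous fun s => jacobiCn s k :=
  Real.continuous_cos.comp (continuous_jacobiAm hk)

lemma continuous_jacobiDn (hk : k ∈ Ioo (0 : ℝ) 1) : Continuous fun s => jacobiDn s k :=
  continuous_iff_continuousAt.2 fun s => (hasDerivAt_jacobiDn hk s).continuousAt

lemma jacobiSn_zero (hk : k ∈ Ioo (0 : ℝ) 1) : jacobiSn 0 k = 0 := by
  simp [jacobiSn, jacobiAm_zero hk]

lemma jacobiCn_zero (hk : k ∈ Ioo (0 : ℝ) 1) : jacobiCn 0 k = 1 := by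
  simp [jacobiCn, jacobiAm_zero hk]

lemma jacobiDn_zero (hk : k ∈ Ioo (0 : ℝ) 1) : jacobiDn 0 k = 1 := by
  simp [jacobiDn, jacobiSn_zero hk]

lemma jacobiSn_neg (hk : k ∈ Ioo (0 : ℝ) 1) (s : ℝ) : jacobiSn (-s) k = -jacobiSn s k := by
  simp [jacobiSn, jacobiAm_neg hk]

lemma jacobiCn_neg (hk : k ∈ Ioo (0 : ℝ) 1) (s : ℝ) : jacobiCn (-s) k = jacobiCn s k := by
  simp [jacobiCn, jacobiAm_neg hk]

lemma jacobiDn_neg (hk : k ∈ Ioo (0 : ℝ) 1) (s : ℝ) : jacobiDn (-s) k = jacobiDn s k := by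
  simp [jacobiDn, jacobiSn_neg hk]

/-- The common denominator of the addition theorems. -/
def jacobiDen (k u v : ℝ) : ℝ := 1 - k ^ 2 * jacobiSn u k ^ 2 * jacobiSn v k ^ 2

lemma jacobiDen_pos (hk : k ∈ Ioo (0 : ℝ) 1) (u v : ℝ) : 0 < jacobiDen k u v := by
  have h1 := one_sub_sq_mul_sin_sq_pos hk (jacobiAm k u)
  have h2 := Real.sin_sq_le_one (jacobiAm k v)
  have h3 := sq_nonneg (k * Real.sin (jacobiAm k u))
  unfold jacobiDen jacobiSn
  nlinarith

lemma hasDerivAt_jacobiDen (hk : k ∈ Ioo (0 : ℝ) 1) (α s : ℝ) :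
    HasDerivAt (fun s => jacobiDen k s (α - s))
      (-(k ^ 2 * (2 * jacobiSn s k * (jacobiCn s k * jacobiDn s k)) * jacobiSn (α - s) k ^ 2 +
        k ^ 2 * jacobiSn s k ^ 2 * (2 * jacobiSn (α - s) k *
          -(jacobiCn (α - s) k * jacobiDn (α - s) k)))) s := by
  have h1 := ((hasDerivAt_jacobiSn hk s).pow 2).const_mul (k ^ 2)
  have h2 := ((hasDerivAt_jacobiSn hk (α - s)).comp_const_sub α s).pow 2
  have h3 := (h1.mul h2).const_sub 1
  refine h3.congr_deriv ?_
  simp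

/-- A function with the derivation rule of a quotient `N(s, α - s) / Δ(s, α - s)` whose
derivative vanishes takes the same value at `s = u` and at `s = u + v`, where `α = u + v`. -/
lemma eq_mul_jacobiDen_of_wronskian (hk : k ∈ Ioo (0 : ℝ) 1) {N N' : ℝ → ℝ → ℝ} (u v : ℝ)
    (hN : ∀ α s, HasDerivAt (fun s => N s (α - s)) (N' s (α - s)) s)
    (hW : ∀ α s, N' s (α - s) * jacobiDen k s (α - s) - N s (α - s) *
      (-(k ^ 2 * (2 * jacobiSn s k * (jacobiCn s k * jacobiDn s k)) * jacobiSn (α - s) k ^ 2 +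
        k ^ 2 * jacobiSn s k ^ 2 * (2 * jacobiSn (α - s) k *
          -(jacobiCn (α - s) k * jacobiDn (α - s) k)))) = 0) :
    N u v = N (u + v) 0 * jacobiDen k u v := by
  have h : ∀ s, HasDerivAt (fun s => N s (u + v - s) / jacobiDen k s (u + v - s)) 0 s := by
    intro s
    have := (hN (u + v) s).div (hasDerivAt_jacobiDen hk (u + v) s) (jacobiDen_pos hk _ _).ne'
    rwa [hW, zero_div] at this
  have := is_const_of_deriv_eq_zero (fun y => (h y).differentiableAt) (fun y => (h y).deriv) u
    (u + v)
  simp only [add_sub_cancel_left, sub_self] at this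
  rw [div_eq_iff (jacobiDen_pos hk _ _).ne'] at this
  rw [this]
  simp [jacobiDen, jacobiSn_zero hk]

lemma jacobiSn_add (hk : k ∈ Ioo (0 : ℝ) 1) (u v : ℝ) :
    jacobiSn (u + v) k * jacobiDen k u v = jacobiSn u k * jacobiCn v k * jacobiDn v k +
      jacobiSn v k * jacobiCn u k * jacobiDn u k := by
  have := eq_mul_jacobiDen_of_wronskian hk
    (N := fun u v => jacobiSn u k * jacobiCn v k * jacobiDn v k +
      jacobiSn v k * jacobiCn u k * jacobiDn u k)
    (N' := fun u v => 2 * k ^ 2 * jacobiSn u k * jacobiSn v k *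
      (jacobiSn u k ^ 2 - jacobiSn v k ^ 2)) u v ?_ ?_
  · simp only [jacobiSn_zero hk, jacobiCn_zero hk, jacobiDn_zero hk] at this
    linarith
  · intro α s
    have a1 := hasDerivAt_jacobiSn hk s
    have a2 := hasDerivAt_jacobiCn hk s
    have a3 := hasDerivAt_jacobiDn hk s
    have b1 := (hasDerivAt_jacobiSn hk (α - s)).comp_const_sub α s
    have b2 := (hasDerivAt_jacobiCn hk (α - s)).comp_const_sub α s
    have b3 := (hasDerivAt_jacobiDn hk (α - s)).comp_const_sub α s
    refine (((a1.mul b2).mul b3).add ((b1.mul a2).mul a3)).congr_deriv ?_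
    simp only [Pi.mul_apply]
    linear_combination
      (jacobiSn s k * jacobiSn (α - s) k) * (jacobiDn_sq hk (α - s) - jacobiDn_sq hk s +
        k ^ 2 * (jacobiCn_sq k (α - s) - jacobiCn_sq k s))
  · intro α s
    have h1 := jacobiCn_sq k s
    have h2 := jacobiDn_sq hk s
    have h3 := jacobiCn_sq k (α - s)
    have h4 := jacobiDn_sq hk (α - s)
    simp only [jacobiDen]
    generalize jacobiSn s k = s1 at *
    generalize jacobiCn s k = c1 at *
    generalize jacobiDn s k = d1 at *
    generalize jacobiSn (α - s) k = s2 at *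
    generalize jacobiCn (α - s) k = c2 at *
    generalize jacobiDn (α - s) k = d2 at *
    linear_combination (2 * k ^ 2 * s1 * s2) * (s2 ^ 2 * (d1 ^ 2 * h1 + (1 - s1 ^ 2) * h2) -
      s1 ^ 2 * (d2 ^ 2 * h3 + (1 - s2 ^ 2) * h4))

lemma jacobiCn_add (hk : k ∈ Ioo (0 : ℝ) 1) (u v : ℝ) :
    jacobiCn (u + v) k * jacobiDen k u v = jacobiCn u k * jacobiCn v k -
      jacobiSn u k * jacobiDn u k * (jacobiSn v k * jacobiDn v k) := by
  have := eq_mul_jacobiDen_of_wronskian hk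
    (N := fun u v => jacobiCn u k * jacobiCn v k -
      jacobiSn u k * jacobiDn u k * (jacobiSn v k * jacobiDn v k))
    (N' := fun u v => 2 * k ^ 2 * jacobiSn u k * jacobiSn v k *
      (jacobiSn u k * jacobiCn u k * jacobiDn v k - jacobiSn v k * jacobiCn v k * jacobiDn u k))
    u v ?_ ?_
  · simp only [jacobiSn_zero hk, jacobiCn_zero hk, jacobiDn_zero hk] at this
    linarith
  · intro α s
    have a1 := hasDerivAt_jacobiSn hk s
    have a2 := hasDerivAt_jacobiCn hk s
    have a3 := hasDerivAt_jacobiDn hk s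
    have b1 := (hasDerivAt_jacobiSn hk (α - s)).comp_const_sub α s
    have b2 := (hasDerivAt_jacobiCn hk (α - s)).comp_const_sub α s
    have b3 := (hasDerivAt_jacobiDn hk (α - s)).comp_const_sub α s
    refine ((a2.mul b2).sub ((a1.mul a3).mul (b1.mul b3))).congr_deriv ?_
    simp only [Pi.mul_apply]
    linear_combination
      (jacobiSn s k * jacobiDn s k * jacobiCn (α - s) k) * jacobiDn_sq hk (α - s) -
        (jacobiCn s k * jacobiSn (α - s) k * jacobiDn (α - s) k) * jacobiDn_sq hk s
  · intro α s
    have h1 := jacobiCn_sq k s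
    have h2 := jacobiDn_sq hk s
    have h3 := jacobiCn_sq k (α - s)
    have h4 := jacobiDn_sq hk (α - s)
    simp only [jacobiDen]
    generalize jacobiSn s k = s1 at *
    generalize jacobiCn s k = c1 at *
    generalize jacobiDn s k = d1 at *
    generalize jacobiSn (α - s) k = s2 at *
    generalize jacobiCn (α - s) k = c2 at *
    generalize jacobiDn (α - s) k = d2 at *
    linear_combination (2 * k ^ 2 * s1 * s2) * (c2 * d1 * s2 * (h1 + s1 ^ 2 * h4) -
      s1 * c1 * d2 * (h3 + s2 ^ 2 * h2))

lemma jacobiDn_add (hk : k ∈ Ioo (0 : ℝ) 1) (u v : ℝ) :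
    jacobiDn (u + v) k * jacobiDen k u v = jacobiDn u k * jacobiDn v k -
      k ^ 2 * (jacobiSn u k * jacobiCn u k * (jacobiSn v k * jacobiCn v k)) := by
  have := eq_mul_jacobiDen_of_wronskian hk
    (N := fun u v => jacobiDn u k * jacobiDn v k -
      k ^ 2 * (jacobiSn u k * jacobiCn u k * (jacobiSn v k * jacobiCn v k)))
    (N' := fun u v => 2 * k ^ 2 * jacobiSn u k * jacobiSn v k *
      (jacobiSn u k * jacobiCn v k * jacobiDn u k - jacobiSn v k * jacobiCn u k * jacobiDn v k))
    u v ?_ ?_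
  · simp only [jacobiSn_zero hk, jacobiCn_zero hk, jacobiDn_zero hk] at this
    linarith
  · intro α s
    have a1 := hasDerivAt_jacobiSn hk s
    have a2 := hasDerivAt_jacobiCn hk s
    have a3 := hasDerivAt_jacobiDn hk s
    have b1 := (hasDerivAt_jacobiSn hk (α - s)).comp_const_sub α s
    have b2 := (hasDerivAt_jacobiCn hk (α - s)).comp_const_sub α s
    have b3 := (hasDerivAt_jacobiDn hk (α - s)).comp_const_sub α s
    refine ((a3.mul b3).sub (((a1.mul a2).mul (b1.mul b2)).const_mul (k ^ 2))).congr_deriv ?_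
    simp only [Pi.mul_apply]
    linear_combination k ^ 2 *
      ((jacobiSn s k * jacobiDn (α - s) k * jacobiCn s k) * jacobiCn_sq k (α - s) -
        (jacobiCn (α - s) k * jacobiSn (α - s) k * jacobiDn s k) * jacobiCn_sq k s)
  · intro α s
    have h1 := jacobiCn_sq k s
    have h2 := jacobiDn_sq hk s
    have h3 := jacobiCn_sq k (α - s)
    have h4 := jacobiDn_sq hk (α - s)
    simp only [jacobiDen]
    generalize jacobiSn s k = s1 at *
    generalize jacobiCn s k = c1 at *
    generalize jacobiDn s k = d1 at *
    generalize jacobiSn (α - s) k = s2 at *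
    generalize jacobiCn (α - s) k = c2 at *
    generalize jacobiDn (α - s) k = d2 at *
    linear_combination (2 * k ^ 2 * s1 * s2) * (c1 * d2 * s2 * (h2 + k ^ 2 * s1 ^ 2 * h3) -
      s1 * c2 * d1 * (h4 + k ^ 2 * s2 ^ 2 * h1))

lemma jacobiDen_neg (hk : k ∈ Ioo (0 : ℝ) 1) (u v : ℝ) :
    jacobiDen k u (-v) = jacobiDen k u v := by
  simp [jacobiDen, jacobiSn_neg hk]

lemma jacobiSn_sub (hk : k ∈ Ioo (0 : ℝ) 1) (u v : ℝ) :
    jacobiSn (u - v) k * jacobiDen k u v = jacobiSn u k * jacobiCn v k * jacobiDn v k -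
      jacobiSn v k * jacobiCn u k * jacobiDn u k := by
  have := jacobiSn_add hk u (-v)
  rw [jacobiDen_neg hk, jacobiSn_neg hk, jacobiCn_neg hk, jacobiDn_neg hk, ← sub_eq_add_neg] at this
  linarith

lemma jacobiCn_sub (hk : k ∈ Ioo (0 : ℝ) 1) (u v : ℝ) :
    jacobiCn (u - v) k * jacobiDen k u v = jacobiCn u k * jacobiCn v k +
      jacobiSn u k * jacobiDn u k * (jacobiSn v k * jacobiDn v k) := by
  have := jacobiCn_add hk u (-v)
  rw [jacobiDen_neg hk, jacobiSn_neg hk, jacobiCn_neg hk, jacobiDn_neg hk, ← sub_eq_add_neg] at this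
  linarith

/-- The addition theorem in half-angle form: the half sum and the half difference of the
amplitudes of `s + m` and `s - m` have the directions `(cn s, sn s dn m)` and
`(cn m, dn s sn m)`, with a common factor of proportionality. -/
lemma exists_half_angle (hk : k ∈ Ioo (0 : ℝ) 1) (s m : ℝ) :
    ∃ κ : ℝ, κ ^ 2 = jacobiDen k s m ∧
      jacobiCn m k = κ * Real.cos ((jacobiAm k (s + m) - jacobiAm k (s - m)) / 2) ∧
      jacobiDn s k * jacobiSn m k =
        κ * Real.sin ((jacobiAm k (s + m) - jacobiAm k (s - m)) / 2) ∧
      jacobiCn s k = κ * Real.cos ((jacobiAm k (s + m) + jacobiAm k (s - m)) / 2) ∧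
      jacobiSn s k * jacobiDn m k =
        κ * Real.sin ((jacobiAm k (s + m) + jacobiAm k (s - m)) / 2) := by
  have a1 := jacobiSn_add hk s m
  have a2 := jacobiCn_add hk s m
  have b1 := jacobiSn_sub hk s m
  have b2 := jacobiCn_sub hk s m
  have hΔ := jacobiDen_pos hk s m
  have e1 : jacobiCn m k ^ 2 + (jacobiDn s k * jacobiSn m k) ^ 2 = jacobiDen k s m := by
    unfold jacobiDen
    linear_combination jacobiCn_sq k m + jacobiSn m k ^ 2 * jacobiDn_sq hk s
  have e2 : jacobiCn s k ^ 2 + (jacobiSn s k * jacobiDn m k) ^ 2 = jacobiDen k s m := by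
    unfold jacobiDen
    linear_combination jacobiCn_sq k s + jacobiSn s k ^ 2 * jacobiDn_sq hk m
  rw [jacobiSn] at a1 b1
  rw [jacobiCn] at a2 b2
  set a := jacobiAm k (s + m)
  set b := jacobiAm k (s - m)
  set Δ := jacobiDen k s m
  generalize hx : jacobiCn s k = x at *
  generalize hz : jacobiCn m k = z at *
  obtain ⟨y, hy⟩ : ∃ y, jacobiSn s k * jacobiDn m k = y := ⟨_, rfl⟩
  obtain ⟨w, hw⟩ : ∃ w, jacobiDn s k * jacobiSn m k = w := ⟨_, rfl⟩
  rw [hy] at e2 ⊢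
  rw [hw] at e1 ⊢
  replace a1 : Real.sin a * Δ = y * z + x * w := by rw [a1, ← hy, ← hw]; ring
  replace b1 : Real.sin b * Δ = y * z - x * w := by rw [b1, ← hy, ← hw]; ring
  replace a2 : Real.cos a * Δ = x * z - y * w := by rw [a2, ← hy, ← hw]; ring
  replace b2 : Real.cos b * Δ = x * z + y * w := by rw [b2, ← hy, ← hw]; ring
  clear hx hz hy hw
  clear_value a b Δ
  obtain ⟨p, hp⟩ : ∃ p, p = (a + b) / 2 := ⟨_, rfl⟩
  obtain ⟨q, hq⟩ : ∃ q, q = (a - b) / 2 := ⟨_, rfl⟩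
  rw [← hp, ← hq]
  have ha : a = p + q := by rw [hp, hq]; ring
  have hb : b = p - q := by rw [hp, hq]; ring
  rw [ha, Real.sin_add] at a1
  rw [hb, Real.sin_sub] at b1
  rw [ha, Real.cos_add] at a2
  rw [hb, Real.cos_sub] at b2
  clear hp hq ha hb
  have hP := Real.sin_sq_add_cos_sq p
  have hQ := Real.sin_sq_add_cos_sq q
  generalize Real.sin p = sp at *
  generalize Real.cos p = cp at *
  generalize Real.sin q = sq at *
  generalize Real.cos q = cq at *
  -- products of the equations: the squares of the double-angle formulas
  have hΔ0 := hΔ.ne'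
  have m1 : sp * cq * Δ = y * z := by linarith
  have m2 : cp * sq * Δ = x * w := by linarith
  have m3 : cp * cq * Δ = x * z := by linarith
  have m4 : sp * sq * Δ = y * w := by linarith
  have n1 : cq * cq * Δ = z * z := by
    apply mul_left_cancel₀ hΔ0
    linear_combination (sp * cq * Δ + y * z) * m1 + (cp * cq * Δ + x * z) * m3
      - cq ^ 2 * Δ ^ 2 * hP + z ^ 2 * e2
  have n2 : cq * sq * Δ = z * w := by
    apply mul_left_cancel₀ hΔ0
    linear_combination (sp * sq * Δ) * m1 + y * z * m4 + (cp * sq * Δ) * m3 + x * z * m2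
      - cq * sq * Δ ^ 2 * hP + z * w * e2
  have n3 : sq * sq * Δ = w * w := by
    linear_combination Δ * hQ - n1 - e1
  have k1 : (z * cq + w * sq) * cq = z := by
    apply mul_left_cancel₀ hΔ0
    linear_combination z * n1 + w * n2 + z * e1
  have k2 : (z * cq + w * sq) * sq = w := by
    apply mul_left_cancel₀ hΔ0
    linear_combination z * n2 + w * n3 + w * e1
  refine ⟨z * cq + w * sq, ?_, k1.symm, k2.symm, ?_, ?_⟩
  · linear_combination e1 + z * k1 + w * k2
  · apply mul_left_cancel₀ hΔ0
    linear_combination -z * m3 - w * m2 - x * e1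
  · apply mul_left_cancel₀ hΔ0
    linear_combination -z * m1 - w * m4 - y * e1

lemma jacobiSn_K (hk : k ∈ Ioo (0 : ℝ) 1) : jacobiSn (ellipticK k) k = 1 := by
  simp [jacobiSn, jacobiAm_ellipticK hk]

lemma jacobiCn_K (hk : k ∈ Ioo (0 : ℝ) 1) : jacobiCn (ellipticK k) k = 0 := by
  simp [jacobiCn, jacobiAm_ellipticK hk]

lemma jacobiDen_K (hk : k ∈ Ioo (0 : ℝ) 1) (u : ℝ) :
    jacobiDen k u (ellipticK k) = jacobiDn u k ^ 2 := by
  rw [jacobiDn_sq hk, jacobiDen, jacobiSn_K hk]; ring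

lemma jacobiSn_add_K (hk : k ∈ Ioo (0 : ℝ) 1) (u : ℝ) :
    jacobiSn (u + ellipticK k) k * jacobiDn u k = jacobiCn u k := by
  have h := jacobiSn_add hk u (ellipticK k)
  rw [jacobiDen_K hk, jacobiSn_K hk, jacobiCn_K hk] at h
  apply mul_right_cancel₀ (jacobiDn_pos hk u).ne'
  linarith

lemma jacobiCn_add_K (hk : k ∈ Ioo (0 : ℝ) 1) (u : ℝ) :
    jacobiCn (u + ellipticK k) k * jacobiDn u k =
      -(jacobiSn u k * jacobiDn (ellipticK k) k) := by
  have h := jacobiCn_add hk u (ellipticK k)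
  rw [jacobiDen_K hk, jacobiSn_K hk, jacobiCn_K hk] at h
  apply mul_right_cancel₀ (jacobiDn_pos hk u).ne'
  linarith

lemma jacobiDn_add_K (hk : k ∈ Ioo (0 : ℝ) 1) (u : ℝ) :
    jacobiDn (u + ellipticK k) k * jacobiDn u k = jacobiDn (ellipticK k) k := by
  have h := jacobiDn_add hk u (ellipticK k)
  rw [jacobiDen_K hk, jacobiSn_K hk, jacobiCn_K hk] at h
  apply mul_right_cancel₀ (jacobiDn_pos hk u).ne'
  linarith

/-- `sn` and `cn` together determine the argument up to the period `4K`. -/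
lemma exists_eq_add_four_K (hk : k ∈ Ioo (0 : ℝ) 1) {s t : ℝ} (h1 : jacobiSn s k = jacobiSn t k)
    (h2 : jacobiCn s k = jacobiCn t k) : ∃ j : ℤ, s = t + j * (4 * ellipticK k) := by
  have h : (jacobiAm k s : Real.Angle) = jacobiAm k t := Real.Angle.cos_sin_inj h2 h1
  rw [Real.Angle.angle_eq_iff_two_pi_dvd_sub] at h
  obtain ⟨j, hj⟩ := h
  refine ⟨j, ?_⟩
  have := jacobiAm_eq_add_int_mul_pi hk (s := s) (t := t) (j := 2 * j) (by push_cast; linarith)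
  rw [this]; push_cast; ring

lemma jacobiAm_add_four_K (hk : k ∈ Ioo (0 : ℝ) 1) (s : ℝ) (j : ℤ) :
    jacobiAm k (s + j * (4 * ellipticK k)) = jacobiAm k s + j * (2 * Real.pi) := by
  have := jacobiAm_add_int_mul hk s (2 * j)
  push_cast at this
  rw [show s + j * (4 * ellipticK k) = s + 2 * j * (2 * ellipticK k) by ring, this]
  ring

lemma jacobiSn_add_four_K (hk : k ∈ Ioo (0 : ℝ) 1) (s : ℝ) (j : ℤ) :
    jacobiSn (s + j * (4 * ellipticK k)) k = jacobiSn s k := by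
  rw [jacobiSn, jacobiAm_add_four_K hk, Real.sin_add_int_mul_two_pi, jacobiSn]

lemma jacobiCn_add_four_K (hk : k ∈ Ioo (0 : ℝ) 1) (s : ℝ) (j : ℤ) :
    jacobiCn (s + j * (4 * ellipticK k)) k = jacobiCn s k := by
  rw [jacobiCn, jacobiAm_add_four_K hk, Real.cos_add_int_mul_two_pi, jacobiCn]

lemma jacobiAm_two_K_sub (hk : k ∈ Ioo (0 : ℝ) 1) (s : ℝ) :
    jacobiAm k (2 * ellipticK k - s) = Real.pi - jacobiAm k s := by
  rw [sub_eq_neg_add, jacobiAm_add_two_K hk, jacobiAm_neg hk]; ring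


end Elliptic

/-! ### Four tangents of a conic and a circle -/

section Core

variable {k : ℝ}

/-- Two parameters are congruent modulo the period `4K`, that is, they label the same tangent. -/
def SamePar (k τ σ : ℝ) : Prop := jacobiSn τ k = jacobiSn σ k ∧ jacobiCn τ k = jacobiCn σ k

/-- The increments `x` and `y` agree up to sign modulo the period `4K`. -/
def MeshRel (k x y : ℝ) : Prop :=
  ∃ j : ℤ, x = y + j * (4 * ellipticK k) ∨ x = -y + j * (4 * ellipticK k)

/-- A linear form in `1, sn, cn`. In suitable coordinates, the oriented distance of a point from
the tangent with parameter `τ` of a conic is `circM / dn`, up to a constant factor. -/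
def circM (k A B G τ : ℝ) : ℝ := A + B * jacobiSn τ k + G * jacobiCn τ k

/-- The point with coefficients `A, B, G` lies on the normal of the conic at the point of contact
of the tangent with parameter `τ`. -/
def ContactAt (k A B G τ : ℝ) : Prop :=
  B * jacobiCn τ k - (1 - k ^ 2) * G * jacobiSn τ k +
    k ^ 2 * A * (jacobiSn τ k * jacobiCn τ k) = 0

/-- The tangents with parameters `τ₁, τ₂, σ₁, σ₂` touch a circle with (scaled) radius `|ρ|`, the
signs of the oriented distances being different for `τ₁, τ₂` and for `σ₁, σ₂`. If a `τ` and a `σ`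
are congruent, the circle touches at the point of contact with the conic, unless the two other
parameters are congruent as well. -/
structure CircData (k A B G ρ τ₁ τ₂ σ₁ σ₂ : ℝ) : Prop where
  ne : ρ ≠ 0
  one : circM k A B G τ₁ = ρ * jacobiDn τ₁ k
  two : circM k A B G τ₂ = -ρ * jacobiDn τ₂ k
  other : (circM k A B G σ₁ = ρ * jacobiDn σ₁ k ∧ circM k A B G σ₂ = -ρ * jacobiDn σ₂ k) ∨
    (circM k A B G σ₁ = -ρ * jacobiDn σ₁ k ∧ circM k A B G σ₂ = ρ * jacobiDn σ₂ k)
  c11 : SamePar k τ₁ σ₁ → ContactAt k A B G τ₁ ∨ SamePar k τ₂ σ₂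
  c12 : SamePar k τ₁ σ₂ → ContactAt k A B G τ₁ ∨ SamePar k τ₂ σ₁
  c21 : SamePar k τ₂ σ₁ → ContactAt k A B G τ₂ ∨ SamePar k τ₁ σ₂
  c22 : SamePar k τ₂ σ₂ → ContactAt k A B G τ₂ ∨ SamePar k τ₁ σ₁

lemma SamePar.symm {τ σ : ℝ} (h : SamePar k τ σ) : SamePar k σ τ := ⟨h.1.symm, h.2.symm⟩

lemma SamePar.trans {τ σ ρ : ℝ} (h : SamePar k τ σ) (h' : SamePar k σ ρ) : SamePar k τ ρ :=
  ⟨h.1.trans h'.1, h.2.trans h'.2⟩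

lemma samePar_iff (hk : k ∈ Ioo (0 : ℝ) 1) {τ σ : ℝ} :
    SamePar k τ σ ↔ ∃ j : ℤ, τ = σ + j * (4 * ellipticK k) := by
  constructor
  · rintro ⟨h1, h2⟩
    exact exists_eq_add_four_K hk h1 h2
  · rintro ⟨j, rfl⟩
    exact ⟨jacobiSn_add_four_K hk _ _, jacobiCn_add_four_K hk _ _⟩

lemma SamePar.dn {τ σ : ℝ} (h : SamePar k τ σ) : jacobiDn τ k = jacobiDn σ k := by
  simp [jacobiDn, h.1]

lemma SamePar.add (hk : k ∈ Ioo (0 : ℝ) 1) {τ σ : ℝ} (h : SamePar k τ σ) (x : ℝ) :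
    SamePar k (τ + x) (σ + x) := by
  obtain ⟨j, rfl⟩ := (samePar_iff hk).1 h
  exact (samePar_iff hk).2 ⟨j, by ring⟩

lemma SamePar.sub (hk : k ∈ Ioo (0 : ℝ) 1) {τ σ : ℝ} (h : SamePar k τ σ) (x : ℝ) :
    SamePar k (τ - x) (σ - x) := h.add hk (-x)

lemma SamePar.circM {τ σ : ℝ} (h : SamePar k τ σ) (A B G : ℝ) :
    circM k A B G τ = circM k A B G σ := by
  simp [_root_.circM, h.1, h.2]

lemma SamePar.contactAt {τ σ : ℝ} (h : SamePar k τ σ) {A B G : ℝ} (hc : ContactAt k A B G σ) :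
    ContactAt k A B G τ := by
  unfold ContactAt at *
  rwa [h.1, h.2]

lemma MeshRel.neg_right {x y : ℝ} (h : MeshRel k x y) : MeshRel k x (-y) := by
  obtain ⟨j, h | h⟩ := h
  · exact ⟨j, Or.inr (by rw [h]; ring)⟩
  · exact ⟨j, Or.inl h⟩

lemma CircData.swap {A B G ρ τ₁ τ₂ σ₁ σ₂ : ℝ} (h : CircData k A B G ρ τ₁ τ₂ σ₁ σ₂) :
    CircData k A B G ρ τ₁ τ₂ σ₂ σ₁ where
  ne := h.ne
  one := h.one
  two := h.two
  other := h.other.symm.imp And.symm And.symm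
  c11 := h.c12
  c12 := h.c11
  c21 := h.c22
  c22 := h.c21

lemma CircData.congr_right {A B G ρ τ₁ τ₂ σ₁ σ₂ σ₂' : ℝ} (h : CircData k A B G ρ τ₁ τ₂ σ₁ σ₂)
    (h' : SamePar k σ₂ σ₂') : CircData k A B G ρ τ₁ τ₂ σ₁ σ₂' where
  ne := h.ne
  one := h.one
  two := h.two
  other := by rw [← h'.circM, ← h'.dn]; exact h.other
  c11 := fun x => (h.c11 x).imp_right fun y => y.trans h'
  c12 := fun x => h.c12 (x.trans h'.symm)
  c21 := fun x => (h.c21 x).imp_right fun y => y.trans h'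
  c22 := fun x => h.c22 (x.trans h'.symm)

/-- The symmetric part of `circM` at `q ± δ`, see `circM_add`. -/
def meshT (k A ν₁ ν₂ δ q : ℝ) : ℝ :=
  A + jacobiCn δ k * (ν₁ * jacobiSn q k + ν₂ * jacobiCn q k)

/-- The antisymmetric part of `circM` at `q ± δ`, see `circM_add`. -/
def meshW (k ν₁ ν₂ δ q : ℝ) : ℝ :=
  jacobiSn δ k * (ν₁ * jacobiCn q k - ν₂ * jacobiSn q k)

lemma circM_add (hk : k ∈ Ioo (0 : ℝ) 1) (A ν₁ ν₂ δ q : ℝ) :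
    circM k A (jacobiDn δ k * ν₁) ν₂ (q + δ) =
      meshT k A ν₁ ν₂ δ q + jacobiDn (q + δ) k * meshW k ν₁ ν₂ δ q := by
  have a1 := jacobiSn_add hk q δ
  have a2 := jacobiCn_add hk q δ
  have a3 := jacobiDn_add hk q δ
  have h1 := jacobiDn_sq hk δ
  have h2 := jacobiCn_sq k q
  apply mul_right_cancel₀ (jacobiDen_pos hk q δ).ne'
  unfold circM meshT meshW
  have hΔ : jacobiDen k q δ = 1 - k ^ 2 * jacobiSn q k ^ 2 * jacobiSn δ k ^ 2 := rfl
  linear_combination jacobiDn δ k * ν₁ * a1 + ν₂ * a2 -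
    (jacobiSn δ k * (ν₁ * jacobiCn q k - ν₂ * jacobiSn q k)) * a3 +
    ν₁ * jacobiSn q k * jacobiCn δ k * (h1 + k ^ 2 * jacobiSn δ k ^ 2 * h2 - hΔ) -
    ν₂ * jacobiCn q k * jacobiCn δ k * hΔ

lemma circM_sub (hk : k ∈ Ioo (0 : ℝ) 1) (A ν₁ ν₂ δ q : ℝ) :
    circM k A (jacobiDn δ k * ν₁) ν₂ (q - δ) =
      meshT k A ν₁ ν₂ δ q - jacobiDn (q - δ) k * meshW k ν₁ ν₂ δ q := by
  have h := circM_add hk A ν₁ ν₂ (-δ) q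
  rw [← sub_eq_add_neg, jacobiDn_neg hk] at h
  rw [h]
  simp only [meshT, meshW, jacobiSn_neg hk, jacobiCn_neg hk]
  ring

lemma meshT_congr {q q' : ℝ} (h : SamePar k q q') (A ν₁ ν₂ δ : ℝ) :
    meshT k A ν₁ ν₂ δ q = meshT k A ν₁ ν₂ δ q' := by simp [meshT, h.1, h.2]

lemma meshT_eq_zero_of_circM (hk : k ∈ Ioo (0 : ℝ) 1) {A ν₁ ν₂ δ p ρ : ℝ}
    (h1 : circM k A (jacobiDn δ k * ν₁) ν₂ (p - δ) = ρ * jacobiDn (p - δ) k)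
    (h2 : circM k A (jacobiDn δ k * ν₁) ν₂ (p + δ) = -ρ * jacobiDn (p + δ) k) :
    meshT k A ν₁ ν₂ δ p = 0 ∧ meshW k ν₁ ν₂ δ p = -ρ := by
  rw [circM_sub hk] at h1
  rw [circM_add hk] at h2
  have d1 := jacobiDn_pos hk (p - δ)
  have d2 := jacobiDn_pos hk (p + δ)
  have h3 : (jacobiDn (p - δ) k + jacobiDn (p + δ) k) * (meshW k ν₁ ν₂ δ p + ρ) = 0 := by linarith
  have h4 : meshW k ν₁ ν₂ δ p + ρ = 0 := by
    rcases mul_eq_zero.1 h3 with h | h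
    · linarith
    · exact h
  have h5 : meshW k ν₁ ν₂ δ p = -ρ := by linarith
  rw [h5] at h2
  exact ⟨by linarith, h5⟩

/-- As functions of `q`, both `meshT` and `meshW - ρ` have the factor
`X sin h + Y cos h`, where `2h` is the difference of the amplitudes of `q` and `p`. -/
lemma mesh_factor {A ν₁ ν₂ δ p ρ : ℝ} (hT : meshT k A ν₁ ν₂ δ p = 0)
    (hW : meshW k ν₁ ν₂ δ p = -ρ) (q h : ℝ) (hh : h = (jacobiAm k q - jacobiAm k p) / 2) :
    meshT k A ν₁ ν₂ δ q = -2 * jacobiCn δ k * Real.sin h *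
        ((ν₁ * jacobiSn p k + ν₂ * jacobiCn p k) * Real.sin h +
          (ν₂ * jacobiSn p k - ν₁ * jacobiCn p k) * Real.cos h) ∧
      meshW k ν₁ ν₂ δ q - ρ = -2 * jacobiSn δ k * Real.cos h *
        ((ν₁ * jacobiSn p k + ν₂ * jacobiCn p k) * Real.sin h +
          (ν₂ * jacobiSn p k - ν₁ * jacobiCn p k) * Real.cos h) := by
  have e : jacobiAm k q = jacobiAm k p + 2 * h := by rw [hh]; ring
  have e1 : jacobiSn q k = jacobiSn p k * (1 - 2 * Real.sin h ^ 2) +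
      jacobiCn p k * (2 * Real.sin h * Real.cos h) := by
    unfold jacobiSn jacobiCn
    rw [e, Real.sin_add, Real.sin_two_mul, Real.cos_two_mul']
    linear_combination Real.sin (jacobiAm k p) * Real.sin_sq_add_cos_sq h
  have e2 : jacobiCn q k = jacobiCn p k * (1 - 2 * Real.sin h ^ 2) -
      jacobiSn p k * (2 * Real.sin h * Real.cos h) := by
    unfold jacobiSn jacobiCn
    rw [e, Real.cos_add, Real.sin_two_mul, Real.cos_two_mul']
    linear_combination Real.cos (jacobiAm k p) * Real.sin_sq_add_cos_sq h
  have e3 := Real.sin_sq_add_cos_sq h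
  unfold meshT meshW at *
  rw [e1, e2]
  constructor
  · linear_combination hT
  · linear_combination -hW + 2 * jacobiSn δ k *
      (ν₁ * jacobiCn p k - ν₂ * jacobiSn p k) * (-e3)

/-- The contact condition for a parameter `x`, for a circle with `meshT = 0` at `x + δ`. -/
lemma contact_imp (hk : k ∈ Ioo (0 : ℝ) 1) {A ν₁ ν₂ δ x : ℝ}
    (hT : meshT k A ν₁ ν₂ δ (x + δ) = 0)
    (hc : ContactAt k A (jacobiDn δ k * ν₁) ν₂ x) :
    ν₁ * jacobiCn x k = ν₂ * jacobiSn x k * jacobiDn δ k := by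
  have a1 := jacobiSn_add hk x δ
  have a2 := jacobiCn_add hk x δ
  have a3 := jacobiDn_add hk x δ
  have h1 := jacobiDn_sq hk δ
  have h2 := jacobiCn_sq k x
  have h3 := jacobiDn_sq hk x
  have h4 := jacobiCn_sq k δ
  have hΔ : jacobiDen k x δ = 1 - k ^ 2 * jacobiSn x k ^ 2 * jacobiSn δ k ^ 2 := rfl
  have hpos := jacobiDen_pos hk x δ
  have hD := jacobiDn_pos hk x
  have hD2 := jacobiDn_pos hk (x + δ)
  unfold meshT at hT
  unfold ContactAt at hc
  have key : (ν₁ * jacobiCn x k - ν₂ * jacobiSn x k * jacobiDn δ k) *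
      (jacobiDn x k * (jacobiDn (x + δ) k * jacobiDen k x δ)) = 0 := by
    rw [a3]
    generalize jacobiSn x k = S at *
    generalize jacobiCn x k = C at *
    generalize jacobiDn x k = D at *
    generalize jacobiSn δ k = s at *
    generalize jacobiCn δ k = c at *
    generalize jacobiDn δ k = d at *
    have hc2 : jacobiDen k x δ * (d * ν₁ * C - (1 - k ^ 2) * ν₂ * S) - k ^ 2 * S * C * c *
        (ν₁ * (S * c * d + s * C * D) + ν₂ * (C * c - S * D * (s * d))) = 0 := by
      linear_combination jacobiDen k x δ * hc - jacobiDen k x δ * k ^ 2 * S * C * hT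
        + k ^ 2 * S * C * c * ν₁ * a1 + k ^ 2 * S * C * c * ν₂ * a2
    rw [hΔ] at hc2
    linear_combination hc2 + ν₁ * d * C * (k ^ 2 * S ^ 2 * h4 + h3) + ν₂ * S *
      (k ^ 2 * (c ^ 2 * h2 + (1 - S ^ 2) * h4) - (D ^ 2 * h1 + (1 - k ^ 2 * s ^ 2) * h3))
  rcases mul_eq_zero.1 key with h | h
  · linarith
  · exact absurd h (by positivity)

/-- If `T` vanishes at `x + δ` and at `x - δ`, the circle touches the line `x` on the conic. -/
lemma contact_of (hk : k ∈ Ioo (0 : ℝ) 1) {A ν₁ ν₂ δ x : ℝ} (hc0 : jacobiCn δ k ≠ 0)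
    (hs0 : jacobiSn δ k ≠ 0)
    (hT : meshT k A ν₁ ν₂ δ (x + δ) = 0) (hT' : meshT k A ν₁ ν₂ δ (x - δ) = 0) :
    ContactAt k A (jacobiDn δ k * ν₁) ν₂ x := by
  have a1 := jacobiSn_add hk x δ
  have a2 := jacobiCn_add hk x δ
  have b1 := jacobiSn_sub hk x δ
  have b2 := jacobiCn_sub hk x δ
  have h1 := jacobiDn_sq hk δ
  have h2 := jacobiCn_sq k x
  have h4 := jacobiCn_sq k δ
  have hΔ : jacobiDen k x δ = 1 - k ^ 2 * jacobiSn x k ^ 2 * jacobiSn δ k ^ 2 := rfl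
  have hpos := jacobiDen_pos hk x δ
  have hD := jacobiDn_pos hk x
  unfold meshT at hT hT'
  unfold ContactAt
  apply mul_right_cancel₀ hpos.ne'
  generalize jacobiSn x k = S at *
  generalize jacobiCn x k = C at *
  generalize jacobiDn x k = D at *
  generalize jacobiSn δ k = s at *
  generalize jacobiCn δ k = c at *
  generalize jacobiDn δ k = d at *
  have e1 : (2 * c * s * D) * (ν₁ * C - ν₂ * S * d) = 0 := by
    linear_combination jacobiDen k x δ * (hT - hT') - c * ν₁ * (a1 - b1) - c * ν₂ * (a2 - b2)
  have e2 : ν₁ * C - ν₂ * S * d = 0 := by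
    rcases mul_eq_zero.1 e1 with h | h
    · exact absurd h (by positivity)
    · exact h
  have e3 : A * jacobiDen k x δ = - c * (ν₁ * S * c * d + ν₂ * C * c) := by
    linear_combination jacobiDen k x δ * (hT + hT') / 2 - c * ν₁ * (a1 + b1) / 2
      - c * ν₂ * (a2 + b2) / 2
  have e4 : ν₁ * C = ν₂ * S * d := by linarith
  rw [zero_mul]
  have : (d * ν₁ * C - (1 - k ^ 2) * ν₂ * S) * jacobiDen k x δ +
      k ^ 2 * (S * C) * (A * jacobiDen k x δ) = 0 := by
    rw [e3, hΔ]
    linear_combination (d * (1 - k ^ 2 * S ^ 2 * s ^ 2) - k ^ 2 * S ^ 2 * c ^ 2 * d) * e4 +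
      ν₂ * S * (1 - k ^ 2 * S ^ 2 * s ^ 2) * h1 - k ^ 2 * S * ν₂ * (1 - k ^ 2 * S ^ 2 * s ^ 2) * h4 -
      k ^ 2 * S * ν₂ * c ^ 2 * (S ^ 2 * h1 + h2)
  linarith

/-- The common factor vanishes for every tangent `x` that touches the circle with the same
orientation as `p - δ` and either differs from it or touches the circle on the conic. -/
lemma factor_eq_zero (hk : k ∈ Ioo (0 : ℝ) 1) {A ν₁ ν₂ δ p ρ x h : ℝ}
    (hT : meshT k A ν₁ ν₂ δ p = 0) (hW : meshW k ν₁ ν₂ δ p = -ρ)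
    (hx : circM k A (jacobiDn δ k * ν₁) ν₂ x = ρ * jacobiDn x k)
    (hc : SamePar k x (p - δ) → ContactAt k A (jacobiDn δ k * ν₁) ν₂ x)
    (hh : h = (jacobiAm k (x - δ) - jacobiAm k p) / 2) :
    (ν₁ * jacobiSn p k + ν₂ * jacobiCn p k) * Real.sin h +
      (ν₂ * jacobiSn p k - ν₁ * jacobiCn p k) * Real.cos h = 0 := by
  obtain ⟨κ, hκ, k1, k2, k3, k4⟩ := exists_half_angle hk x δ
  have hκ0 : κ ≠ 0 := by
    rintro rfl
    have := jacobiDen_pos hk x δ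
    rw [← hκ] at this
    simp at this
  by_cases hs : SamePar k x (p - δ)
  · have hc' := hc hs
    obtain ⟨j, hj⟩ := (samePar_iff hk).1 hs
    have hp : SamePar k p (x + δ) := (samePar_iff hk).2 ⟨-j, by rw [hj]; push_cast; ring⟩
    rw [meshT_congr hp] at hT
    have hV := contact_imp hk hT hc'
    have hV2 : (ν₁ * Real.cos ((jacobiAm k (x + δ) + jacobiAm k (x - δ)) / 2) -
        ν₂ * Real.sin ((jacobiAm k (x + δ) + jacobiAm k (x - δ)) / 2)) = 0 := by
      apply mul_left_cancel₀ hκ0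
      linear_combination hV - ν₁ * k3 + ν₂ * k4
    have hp' : jacobiAm k (x + δ) = jacobiAm k p + j * (2 * Real.pi) := by
      rw [← jacobiAm_add_four_K hk, hj]; congr 1; ring
    have e : (jacobiAm k (x + δ) + jacobiAm k (x - δ)) / 2 = jacobiAm k p + h + j * Real.pi := by
      rw [hh, hp']; ring
    rw [e, Real.cos_add_int_mul_pi, Real.sin_add_int_mul_pi, Real.cos_add, Real.sin_add] at hV2
    have hj0 : ((-1 : ℝ) ^ j) ≠ 0 := zpow_ne_zero _ (by norm_num)
    apply mul_left_cancel₀ hj0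
    unfold jacobiSn jacobiCn
    linear_combination -hV2
  · obtain ⟨f1, f2⟩ := mesh_factor hT hW (x - δ) h hh
    set Φ := (ν₁ * jacobiSn p k + ν₂ * jacobiCn p k) * Real.sin h +
      (ν₂ * jacobiSn p k - ν₁ * jacobiCn p k) * Real.cos h
    have e := circM_add hk A ν₁ ν₂ δ (x - δ)
    rw [sub_add_cancel, hx] at e
    have e2 : Φ * (jacobiCn δ k * Real.sin h + jacobiDn x k * jacobiSn δ k * Real.cos h) = 0 := by
      linear_combination (1 / 2) * (f1 + jacobiDn x k * f2 + e)
    rcases mul_eq_zero.1 e2 with h0 | h0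
    · exact h0
    · exfalso
      apply hs
      rw [k1, k2] at h0
      have e3 : Real.sin (h + (jacobiAm k (x + δ) - jacobiAm k (x - δ)) / 2) = 0 := by
        apply mul_left_cancel₀ hκ0
        rw [Real.sin_add]
        linear_combination h0
      obtain ⟨j, hj⟩ := Real.sin_eq_zero_iff.1 e3
      have e4 : jacobiAm k (x + δ) = jacobiAm k (p + j * (4 * ellipticK k)) := by
        rw [jacobiAm_add_four_K hk]
        rw [hh] at hj
        linarith
      have e5 := (strictMono_jacobiAm hk).injective e4
      exact (samePar_iff hk).2 ⟨j, by linarith⟩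

/-- If four tangents of the conic touch a circle, lying between the first two and between the
last two of them, then the increments of the parameters agree up to sign. -/
theorem CircData.meshRel (hk : k ∈ Ioo (0 : ℝ) 1) {A B G ρ τ₁ τ₂ σ₁ σ₂ : ℝ}
    (h : CircData k A B G ρ τ₁ τ₂ σ₁ σ₂) : MeshRel k (τ₂ - τ₁) (σ₂ - σ₁) := by
  -- it suffices to treat the case that `σ₁` has the orientation of `τ₁`
  wlog hσ : circM k A B G σ₁ = ρ * jacobiDn σ₁ k ∧ circM k A B G σ₂ = -ρ * jacobiDn σ₂ k
    generalizing σ₁ σ₂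
  · have h' := (this h.swap ((h.other.resolve_left hσ).symm)).neg_right
    rwa [neg_sub] at h'
  obtain ⟨g1, g2⟩ := hσ
  by_cases hboth : SamePar k τ₁ σ₁ ∧ SamePar k τ₂ σ₂
  · obtain ⟨i, hi⟩ := (samePar_iff hk).1 hboth.1
    obtain ⟨j, hj⟩ := (samePar_iff hk).1 hboth.2
    exact ⟨j - i, Or.inl (by rw [hi, hj]; push_cast; ring)⟩
  obtain ⟨δ, hδ⟩ : ∃ δ, δ = (τ₂ - τ₁) / 2 := ⟨_, rfl⟩
  obtain ⟨p, hp⟩ : ∃ p, p = (τ₁ + τ₂) / 2 := ⟨_, rfl⟩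
  have t1 : τ₁ = p - δ := by rw [hp, hδ]; ring
  have t2 : τ₂ = p + δ := by rw [hp, hδ]; ring
  have hd := jacobiDn_pos hk δ
  obtain ⟨ν₁, rfl⟩ : ∃ ν₁, B = jacobiDn δ k * ν₁ := ⟨B / jacobiDn δ k, by field_simp⟩
  have o1 := h.one
  have o2 := h.two
  rw [t1] at o1
  rw [t2] at o2
  obtain ⟨hT, hW⟩ := meshT_eq_zero_of_circM hk o1 o2
  obtain ⟨h1, hh1⟩ : ∃ h1, h1 = (jacobiAm k (σ₁ - δ) - jacobiAm k p) / 2 := ⟨_, rfl⟩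
  obtain ⟨h2, hh2⟩ : ∃ h2, h2 = (jacobiAm k (σ₂ - -δ) - jacobiAm k p) / 2 := ⟨_, rfl⟩
  have F1 := factor_eq_zero hk hT hW g1 (fun hs => by
    rw [← t1] at hs
    rcases h.c11 hs.symm with h' | h'
    · exact hs.contactAt h'
    · exact absurd ⟨hs.symm, h'⟩ hboth) hh1
  have hT' : meshT k A ν₁ G (-δ) p = 0 := by
    rw [← hT]; simp [meshT, jacobiCn_neg hk]
  have hW' : meshW k ν₁ G (-δ) p = -(-ρ) := by
    rw [← hW]; simp [meshW, jacobiSn_neg hk]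
  have F2 := factor_eq_zero hk hT' hW' (by rw [jacobiDn_neg hk]; exact g2) (fun hs => by
    rw [jacobiDn_neg hk]
    rw [sub_neg_eq_add, ← t2] at hs
    rcases h.c22 hs.symm with h' | h'
    · exact hs.contactAt h'
    · exact absurd ⟨h', hs.symm⟩ hboth) hh2
  have hY : G * jacobiSn p k - ν₁ * jacobiCn p k ≠ 0 := by
    intro h0
    apply h.ne
    have : meshW k ν₁ G δ p = 0 := by
      unfold meshW
      linear_combination (-jacobiSn δ k) * h0
    linarith
  have F3 : Real.sin (h2 - h1) = 0 := by
    apply mul_left_cancel₀ hY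
    rw [Real.sin_sub]
    linear_combination Real.sin h2 * F1 - Real.sin h1 * F2
  obtain ⟨j, hj⟩ := Real.sin_eq_zero_iff.1 F3
  have e4 : jacobiAm k (σ₂ + δ) = jacobiAm k (σ₁ - δ + j * (4 * ellipticK k)) := by
    rw [jacobiAm_add_four_K hk]
    rw [hh1, hh2, sub_neg_eq_add] at hj
    linarith
  have e5 := (strictMono_jacobiAm hk).injective e4
  refine ⟨j, Or.inr ?_⟩
  have : τ₂ - τ₁ = 2 * δ := by rw [hδ]; ring
  linarith

lemma circData_of_mesh (hk : k ∈ Ioo (0 : ℝ) 1) {A ν₁ ν₂ δ p q ρ : ℝ} (hρ : ρ ≠ 0)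
    (hc0 : jacobiCn δ k ≠ 0) (hs0 : jacobiSn δ k ≠ 0)
    (hTp : meshT k A ν₁ ν₂ δ p = 0) (hWp : meshW k ν₁ ν₂ δ p = -ρ)
    (hTq : meshT k A ν₁ ν₂ δ q = 0)
    (hWq : meshW k ν₁ ν₂ δ q = ρ ∨ SamePar k p q) :
    CircData k A (jacobiDn δ k * ν₁) ν₂ ρ (p - δ) (p + δ) (q - δ) (q + δ) := by
  have o1 : circM k A (jacobiDn δ k * ν₁) ν₂ (p - δ) = ρ * jacobiDn (p - δ) k := by
    rw [circM_sub hk, hTp, hWp]; ring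
  have o2 : circM k A (jacobiDn δ k * ν₁) ν₂ (p + δ) = -ρ * jacobiDn (p + δ) k := by
    rw [circM_add hk, hTp, hWp]; ring
  have hne : ∀ {x y : ℝ}, circM k A (jacobiDn δ k * ν₁) ν₂ x = ρ * jacobiDn x k →
      circM k A (jacobiDn δ k * ν₁) ν₂ y = -ρ * jacobiDn y k → ¬ SamePar k x y := by
    intro x y hx hy hs
    rw [hs.circM, hs.dn, hy] at hx
    have := jacobiDn_pos hk y
    apply hρ
    apply mul_right_cancel₀ this.ne'
    linarith
  rcases hWq with hWq | hpq
  · have o3 : circM k A (jacobiDn δ k * ν₁) ν₂ (q - δ) = -ρ * jacobiDn (q - δ) k := by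
      rw [circM_sub hk, hTq, hWq]; ring
    have o4 : circM k A (jacobiDn δ k * ν₁) ν₂ (q + δ) = ρ * jacobiDn (q + δ) k := by
      rw [circM_add hk, hTq, hWq]; ring
    refine ⟨hρ, o1, o2, Or.inr ⟨o3, o4⟩, fun h => absurd h (hne o1 o3), fun h => Or.inl ?_,
      fun h => Or.inl ?_, fun h => absurd h.symm (hne o4 o2)⟩
    · refine contact_of hk hc0 hs0 (by rwa [sub_add_cancel]) ?_
      have := h.sub hk δ
      rw [add_sub_cancel_right] at this
      rwa [meshT_congr this]
    · refine contact_of hk hc0 hs0 ?_ (by rwa [add_sub_cancel_right])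
      have := h.add hk δ
      rw [sub_add_cancel] at this
      rwa [meshT_congr this]
  · have o3 : circM k A (jacobiDn δ k * ν₁) ν₂ (q - δ) = ρ * jacobiDn (q - δ) k := by
      rw [← (hpq.sub hk δ).circM, ← (hpq.sub hk δ).dn, o1]
    have o4 : circM k A (jacobiDn δ k * ν₁) ν₂ (q + δ) = -ρ * jacobiDn (q + δ) k := by
      rw [← (hpq.add hk δ).circM, ← (hpq.add hk δ).dn, o2]
    exact ⟨hρ, o1, o2, Or.inl ⟨o3, o4⟩, fun h => Or.inr (hpq.add hk δ),
      fun h => absurd h (hne o1 o4), fun h => absurd h.symm (hne o3 o2),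
      fun h => Or.inr (hpq.sub hk δ)⟩

lemma cos_half_sub_eq_zero_iff (hk : k ∈ Ioo (0 : ℝ) 1) {x y : ℝ} :
    Real.cos ((jacobiAm k x - jacobiAm k y) / 2) = 0 ↔
      ∃ j : ℤ, x = y + (2 * j + 1) * (2 * ellipticK k) := by
  rw [Real.cos_eq_zero_iff]
  refine exists_congr fun j => ?_
  constructor
  · intro h
    have := jacobiAm_eq_add_int_mul_pi hk (s := x) (t := y) (j := 2 * j + 1)
      (by push_cast; linarith)
    rw [this]; push_cast; ring
  · intro h
    have := jacobiAm_add_int_mul hk y (2 * j + 1)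
    push_cast at this
    rw [h, this]
    ring

lemma sn_eq_zero_imp (hk : k ∈ Ioo (0 : ℝ) 1) {x : ℝ} (h : jacobiSn x k = 0) :
    ∃ j : ℤ, x = j * (2 * ellipticK k) := by
  obtain ⟨j, hj⟩ := Real.sin_eq_zero_iff.1 h
  refine ⟨j, ?_⟩
  have := jacobiAm_eq_add_int_mul_pi hk (s := x) (t := 0) (j := j) (by rw [jacobiAm_zero hk]; linarith)
  linarith

lemma cn_eq_zero_imp (hk : k ∈ Ioo (0 : ℝ) 1) {x : ℝ} (h : jacobiCn x k = 0) :
    ∃ j : ℤ, x = (2 * j + 1) * ellipticK k := by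
  obtain ⟨j, hj⟩ := Real.cos_eq_zero_iff.1 h
  refine ⟨j, ?_⟩
  have := jacobiAm_eq_add_int_mul_pi hk (s := x) (t := ellipticK k) (j := j)
    (by rw [jacobiAm_ellipticK hk, show jacobiAm k x = _ from hj]; ring)
  rw [this]; ring

/-- If `ν` is a multiple of `(sin O, cos O)`, where `O` is half the sum of the amplitudes of `p` and
`q`, then `T(p) = T(q)` and `W(p) = -W(q)`, as required for four tangents `p ± δ`, `q ± δ` of a
circle. -/
lemma meshT_bisector (A r δ p q : ℝ) :
    meshT k A (r * Real.sin ((jacobiAm k p + jacobiAm k q) / 2))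
        (r * Real.cos ((jacobiAm k p + jacobiAm k q) / 2)) δ p =
      A + jacobiCn δ k * r * Real.cos ((jacobiAm k p - jacobiAm k q) / 2) ∧
    meshT k A (r * Real.sin ((jacobiAm k p + jacobiAm k q) / 2))
        (r * Real.cos ((jacobiAm k p + jacobiAm k q) / 2)) δ q =
      A + jacobiCn δ k * r * Real.cos ((jacobiAm k p - jacobiAm k q) / 2) ∧
    meshW k (r * Real.sin ((jacobiAm k p + jacobiAm k q) / 2))
        (r * Real.cos ((jacobiAm k p + jacobiAm k q) / 2)) δ p =
      -(jacobiSn δ k * r * Real.sin ((jacobiAm k p - jacobiAm k q) / 2)) ∧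
    meshW k (r * Real.sin ((jacobiAm k p + jacobiAm k q) / 2))
        (r * Real.cos ((jacobiAm k p + jacobiAm k q) / 2)) δ q =
      jacobiSn δ k * r * Real.sin ((jacobiAm k p - jacobiAm k q) / 2) := by
  obtain ⟨P, hP⟩ : ∃ P, P = (jacobiAm k p + jacobiAm k q) / 2 := ⟨_, rfl⟩
  obtain ⟨Q, hQ⟩ : ∃ Q, Q = (jacobiAm k p - jacobiAm k q) / 2 := ⟨_, rfl⟩
  have h1 : jacobiAm k p = P + Q := by rw [hP, hQ]; ring
  have h2 : jacobiAm k q = P - Q := by rw [hP, hQ]; ring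
  have h3 := Real.sin_sq_add_cos_sq P
  rw [← hP, ← hQ]
  simp only [meshT, meshW, jacobiSn, jacobiCn, h1, h2, Real.sin_add, Real.cos_add, Real.sin_sub,
    Real.cos_sub]
  refine ⟨?_, ?_, ?_, ?_⟩
  · linear_combination (Real.cos (jacobiAm k δ) * r * Real.cos Q) * h3
  · linear_combination (Real.cos (jacobiAm k δ) * r * Real.cos Q) * h3
  · linear_combination (-Real.sin (jacobiAm k δ) * r * Real.sin Q) * h3
  · linear_combination (Real.sin (jacobiAm k δ) * r * Real.sin Q) * h3

lemma samePar_of_sin_half (hk : k ∈ Ioo (0 : ℝ) 1) {p q : ℝ}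
    (h : Real.sin ((jacobiAm k p - jacobiAm k q) / 2) = 0) : SamePar k p q := by
  obtain ⟨j, hj⟩ := Real.sin_eq_zero_iff.1 h
  have := jacobiAm_eq_add_int_mul_pi hk (s := p) (t := q) (j := 2 * j) (by push_cast; linarith)
  exact (samePar_iff hk).2 ⟨j, by rw [this]; push_cast; ring⟩

/-- Normalisation `A = -1`, as required for an ellipse. -/
lemma exists_circData_ellipse_aux (hk : k ∈ Ioo (0 : ℝ) 1) {δ p q : ℝ}
    (hc0 : jacobiCn δ k ≠ 0) (hs0 : jacobiSn δ k ≠ 0)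
    (hpq : Real.cos ((jacobiAm k p - jacobiAm k q) / 2) ≠ 0) :
    ∃ B G ρ, CircData k (-1) B G ρ (p - δ) (p + δ) (q - δ) (q + δ) := by
  by_cases hsin : Real.sin ((jacobiAm k p - jacobiAm k q) / 2) = 0
  · have hs := samePar_of_sin_half hk hsin
    obtain ⟨ν₁, hν₁⟩ : ∃ ν₁, ν₁ = jacobiSn p k / jacobiCn δ k + jacobiCn p k := ⟨_, rfl⟩
    obtain ⟨ν₂, hν₂⟩ : ∃ ν₂, ν₂ = jacobiCn p k / jacobiCn δ k - jacobiSn p k := ⟨_, rfl⟩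
    have h1 := jacobi_sn_sq_add_cn_sq k p
    have hT : meshT k (-1) ν₁ ν₂ δ p = 0 := by
      unfold meshT
      rw [hν₁, hν₂]
      field_simp
      linear_combination h1
    refine ⟨_, _, -jacobiSn δ k, circData_of_mesh hk (ν₁ := ν₁) (ν₂ := ν₂) (neg_ne_zero.2 hs0) hc0 hs0 hT
      ?_ (by rw [← meshT_congr hs]; exact hT) (Or.inr hs)⟩
    unfold meshW
    rw [hν₁, hν₂]
    field_simp
    linear_combination jacobiCn δ k * h1
  · obtain ⟨r, hr⟩ : ∃ r, r = 1 / (jacobiCn δ k * Real.cos ((jacobiAm k p - jacobiAm k q) / 2)) :=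
      ⟨_, rfl⟩
    have hr0 : r ≠ 0 := by rw [hr]; positivity
    obtain ⟨e1, e2, e3, e4⟩ := meshT_bisector (k := k) (-1) r δ p q
    have e0 : -1 + jacobiCn δ k * r * Real.cos ((jacobiAm k p - jacobiAm k q) / 2) = 0 := by
      rw [hr]; field_simp; norm_num
    exact ⟨_, _, _, circData_of_mesh hk (mul_ne_zero (mul_ne_zero hs0 hr0) hsin) hc0 hs0
      (e1.trans e0) e3 (e2.trans e0) (Or.inl e4)⟩

/-- Normalisation `B = -1`, as required for a hyperbola. -/
lemma exists_circData_hyperbola_aux (hk : k ∈ Ioo (0 : ℝ) 1) {δ p q : ℝ}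
    (hc0 : jacobiCn δ k ≠ 0) (hs0 : jacobiSn δ k ≠ 0)
    (hpq : Real.sin ((jacobiAm k p + jacobiAm k q) / 2) ≠ 0) :
    ∃ A G ρ, CircData k A (-1) G ρ (p - δ) (p + δ) (q - δ) (q + δ) := by
  have hd := jacobiDn_pos hk δ
  by_cases hsin : Real.sin ((jacobiAm k p - jacobiAm k q) / 2) = 0
  · have hs := samePar_of_sin_half hk hsin
    have hS : jacobiSn p k ≠ 0 := by
      obtain ⟨j, hj⟩ := Real.sin_eq_zero_iff.1 hsin
      have : jacobiAm k p = (jacobiAm k p + jacobiAm k q) / 2 + j * Real.pi := by linarith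
      unfold jacobiSn
      rw [this, Real.sin_add_int_mul_pi]
      exact mul_ne_zero (zpow_ne_zero _ (by norm_num)) hpq
    obtain ⟨ν₁, hν₁⟩ : ∃ ν₁, ν₁ = -1 / jacobiDn δ k := ⟨_, rfl⟩
    obtain ⟨ν₂, hν₂⟩ : ∃ ν₂, ν₂ = (ν₁ * jacobiCn p k - 1) / jacobiSn p k := ⟨_, rfl⟩
    have hB : jacobiDn δ k * ν₁ = -1 := by rw [hν₁]; field_simp
    obtain ⟨A, hA⟩ : ∃ A, A = -(jacobiCn δ k * (ν₁ * jacobiSn p k + ν₂ * jacobiCn p k)) := ⟨_, rfl⟩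
    have hT : meshT k A ν₁ ν₂ δ p = 0 := by unfold meshT; rw [hA]; ring
    have := circData_of_mesh hk (ρ := -jacobiSn δ k) (neg_ne_zero.2 hs0) hc0 hs0 hT
      (by unfold meshW; rw [hν₂]; field_simp; ring) (by rw [← meshT_congr hs]; exact hT)
      (Or.inr hs)
    rw [hB] at this
    exact ⟨_, _, _, this⟩
  · obtain ⟨r, hr⟩ : ∃ r, r = -1 / (jacobiDn δ k * Real.sin ((jacobiAm k p + jacobiAm k q) / 2)) :=
      ⟨_, rfl⟩
    have hr0 : r ≠ 0 := by
      rw [hr]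
      exact div_ne_zero (by norm_num) (mul_ne_zero hd.ne' hpq)
    obtain ⟨A, hA⟩ : ∃ A, A = -(jacobiCn δ k * r *
      Real.cos ((jacobiAm k p - jacobiAm k q) / 2)) := ⟨_, rfl⟩
    obtain ⟨e1, e2, e3, e4⟩ := meshT_bisector (k := k) A r δ p q
    have e0 : A + jacobiCn δ k * r * Real.cos ((jacobiAm k p - jacobiAm k q) / 2) = 0 := by
      rw [hA]; ring
    have := circData_of_mesh hk (mul_ne_zero (mul_ne_zero hs0 hr0) hsin) hc0 hs0
      (e1.trans e0) e3 (e2.trans e0) (Or.inl e4)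
    have hB : jacobiDn δ k * (r * Real.sin ((jacobiAm k p + jacobiAm k q) / 2)) = -1 := by
      rw [hr]; field_simp
    rw [hB] at this
    exact ⟨_, _, _, this⟩

/-- The lines with parameters `τ` and `σ`, of different families, are not parallel. -/
def FinPar (k τ σ : ℝ) : Prop := Real.cos ((jacobiAm k τ - jacobiAm k σ) / 2) ≠ 0

lemma FinPar.congr (hk : k ∈ Ioo (0 : ℝ) 1) {x y x' y' : ℝ} (h : FinPar k x y)
    (h' : x - y = x' - y') : FinPar k x' y' := by
  unfold FinPar at *
  rw [Ne, cos_half_sub_eq_zero_iff hk] at *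
  rintro ⟨j, hj⟩
  exact h ⟨j, by linarith⟩

lemma sn_cn_half_ne_zero (hk : k ∈ Ioo (0 : ℝ) 1) {x : ℝ}
    (h : ∀ j : ℤ, x ≠ j * (2 * ellipticK k)) :
    jacobiSn (x / 2) k ≠ 0 ∧ jacobiCn (x / 2) k ≠ 0 := by
  constructor
  · intro h0
    obtain ⟨j, hj⟩ := sn_eq_zero_imp hk h0
    exact h (2 * j) (by push_cast; linarith)
  · intro h0
    obtain ⟨j, hj⟩ := cn_eq_zero_imp hk h0
    exact h (2 * j + 1) (by push_cast; linarith)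

/-- Four tangents of an ellipse whose parameters have equal increments touch a circle. The finiteness
of two opposite vertices makes the constant coefficient of the linear form nonzero. -/
theorem exists_circData_ellipse (hk : k ∈ Ioo (0 : ℝ) 1) {τ₁ τ₂ σ₁ σ₂ : ℝ}
    (hrel : MeshRel k (τ₂ - τ₁) (σ₂ - σ₁)) (hδ : ∀ j : ℤ, τ₂ - τ₁ ≠ j * (2 * ellipticK k))
    (h1 : FinPar k τ₁ σ₁) (h2 : FinPar k τ₂ σ₁) :
    ∃ B G ρ, CircData k (-1) B G ρ τ₁ τ₂ σ₁ σ₂ := by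
  obtain ⟨hs0, hc0⟩ := sn_cn_half_ne_zero hk hδ
  have t1 : (τ₁ + τ₂) / 2 - (τ₂ - τ₁) / 2 = τ₁ := by ring
  have t2 : (τ₁ + τ₂) / 2 + (τ₂ - τ₁) / 2 = τ₂ := by ring
  obtain ⟨j, h | h⟩ := hrel
  · obtain ⟨B, G, ρ, hD⟩ := exists_circData_ellipse_aux hk (p := (τ₁ + τ₂) / 2)
      (q := σ₁ + (τ₂ - τ₁) / 2) hc0 hs0 (h1.congr hk (by ring))
    rw [t1, t2, add_sub_cancel_right] at hD
    exact ⟨B, G, ρ, hD.congr_right ((samePar_iff hk).2 ⟨j, by linarith⟩)⟩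
  · obtain ⟨B, G, ρ, hD⟩ := exists_circData_ellipse_aux hk (p := (τ₁ + τ₂) / 2)
      (q := σ₁ - (τ₂ - τ₁) / 2) hc0 hs0 (h2.congr hk (by ring))
    rw [t1, t2, sub_add_cancel] at hD
    exact ⟨B, G, ρ, hD.swap.congr_right ((samePar_iff hk).2 ⟨-j, by push_cast; linarith⟩)⟩

/-- Four tangents of a hyperbola whose parameters have equal increments touch a circle. The two
families are parametrised in opposite directions, and the coefficient of `sn` is nonzero. -/
theorem exists_circData_hyperbola (hk : k ∈ Ioo (0 : ℝ) 1) {τ₁ τ₂ σ₁ σ₂ : ℝ}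
    (hrel : MeshRel k (τ₂ - τ₁) (σ₂ - σ₁)) (hδ : ∀ j : ℤ, τ₂ - τ₁ ≠ j * (2 * ellipticK k))
    (h1 : FinPar k τ₁ σ₁) (h2 : FinPar k τ₂ σ₁) :
    ∃ A G ρ, CircData k A (-1) G ρ τ₁ τ₂ (2 * ellipticK k - σ₁) (2 * ellipticK k - σ₂) := by
  obtain ⟨hs0, hc0⟩ := sn_cn_half_ne_zero hk hδ
  have t1 : (τ₁ + τ₂) / 2 - (τ₂ - τ₁) / 2 = τ₁ := by ring
  have t2 : (τ₁ + τ₂) / 2 + (τ₂ - τ₁) / 2 = τ₂ := by ring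
  have hsin : ∀ x y, FinPar k x y →
      Real.sin ((jacobiAm k x + jacobiAm k (2 * ellipticK k - y)) / 2) ≠ 0 := by
    intro x y h
    rw [jacobiAm_two_K_sub hk, show (jacobiAm k x + (Real.pi - jacobiAm k y)) / 2 =
      (jacobiAm k x - jacobiAm k y) / 2 + Real.pi / 2 by ring, Real.sin_add_pi_div_two]
    exact h
  obtain ⟨j, h | h⟩ := hrel
  · obtain ⟨B, G, ρ, hD⟩ := exists_circData_hyperbola_aux hk (p := (τ₁ + τ₂) / 2)
      (q := 2 * ellipticK k - (σ₁ + (τ₂ - τ₁) / 2)) hc0 hs0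
      (hsin _ _ (h1.congr hk (by ring)))
    rw [t1, t2, show 2 * ellipticK k - (σ₁ + (τ₂ - τ₁) / 2) + (τ₂ - τ₁) / 2 =
      2 * ellipticK k - σ₁ by ring] at hD
    exact ⟨B, G, ρ, hD.swap.congr_right ((samePar_iff hk).2 ⟨-j, by push_cast; linarith⟩)⟩
  · obtain ⟨B, G, ρ, hD⟩ := exists_circData_hyperbola_aux hk (p := (τ₁ + τ₂) / 2)
      (q := 2 * ellipticK k - (σ₁ - (τ₂ - τ₁) / 2)) hc0 hs0
      (hsin _ _ (h2.congr hk (by ring)))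
    rw [t1, t2, show 2 * ellipticK k - (σ₁ - (τ₂ - τ₁) / 2) - (τ₂ - τ₁) / 2 =
      2 * ellipticK k - σ₁ by ring] at hD
    exact ⟨B, G, ρ, hD.congr_right ((samePar_iff hk).2 ⟨j, by linarith⟩)⟩

end Core

/-! ### Lines and rulings -/

section Lines

variable {E F : Type} [NormedAddCommGroup E] [InnerProductSpace ℝ E]
  [NormedAddCommGroup F] [InnerProductSpace ℝ F]

/-- The line through `P` with direction `V`. -/
def lineThrough (P V : E) : AffineSubspace ℝ E := AffineSubspace.mk' P (Submodule.span ℝ {V})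

lemma mem_lineThrough {P V Q : E} : Q ∈ lineThrough P V ↔ ∃ t : ℝ, Q = P + t • V := by
  rw [lineThrough, AffineSubspace.mem_mk', Submodule.mem_span_singleton]
  refine exists_congr fun t => ?_
  rw [vsub_eq_sub, eq_sub_iff_add_eq', eq_comm]

lemma self_mem_lineThrough (P V : E) : P ∈ lineThrough P V :=
  mem_lineThrough.2 ⟨0, by simp⟩

lemma direction_lineThrough (P V : E) : (lineThrough P V).direction = Submodule.span ℝ {V} :=
  AffineSubspace.direction_mk' _ _

lemma finrank_lineThrough {P V : E} (hV : V ≠ 0) :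
    Module.finrank ℝ (lineThrough P V).direction = 1 := by
  rw [direction_lineThrough, finrank_span_singleton hV]

lemma map_lineThrough (P V : E) (f : E →ᵃ[ℝ] F) :
    (lineThrough P V).map f = lineThrough (f P) (f.linear V) := by
  rw [lineThrough, AffineSubspace.map_mk', Submodule.map_span, image_singleton, lineThrough]

lemma exists_eq_lineThrough {L : AffineSubspace ℝ E} (h : Module.finrank ℝ L.direction = 1)
    {P : E} (hP : P ∈ L) : ∃ V : E, V ≠ 0 ∧ L = lineThrough P V := by
  obtain ⟨⟨V, hV⟩, hne, hspan⟩ := finrank_eq_one_iff'.1 h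
  refine ⟨V, fun h0 => hne (Subtype.ext h0), ?_⟩
  ext Q
  rw [mem_lineThrough]
  constructor
  · intro hQ
    obtain ⟨t, ht⟩ := hspan ⟨Q -ᵥ P, AffineSubspace.vsub_mem_direction hQ hP⟩
    have ht' : t • V = Q - P := congrArg Subtype.val ht
    exact ⟨t, by rw [ht']; abel⟩
  · rintro ⟨t, rfl⟩
    have := AffineSubspace.vadd_mem_of_mem_direction (L.direction.smul_mem t hV) hP
    rwa [vadd_eq_add, add_comm] at this

lemma lineThrough_eq_of {P V Q W : E} {t x : ℝ} (hQ : Q = P + t • V) (hW : W = x • V)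
    (hx : x ≠ 0) : lineThrough P V = lineThrough Q W := by
  ext R
  rw [mem_lineThrough, mem_lineThrough, hQ, hW]
  constructor
  · rintro ⟨y, rfl⟩
    refine ⟨(y - t) / x, ?_⟩
    rw [smul_smul, div_mul_cancel₀ _ hx, add_assoc, ← add_smul]
    congr 2
    ring
  · rintro ⟨y, rfl⟩
    refine ⟨t + y * x, ?_⟩
    rw [add_smul, mul_smul, add_assoc]

end Lines

lemma exists_angle {x y : ℝ} (h : x ^ 2 + y ^ 2 = 1) : ∃ φ, Real.sin φ = x ∧ Real.cos φ = y := by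
  have hn : ‖(⟨y, x⟩ : ℂ)‖ = 1 := by
    rw [Complex.norm_def, Complex.normSq_mk, show y * y + x * x = 1 by linarith, Real.sqrt_one]
  have h0 : (⟨y, x⟩ : ℂ) ≠ 0 := norm_ne_zero_iff.1 (by rw [hn]; norm_num)
  exact ⟨Complex.arg ⟨y, x⟩, by rw [Complex.sin_arg, hn, div_one],
    by rw [Complex.cos_arg h0, hn, div_one]⟩

lemma E3.ext {P Q : E3} (h0 : P 0 = Q 0) (h1 : P 1 = Q 1) (h2 : P 2 = Q 2) : P = Q := by
  ext i
  fin_cases i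
  · exact h0
  · exact h1
  · exact h2

lemma E2.ext {P Q : E2} (h0 : P 0 = Q 0) (h1 : P 1 = Q 1) : P = Q := by
  ext i
  fin_cases i
  · exact h0
  · exact h1

/-- The straight line with angle `φ` in the family `ε = ±1` on the hyperboloid
`x²/p² + y²/q² - z²/r² = 1`. It passes through the point `(p sin φ, q cos φ, 0)`. -/
def ruling (p q r ε φ : ℝ) : AffineSubspace ℝ E3 :=
  lineThrough !₂[p * Real.sin φ, q * Real.cos φ, 0]
    !₂[p * (ε * Real.cos φ), -(q * (ε * Real.sin φ)), r]

/-- The intersection of the line `φ` of the family `ε` with the line `χ` of the family `-ε`. -/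
def rulingVertex (p q r ε φ χ : ℝ) : E3 :=
  !₂[p * (Real.sin ((φ + χ) / 2) / Real.cos ((φ - χ) / 2)),
    q * (Real.cos ((φ + χ) / 2) / Real.cos ((φ - χ) / 2)),
    -(r * (ε * (Real.sin ((φ - χ) / 2) / Real.cos ((φ - χ) / 2))))]

/-- The grid of straight lines on a hyperboloid with given sequences of angles. -/
def rulingGrid (p q r ε : ℝ) (φ χ : ℤ → ℝ) : LineGrid E3 where
  fst n := ruling p q r ε (φ n)
  snd n := ruling p q r (-ε) (χ n)
  vertex n n' := rulingVertex p q r ε (φ n) (χ n')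

section Rulings

variable {p q r ε φ χ : ℝ}

lemma mem_ruling {P : E3} : P ∈ ruling p q r ε φ ↔
    ∃ t : ℝ, P 0 = p * (Real.sin φ + t * (ε * Real.cos φ)) ∧
      P 1 = q * (Real.cos φ - t * (ε * Real.sin φ)) ∧ P 2 = r * t := by
  rw [ruling, mem_lineThrough]
  refine exists_congr fun t => ?_
  constructor
  · rintro rfl
    refine ⟨?_, ?_, ?_⟩ <;> simp <;> ring
  · rintro ⟨h0, h1, h2⟩
    apply E3.ext
    · rw [h0]; simp; ring
    · rw [h1]; simp; ring
    · rw [h2]; simp; ring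

lemma sin_half_identities (φ χ : ℝ) :
    Real.sin ((φ + χ) / 2) = Real.sin φ * Real.cos ((φ - χ) / 2) -
      Real.cos φ * Real.sin ((φ - χ) / 2) ∧
    Real.cos ((φ + χ) / 2) = Real.cos φ * Real.cos ((φ - χ) / 2) +
      Real.sin φ * Real.sin ((φ - χ) / 2) ∧
    Real.sin ((φ + χ) / 2) = Real.sin χ * Real.cos ((φ - χ) / 2) +
      Real.cos χ * Real.sin ((φ - χ) / 2) ∧
    Real.cos ((φ + χ) / 2) = Real.cos χ * Real.cos ((φ - χ) / 2) -
      Real.sin χ * Real.sin ((φ - χ) / 2) := by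
  refine ⟨?_, ?_, ?_, ?_⟩
  · rw [← Real.sin_sub]; congr 1; ring
  · rw [← Real.cos_sub]; congr 1; ring
  · rw [← Real.sin_add]; congr 1; ring
  · rw [← Real.cos_add]; congr 1; ring

lemma rulingVertex_mem (hε : ε = 1 ∨ ε = -1) (h : Real.cos ((φ - χ) / 2) ≠ 0) :
    rulingVertex p q r ε φ χ ∈ ruling p q r ε φ ∧
      rulingVertex p q r ε φ χ ∈ ruling p q r (-ε) χ := by
  obtain ⟨h1, h2, h3, h4⟩ := sin_half_identities φ χ
  have hε2 : ε * ε = 1 := by rcases hε with rfl | rfl <;> norm_num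
  constructor
  · refine mem_ruling.2 ⟨-(ε * (Real.sin ((φ - χ) / 2) / Real.cos ((φ - χ) / 2))), ?_, ?_, ?_⟩
    · simp only [rulingVertex, PiLp.toLp_apply, Matrix.cons_val_zero, h1]
      field_simp
      linear_combination p * Real.cos φ * Real.sin ((φ - χ) / 2) * hε2
    · simp only [rulingVertex, PiLp.toLp_apply, Matrix.cons_val_one, Matrix.cons_val_zero, h2]
      field_simp
      linear_combination -q * Real.sin φ * Real.sin ((φ - χ) / 2) * hε2
    · simp [rulingVertex]
  · refine mem_ruling.2 ⟨-(ε * (Real.sin ((φ - χ) / 2) / Real.cos ((φ - χ) / 2))), ?_, ?_, ?_⟩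
    · simp only [rulingVertex, PiLp.toLp_apply, Matrix.cons_val_zero, h3]
      field_simp
      linear_combination -p * Real.cos χ * Real.sin ((φ - χ) / 2) * hε2
    · simp only [rulingVertex, PiLp.toLp_apply, Matrix.cons_val_one, Matrix.cons_val_zero, h4]
      field_simp
      linear_combination q * Real.sin χ * Real.sin ((φ - χ) / 2) * hε2
    · simp [rulingVertex]

/-- Lines of different families intersect in at most one point. -/
lemma eq_rulingVertex (hp : p ≠ 0) (hq : q ≠ 0) (hr : r ≠ 0) (hε : ε = 1 ∨ ε = -1) {P : E3}
    (h1 : P ∈ ruling p q r ε φ) (h2 : P ∈ ruling p q r (-ε) χ) :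
    Real.cos ((φ - χ) / 2) ≠ 0 ∧ P = rulingVertex p q r ε φ χ := by
  obtain ⟨t, a0, a1, a2⟩ := mem_ruling.1 h1
  obtain ⟨t', b0, b1, b2⟩ := mem_ruling.1 h2
  have ht : t' = t := mul_left_cancel₀ hr (b2.symm.trans a2)
  subst ht
  have c0 := mul_left_cancel₀ hp (a0.symm.trans b0)
  have c1 := mul_left_cancel₀ hq (a1.symm.trans b1)
  obtain ⟨T, hT⟩ : ∃ T, T = t' * ε := ⟨_, rfl⟩
  have hε2 : ε * ε = 1 := by rcases hε with rfl | rfl <;> norm_num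
  have ht' : t' = T * ε := by rw [hT]; linear_combination -t' * hε2
  obtain ⟨h1, h2, h3, h4⟩ := sin_half_identities φ χ
  obtain ⟨O, hO⟩ : ∃ O, O = (φ + χ) / 2 := ⟨_, rfl⟩
  obtain ⟨o, ho⟩ : ∃ o, o = (φ - χ) / 2 := ⟨_, rfl⟩
  have hφ : φ = O + o := by rw [hO, ho]; ring
  have hχ : χ = O - o := by rw [hO, ho]; ring
  have hOO := Real.sin_sq_add_cos_sq O
  have hoo := Real.sin_sq_add_cos_sq o
  have key : Real.sin o + T * Real.cos o = 0 := by
    rw [hφ, hχ, Real.sin_add, Real.sin_sub, Real.cos_add, Real.cos_sub] at c0 c1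
    have e1 : Real.cos O * (Real.sin o + T * Real.cos o) = 0 := by
      rw [hT]; linear_combination c0 / 2
    have e2 : Real.sin O * (Real.sin o + T * Real.cos o) = 0 := by
      rw [hT]; linear_combination -c1 / 2
    linear_combination Real.cos O * e1 + Real.sin O * e2 - (Real.sin o + T * Real.cos o) * hOO
  have hne : Real.cos o ≠ 0 := by
    intro h0
    rw [h0, mul_zero, add_zero] at key
    rw [h0, key] at hoo
    norm_num at hoo
  rw [ho] at key hne
  refine ⟨hne, E3.ext ?_ ?_ ?_⟩
  · simp only [rulingVertex, PiLp.toLp_apply, Matrix.cons_val_zero, h1]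
    rw [a0, ht']
    field_simp
    linear_combination T * Real.cos φ * Real.cos ((φ - χ) / 2) * hε2 + Real.cos φ * key
  · simp only [rulingVertex, PiLp.toLp_apply, Matrix.cons_val_one, Matrix.cons_val_zero, h2]
    rw [a1, ht']
    field_simp
    linear_combination -T * Real.sin φ * Real.cos ((φ - χ) / 2) * hε2 - Real.sin φ * key
  · simp only [rulingVertex, PiLp.toLp_apply, Matrix.cons_val]
    rw [a2, ht']
    field_simp
    linear_combination ε * key

/-- Lines of the same family are equal or disjoint. -/
lemma angle_eq_of_mem_ruling (hp : p ≠ 0) (hq : q ≠ 0) (hr : r ≠ 0) {P : E3}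
    (h1 : P ∈ ruling p q r ε φ) (h2 : P ∈ ruling p q r ε χ) :
    Real.sin φ = Real.sin χ ∧ Real.cos φ = Real.cos χ := by
  obtain ⟨t, a0, a1, a2⟩ := mem_ruling.1 h1
  obtain ⟨t', b0, b1, b2⟩ := mem_ruling.1 h2
  have ht : t' = t := mul_left_cancel₀ hr (b2.symm.trans a2)
  subst ht
  have c0 := mul_left_cancel₀ hp (a0.symm.trans b0)
  have c1 := mul_left_cancel₀ hq (a1.symm.trans b1)
  have hpos : (1 + (t' * ε) ^ 2) ≠ 0 := by positivity
  constructor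
  · apply mul_left_cancel₀ hpos
    linear_combination c0 - t' * ε * c1
  · apply mul_left_cancel₀ hpos
    linear_combination t' * ε * c0 + c1

lemma ruling_congr (h1 : Real.sin φ = Real.sin χ) (h2 : Real.cos φ = Real.cos χ) :
    ruling p q r ε φ = ruling p q r ε χ := by
  rw [ruling, h1, h2, ruling]

lemma ruling_self_mem (p q r ε φ : ℝ) :
    !₂[p * Real.sin φ, q * Real.cos φ, 0] ∈ ruling p q r ε φ :=
  self_mem_lineThrough _ _

lemma angle_eq_of_ruling_eq (hp : p ≠ 0) (hq : q ≠ 0) (hr : r ≠ 0)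
    (h : ruling p q r ε φ = ruling p q r ε χ) :
    Real.sin φ = Real.sin χ ∧ Real.cos φ = Real.cos χ := by
  have := ruling_self_mem p q r ε φ
  exact angle_eq_of_mem_ruling hp hq hr this (h ▸ this)

lemma ruling_ne_ruling_neg (hp : p ≠ 0) (hq : q ≠ 0) (hr : r ≠ 0) (hε : ε = 1 ∨ ε = -1) :
    ruling p q r ε φ ≠ ruling p q r (-ε) χ := by
  intro h
  -- two points of a common line would both be the only common point of the two lines
  have m1 := ruling_self_mem p q r ε φ
  have m2 : !₂[p * (Real.sin φ + 1 * (ε * Real.cos φ)), q * (Real.cos φ - 1 * (ε * Real.sin φ)),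
      r * 1] ∈ ruling p q r ε φ := mem_ruling.2 ⟨1, by simp, by simp, by simp⟩
  have e1 := (eq_rulingVertex hp hq hr hε m1 (h ▸ m1)).2
  have e2 := (eq_rulingVertex hp hq hr hε m2 (h ▸ m2)).2
  have := congrArg (fun P : E3 => P 2) (e1.trans e2.symm)
  simp at this
  exact hr this.symm

lemma ruling_dir_ne_zero (hp : p ≠ 0) (hq : q ≠ 0) (hε : ε = 1 ∨ ε = -1) :
    (!₂[p * (ε * Real.cos φ), -(q * (ε * Real.sin φ)), r] : E3) ≠ 0 := by
  intro h
  have h0 := congrArg (fun P : E3 => P 0) h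
  have h1 := congrArg (fun P : E3 => P 1) h
  have hε0 : ε ≠ 0 := by rcases hε with rfl | rfl <;> norm_num
  simp [hp, hq, hε0] at h0 h1
  have := Real.sin_sq_add_cos_sq φ
  rw [h0, h1] at this
  norm_num at this

/-- Every straight line on the hyperboloid is one of the rulings. -/
lemma exists_eq_ruling (hp : 0 < p) (hq : 0 < q) (hr : 0 < r) {L : AffineSubspace ℝ E3}
    (hL : Module.finrank ℝ L.direction = 1) {P : E3} (hP : P ∈ L)
    (h : ∀ Q ∈ L, Q 0 ^ 2 / p ^ 2 + Q 1 ^ 2 / q ^ 2 - Q 2 ^ 2 / r ^ 2 = 1) :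
    ∃ ε φ, (ε = 1 ∨ ε = -1) ∧ L = ruling p q r ε φ := by
  obtain ⟨V, hV, rfl⟩ := exists_eq_lineThrough hL hP
  have hp0 := hp.ne'
  have hq0 := hq.ne'
  have hr0 := hr.ne'
  obtain ⟨x, hx⟩ : ∃ x, P 0 = p * x := ⟨P 0 / p, by field_simp⟩
  obtain ⟨y, hy⟩ : ∃ y, P 1 = q * y := ⟨P 1 / q, by field_simp⟩
  obtain ⟨z, hz⟩ : ∃ z, P 2 = r * z := ⟨P 2 / r, by field_simp⟩
  obtain ⟨α, hα⟩ : ∃ x, V 0 = p * x := ⟨V 0 / p, by field_simp⟩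
  obtain ⟨β, hβ⟩ : ∃ y, V 1 = q * y := ⟨V 1 / q, by field_simp⟩
  obtain ⟨γ, hγ⟩ : ∃ z, V 2 = r * z := ⟨V 2 / r, by field_simp⟩
  have key : ∀ t : ℝ, (x + t * α) ^ 2 + (y + t * β) ^ 2 - (z + t * γ) ^ 2 = 1 := by
    intro t
    have := h (P + t • V) (mem_lineThrough.2 ⟨t, rfl⟩)
    simp only [PiLp.add_apply, PiLp.smul_apply, smul_eq_mul, hx, hy, hz, hα, hβ, hγ] at this
    have e : ∀ w x α : ℝ, w ≠ 0 → (w * x + t * (w * α)) ^ 2 / w ^ 2 = (x + t * α) ^ 2 := by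
      intro w x α hw
      field_simp
    rwa [e p x α hp0, e q y β hq0, e r z γ hr0] at this
  have k0 := key 0
  have k1 := key 1
  have k2 := key (-1)
  have q0 : x ^ 2 + y ^ 2 - z ^ 2 = 1 := by linarith
  have q1 : x * α + y * β - z * γ = 0 := by linarith
  have q2 : α ^ 2 + β ^ 2 - γ ^ 2 = 0 := by linarith
  have hγ0 : γ ≠ 0 := by
    rintro rfl
    have hα0 : α = 0 := by nlinarith [sq_nonneg α, sq_nonneg β]
    have hβ0 : β = 0 := by nlinarith [sq_nonneg α, sq_nonneg β]
    apply hV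
    apply E3.ext <;> simp [hα, hβ, hγ, hα0, hβ0]
  -- the direction is normalised to `(g₁, g₂, 1)`, and `(h₁, h₂, 0)` is the point with `z = 0`
  obtain ⟨g₁, hg₁⟩ : ∃ g, α = γ * g := ⟨α / γ, by field_simp⟩
  obtain ⟨g₂, hg₂⟩ : ∃ g, β = γ * g := ⟨β / γ, by field_simp⟩
  obtain ⟨s₁, hs₁⟩ : ∃ s, s = x - z * g₁ := ⟨_, rfl⟩
  obtain ⟨s₂, hs₂⟩ : ∃ s, s = y - z * g₂ := ⟨_, rfl⟩
  have e1 : g₁ ^ 2 + g₂ ^ 2 = 1 := by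
    apply mul_left_cancel₀ (pow_ne_zero 2 hγ0)
    rw [hg₁, hg₂] at q2
    linear_combination q2
  have e2 : x * g₁ + y * g₂ = z := by
    apply mul_left_cancel₀ hγ0
    rw [hg₁, hg₂] at q1
    linear_combination q1
  have e3 : s₁ ^ 2 + s₂ ^ 2 = 1 := by
    rw [hs₁, hs₂]; linear_combination q0 + z ^ 2 * e1 - 2 * z * e2
  have e4 : s₁ * g₁ + s₂ * g₂ = 0 := by
    rw [hs₁, hs₂]; linear_combination e2 - z * e1
  obtain ⟨φ, hφ1, hφ2⟩ := exists_angle e3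
  have e5 : (g₁ * s₂ - g₂ * s₁) ^ 2 = 1 := by
    linear_combination e1 * (s₁ ^ 2 + s₂ ^ 2) + e3 - (s₁ * g₁ + s₂ * g₂) * e4
  have e6 : g₁ = (g₁ * s₂ - g₂ * s₁) * s₂ := by linear_combination -g₁ * e3 + s₁ * e4
  have e7 : g₂ = -((g₁ * s₂ - g₂ * s₁) * s₁) := by linear_combination -g₂ * e3 + s₂ * e4
  refine ⟨g₁ * s₂ - g₂ * s₁, φ, mul_self_eq_one_iff.1 (by rw [← sq]; exact e5), ?_⟩
  rw [ruling, hφ1, hφ2, ← e6, ← mul_neg, ← e7]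
  refine lineThrough_eq_of (t := -z / γ) (x := 1 / γ) ?_ ?_ (by positivity)
  · apply E3.ext
    · simp [hx, hα, hg₁, hs₁]; field_simp; ring
    · simp [hy, hβ, hg₂, hs₂]; field_simp; ring
    · simp [hz, hγ]; field_simp; ring
  · apply E3.ext
    · simp [hα, hg₁]; field_simp
    · simp [hβ, hg₂]; field_simp
    · simp [hγ]; field_simp

end Rulings

section RulingGrids

variable {p q r ε φ χ φ₁ χ₁ : ℝ}

lemma mem_ruling_quadric (hp : p ≠ 0) (hq : q ≠ 0) (hr : r ≠ 0) (hε : ε = 1 ∨ ε = -1) {P : E3}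
    (h : P ∈ ruling p q r ε φ) : P 0 ^ 2 / p ^ 2 + P 1 ^ 2 / q ^ 2 - P 2 ^ 2 / r ^ 2 = 1 := by
  obtain ⟨t, h0, h1, h2⟩ := mem_ruling.1 h
  have hε2 : ε ^ 2 = 1 := by rcases hε with rfl | rfl <;> norm_num
  rw [h0, h1, h2]
  field_simp
  linear_combination (1 + t ^ 2 * ε ^ 2) * Real.sin_sq_add_cos_sq φ + t ^ 2 * hε2

/-- A chord of the hyperboloid on which the quadratic form vanishes is contained in a line of the
hyperboloid, so that it ends on one of the two lines through its starting point. -/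
lemma null_chord (hε : ε = 1 ∨ ε = -1) {P Q : E3} (h1 : P ∈ ruling 1 1 1 ε φ)
    (h2 : P ∈ ruling 1 1 1 (-ε) χ) (hQ : Q 0 ^ 2 + Q 1 ^ 2 - Q 2 ^ 2 = 1)
    (hPQ : (P 0 - Q 0) ^ 2 + (P 1 - Q 1) ^ 2 - (P 2 - Q 2) ^ 2 = 0) :
    Q ∈ ruling 1 1 1 ε φ ∨ Q ∈ ruling 1 1 1 (-ε) χ := by
  by_cases hne : Q - P = 0
  · rw [sub_eq_zero.1 hne]; exact Or.inl h1
  have hP := mem_ruling_quadric one_ne_zero one_ne_zero one_ne_zero hε h1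
  simp only [one_pow, div_one] at hP
  have mP : P ∈ lineThrough P (Q - P) := self_mem_lineThrough _ _
  have mQ : Q ∈ lineThrough P (Q - P) := mem_lineThrough.2 ⟨1, by rw [one_smul]; abel⟩
  obtain ⟨ε', φ', hε', he⟩ := exists_eq_ruling one_pos one_pos one_pos
    (finrank_lineThrough hne) mP (by
      intro R hR
      obtain ⟨t, rfl⟩ := mem_lineThrough.1 hR
      simp only [PiLp.add_apply, PiLp.smul_apply, PiLp.sub_apply, smul_eq_mul, one_pow, div_one]
      linear_combination (1 - t) * hP + t * hQ + (t ^ 2 - t) * hPQ)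
  rw [he] at mP mQ
  by_cases hee : ε' = ε
  · subst hee
    obtain ⟨e1, e2⟩ := angle_eq_of_mem_ruling one_ne_zero one_ne_zero one_ne_zero h1 mP
    left
    rwa [ruling_congr e1 e2]
  · have hee' : ε' = -ε := by
      rcases hε with rfl | rfl <;> rcases hε' with rfl | rfl <;> simp_all
    subst hee'
    obtain ⟨e1, e2⟩ := angle_eq_of_mem_ruling one_ne_zero one_ne_zero one_ne_zero h2 mP
    right
    rwa [ruling_congr e1 e2]

/-- The points at which two lines of one family meet two lines of the other one are not
coplanar. -/
lemma affineIndependent_vertices (hp : p ≠ 0) (hq : q ≠ 0) (hr : r ≠ 0) (hε : ε = 1 ∨ ε = -1)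
    {A B C D : E3} (hA : A ∈ ruling p q r ε φ) (hA' : A ∈ ruling p q r (-ε) χ)
    (hB : B ∈ ruling p q r ε φ₁) (hB' : B ∈ ruling p q r (-ε) χ)
    (hC : C ∈ ruling p q r ε φ₁) (hC' : C ∈ ruling p q r (-ε) χ₁)
    (hD : D ∈ ruling p q r ε φ) (hD' : D ∈ ruling p q r (-ε) χ₁)
    (hφ : ¬ (Real.sin φ = Real.sin φ₁ ∧ Real.cos φ = Real.cos φ₁))
    (hχ : ¬ (Real.sin χ = Real.sin χ₁ ∧ Real.cos χ = Real.cos χ₁)) :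
    AffineIndependent ℝ ![A, B, C, D] := by
  have hAD : A ≠ D := by
    rintro rfl
    exact hχ (angle_eq_of_mem_ruling hp hq hr hA' hD')
  have hBC : B ≠ C := by
    rintro rfl
    exact hχ (angle_eq_of_mem_ruling hp hq hr hB' hC')
  obtain ⟨tA, a0, a1, a2⟩ := mem_ruling.1 hA
  obtain ⟨tB, b0, b1, b2⟩ := mem_ruling.1 hB
  obtain ⟨tC, c0, c1, c2⟩ := mem_ruling.1 hC
  obtain ⟨tD, d0, d1, d2⟩ := mem_ruling.1 hD
  have tAD : tA ≠ tD := by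
    rintro rfl
    exact hAD (E3.ext (a0.trans d0.symm) (a1.trans d1.symm) (a2.trans d2.symm))
  have tBC : tB ≠ tC := by
    rintro rfl
    exact hBC (E3.ext (b0.trans c0.symm) (b1.trans c1.symm) (b2.trans c2.symm))
  have hε0 : ε ≠ 0 := by rcases hε with rfl | rfl <;> norm_num
  rw [affineIndependent_iff_of_fintype]
  intro w hw hv
  rw [Finset.weightedVSub_eq_linear_combination _ hw] at hv
  simp only [Fin.sum_univ_four, Matrix.cons_val] at hw hv
  have v0 := congrArg (fun P : E3 => P 0) hv
  have v1 := congrArg (fun P : E3 => P 1) hv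
  have v2 := congrArg (fun P : E3 => P 2) hv
  simp only [PiLp.add_apply, PiLp.smul_apply, smul_eq_mul, PiLp.zero_apply, a0, b0, c0, d0, a1,
    b1, c1, d1, a2, b2, c2, d2] at v0 v1 v2
  -- `S` and `X` are the coefficients of the base point and of the direction of the line `φ`
  obtain ⟨S, hS⟩ : ∃ S, S = w 0 + w 3 := ⟨_, rfl⟩
  obtain ⟨X, hX⟩ : ∃ X, X = w 0 * tA + w 3 * tD := ⟨_, rfl⟩
  have hS' : w 1 + w 2 = -S := by rw [hS]; linear_combination hw
  have hX' : w 1 * tB + w 2 * tC = -X := by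
    apply mul_left_cancel₀ hr
    rw [hX]; linear_combination v2
  have e0 : S * (Real.sin φ - Real.sin φ₁) + X * ε * (Real.cos φ - Real.cos φ₁) = 0 := by
    apply mul_left_cancel₀ hp
    linear_combination v0 + p * Real.sin φ * hS + p * ε * Real.cos φ * hX -
      p * Real.sin φ₁ * hS' - p * ε * Real.cos φ₁ * hX'
  have e1 : S * (Real.cos φ - Real.cos φ₁) - X * ε * (Real.sin φ - Real.sin φ₁) = 0 := by
    apply mul_left_cancel₀ hq
    linear_combination v1 + q * Real.cos φ * hS - q * ε * Real.sin φ * hX -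
      q * Real.cos φ₁ * hS' + q * ε * Real.sin φ₁ * hX'
  have hg : (Real.sin φ - Real.sin φ₁) ^ 2 + (Real.cos φ - Real.cos φ₁) ^ 2 ≠ 0 := by
    intro h0
    rw [add_eq_zero_iff_of_nonneg (sq_nonneg _) (sq_nonneg _)] at h0
    exact hφ ⟨sub_eq_zero.1 (pow_eq_zero_iff two_ne_zero |>.1 h0.1),
      sub_eq_zero.1 (pow_eq_zero_iff two_ne_zero |>.1 h0.2)⟩
  have S0 : S = 0 := by
    apply mul_left_cancel₀ hg
    linear_combination (Real.sin φ - Real.sin φ₁) * e0 + (Real.cos φ - Real.cos φ₁) * e1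
  have X0 : X = 0 := by
    apply mul_left_cancel₀ (mul_ne_zero hε0 hg)
    linear_combination (Real.cos φ - Real.cos φ₁) * e0 - (Real.sin φ - Real.sin φ₁) * e1
  have w0 : w 0 = 0 := by
    apply mul_left_cancel₀ (sub_ne_zero.2 tAD)
    linear_combination -hX + X0 + tD * (hS - S0)
  have w3 : w 3 = 0 := by linear_combination -hS + S0 - w0
  have w1 : w 1 = 0 := by
    apply mul_left_cancel₀ (sub_ne_zero.2 tBC)
    linear_combination hX' - X0 - tC * (hS' - S0)
  have w2 : w 2 = 0 := by linear_combination hS' - S0 - w1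
  intro i
  fin_cases i <;> assumption

lemma rulingVertex_eq_normal (p q r ε φ χ : ℝ) :
    rulingVertex p q r ε φ χ = !₂[p * rulingVertex 1 1 1 ε φ χ 0, q * rulingVertex 1 1 1 ε φ χ 1,
      r * rulingVertex 1 1 1 ε φ χ 2] := by
  apply E3.ext <;> simp [rulingVertex]

lemma rulingVertex_null_ne (hε : ε = 1 ∨ ε = -1) (h : Real.cos ((φ - χ) / 2) ≠ 0)
    (h' : Real.cos ((φ₁ - χ₁) / 2) ≠ 0)
    (hφ : ¬ (Real.sin φ = Real.sin φ₁ ∧ Real.cos φ = Real.cos φ₁))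
    (hχ : ¬ (Real.sin χ = Real.sin χ₁ ∧ Real.cos χ = Real.cos χ₁)) :
    (rulingVertex 1 1 1 ε φ χ 0 - rulingVertex 1 1 1 ε φ₁ χ₁ 0) ^ 2 +
      (rulingVertex 1 1 1 ε φ χ 1 - rulingVertex 1 1 1 ε φ₁ χ₁ 1) ^ 2 -
      (rulingVertex 1 1 1 ε φ χ 2 - rulingVertex 1 1 1 ε φ₁ χ₁ 2) ^ 2 ≠ 0 := by
  intro h0
  obtain ⟨m1, m2⟩ := rulingVertex_mem (p := 1) (q := 1) (r := 1) hε h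
  obtain ⟨n1, n2⟩ := rulingVertex_mem (p := 1) (q := 1) (r := 1) hε h'
  have hQ := mem_ruling_quadric one_ne_zero one_ne_zero one_ne_zero hε n1
  simp only [one_pow, div_one] at hQ
  rcases null_chord hε m1 m2 hQ h0 with h1 | h1
  · exact hφ (angle_eq_of_mem_ruling one_ne_zero one_ne_zero one_ne_zero h1 n1)
  · exact hχ (angle_eq_of_mem_ruling one_ne_zero one_ne_zero one_ne_zero h1 n2)

lemma LineGrid.ext' {E : Type} [NormedAddCommGroup E] [InnerProductSpace ℝ E] {G H : LineGrid E}
    (h1 : ∀ n, G.fst n = H.fst n) (h2 : ∀ n, G.snd n = H.snd n)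
    (h3 : ∀ n n', G.vertex n n' = H.vertex n n') : G = H := by
  cases G
  cases H
  congr
  · exact funext h1
  · exact funext h2
  · exact funext fun n => funext (h3 n)

end RulingGrids

/-! ### The affine deformation -/

section Deform

variable {a b c u v : ℝ}

lemma sqrt_scale (x : ℝ) {y z : ℝ} (hy : 0 ≤ y) (hx : 0 < x) :
    Real.sqrt (y / x) * (Real.sqrt x * z) = Real.sqrt y * z := by
  have := (Real.sqrt_pos.2 hx).ne'
  rw [Real.sqrt_div hy]
  field_simp

/-- In coordinates with respect to the semi-axes of the hyperboloids, the deformation is the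
identity. -/
lemma deform_scale (hba : b < a) (hu : u ∈ Ioo (-b) (-c)) (hv : v ∈ Icc (-b) (-c))
    (x y z : ℝ) :
    deform a b c u v !₂[Real.sqrt (u + a) * x, Real.sqrt (u + b) * y, Real.sqrt (-(u + c)) * z] =
      !₂[Real.sqrt (v + a) * x, Real.sqrt (v + b) * y, Real.sqrt (-(v + c)) * z] := by
  obtain ⟨hu1, hu2⟩ := hu
  obtain ⟨hv1, hv2⟩ := hv
  apply E3.ext
  · exact sqrt_scale _ (by linarith) (by linarith)
  · exact sqrt_scale _ (by linarith) (by linarith)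
  · change Real.sqrt ((v + c) / (u + c)) * (Real.sqrt (-(u + c)) * z) = _
    rw [← neg_div_neg_eq]
    exact sqrt_scale _ (by linarith) (by linarith)

/-- The grid of straight lines on the hyperboloid with parameter `v`, or on the plane into which it
degenerates, with given sequences of angles. -/
def acGrid (a b c v ε : ℝ) (φ χ : ℤ → ℝ) : LineGrid E3 :=
  rulingGrid (Real.sqrt (v + a)) (Real.sqrt (v + b)) (Real.sqrt (-(v + c))) ε φ χ

lemma map_deform_ruling (hba : b < a) (hu : u ∈ Ioo (-b) (-c)) (hv : v ∈ Icc (-b) (-c))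
    (ε φ : ℝ) :
    (ruling (Real.sqrt (u + a)) (Real.sqrt (u + b)) (Real.sqrt (-(u + c))) ε φ).map
      (deform a b c u v) =
      ruling (Real.sqrt (v + a)) (Real.sqrt (v + b)) (Real.sqrt (-(v + c))) ε φ := by
  rw [ruling, map_lineThrough, ruling]
  congr 1
  · have := deform_scale hba hu hv (Real.sin φ) (Real.cos φ) 0
    rwa [mul_zero, mul_zero] at this
  · have := deform_scale hba hu hv (ε * Real.cos φ) (-(ε * Real.sin φ)) 1
    rw [mul_one, mul_one, mul_neg, mul_neg] at this
    exact this

lemma deform_rulingVertex (hba : b < a) (hu : u ∈ Ioo (-b) (-c)) (hv : v ∈ Icc (-b) (-c))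
    (ε φ χ : ℝ) :
    deform a b c u v (rulingVertex (Real.sqrt (u + a)) (Real.sqrt (u + b)) (Real.sqrt (-(u + c)))
      ε φ χ) =
      rulingVertex (Real.sqrt (v + a)) (Real.sqrt (v + b)) (Real.sqrt (-(v + c))) ε φ χ := by
  rw [rulingVertex_eq_normal, deform_scale hba hu hv, ← rulingVertex_eq_normal]

lemma acGrid_map_deform (hba : b < a) (hu : u ∈ Ioo (-b) (-c)) (hv : v ∈ Icc (-b) (-c))
    (ε : ℝ) (φ χ : ℤ → ℝ) :
    (acGrid a b c u ε φ χ).map (deform a b c u v) = acGrid a b c v ε φ χ :=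
  LineGrid.ext' (fun n => map_deform_ruling hba hu hv ε (φ n))
    (fun n => map_deform_ruling hba hu hv (-ε) (χ n))
    (fun n n' => deform_rulingVertex hba hu hv ε (φ n) (χ n'))

lemma continuousOn_deform (a b c u : ℝ) (P : E3) (s : Set ℝ) :
    ContinuousOn (fun v => deform a b c u v P) s := by
  apply Continuous.continuousOn
  have h : (fun v => deform a b c u v P) = fun v => !₂[Real.sqrt ((v + a) / (u + a)) * P 0,
        Real.sqrt ((v + b) / (u + b)) * P 1, Real.sqrt ((v + c) / (u + c)) * P 2] := rfl
  rw [h]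
  refine (PiLp.continuous_toLp 2 _).comp (continuous_pi fun i => ?_)
  fin_cases i
  · exact ((Real.continuous_sqrt.comp ((continuous_id.add continuous_const).div_const _)).mul
      continuous_const)
  · exact ((Real.continuous_sqrt.comp ((continuous_id.add continuous_const).div_const _)).mul
      continuous_const)
  · exact ((Real.continuous_sqrt.comp ((continuous_id.add continuous_const).div_const _)).mul
      continuous_const)

lemma dist_sq_E3 (P Q : E3) :
    dist P Q ^ 2 = (P 0 - Q 0) ^ 2 + (P 1 - Q 1) ^ 2 + (P 2 - Q 2) ^ 2 := by
  rw [EuclideanSpace.dist_eq, Real.sq_sqrt (by positivity), Fin.sum_univ_three]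
  simp [Real.dist_eq, sq_abs]

/-- The deformation is isometric along each straight line of the hyperboloid, since the length
of the direction vector depends only on the differences of `a`, `b`, `c`. -/
lemma dist_deform_ruling (hba : b < a) (hu : u ∈ Ioo (-b) (-c)) (hv : v ∈ Icc (-b) (-c))
    {ε φ : ℝ} (hε : ε = 1 ∨ ε = -1) {P Q : E3}
    (hP : P ∈ ruling (Real.sqrt (u + a)) (Real.sqrt (u + b)) (Real.sqrt (-(u + c))) ε φ)
    (hQ : Q ∈ ruling (Real.sqrt (u + a)) (Real.sqrt (u + b)) (Real.sqrt (-(u + c))) ε φ) :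
    dist (deform a b c u v P) (deform a b c u v Q) = dist P Q := by
  obtain ⟨t, h0, h1, h2⟩ := mem_ruling.1 hP
  obtain ⟨t', g0, g1, g2⟩ := mem_ruling.1 hQ
  have eP : P = !₂[Real.sqrt (u + a) * (Real.sin φ + t * (ε * Real.cos φ)),
    Real.sqrt (u + b) * (Real.cos φ - t * (ε * Real.sin φ)), Real.sqrt (-(u + c)) * t] :=
    E3.ext h0 h1 h2
  have eQ : Q = !₂[Real.sqrt (u + a) * (Real.sin φ + t' * (ε * Real.cos φ)),
    Real.sqrt (u + b) * (Real.cos φ - t' * (ε * Real.sin φ)), Real.sqrt (-(u + c)) * t'] :=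
    E3.ext g0 g1 g2
  have hε2 : ε ^ 2 = 1 := by rcases hε with rfl | rfl <;> norm_num
  have key : ∀ w ∈ Icc (-b) (-c),
      dist (!₂[Real.sqrt (w + a) * (Real.sin φ + t * (ε * Real.cos φ)),
        Real.sqrt (w + b) * (Real.cos φ - t * (ε * Real.sin φ)), Real.sqrt (-(w + c)) * t] : E3)
        !₂[Real.sqrt (w + a) * (Real.sin φ + t' * (ε * Real.cos φ)),
        Real.sqrt (w + b) * (Real.cos φ - t' * (ε * Real.sin φ)), Real.sqrt (-(w + c)) * t'] ^ 2 =
      (t - t') ^ 2 * (a * Real.cos φ ^ 2 + b * Real.sin φ ^ 2 - c) := by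
    rintro w ⟨hw1, hw2⟩
    have s1 := Real.sq_sqrt (show 0 ≤ w + a by linarith)
    have s2 := Real.sq_sqrt (show 0 ≤ w + b by linarith)
    have s3 := Real.sq_sqrt (show 0 ≤ -(w + c) by linarith)
    rw [dist_sq_E3]
    simp only [Matrix.cons_val]
    linear_combination (t - t') ^ 2 * (ε ^ 2 * Real.cos φ ^ 2 * s1 + ε ^ 2 * Real.sin φ ^ 2 * s2 + s3
      + ((w + a) * Real.cos φ ^ 2 + (w + b) * Real.sin φ ^ 2) * hε2 + w * Real.sin_sq_add_cos_sq φ)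
  refine (sq_eq_sq₀ dist_nonneg dist_nonneg).1 ?_
  rw [eP, eQ, deform_scale hba hu hv, deform_scale hba hu hv, key v hv,
    key u (Ioo_subset_Icc_self hu)]

/-- The square of the distance of two points is an affine function of the parameter `v`. -/
lemma strictMono_or_strictAnti_dist (hba : b < a) {P Q : E3}
    (h : (P 0 - Q 0) ^ 2 + (P 1 - Q 1) ^ 2 - (P 2 - Q 2) ^ 2 ≠ 0) :
    StrictMonoOn (fun v => dist (!₂[Real.sqrt (v + a) * P 0, Real.sqrt (v + b) * P 1,
        Real.sqrt (-(v + c)) * P 2] : E3) !₂[Real.sqrt (v + a) * Q 0, Real.sqrt (v + b) * Q 1,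
        Real.sqrt (-(v + c)) * Q 2]) (Icc (-b) (-c)) ∨
      StrictAntiOn (fun v => dist (!₂[Real.sqrt (v + a) * P 0, Real.sqrt (v + b) * P 1,
        Real.sqrt (-(v + c)) * P 2] : E3) !₂[Real.sqrt (v + a) * Q 0, Real.sqrt (v + b) * Q 1,
        Real.sqrt (-(v + c)) * Q 2]) (Icc (-b) (-c)) := by
  have key : ∀ w ∈ Icc (-b) (-c), dist (!₂[Real.sqrt (w + a) * P 0, Real.sqrt (w + b) * P 1,
        Real.sqrt (-(w + c)) * P 2] : E3) !₂[Real.sqrt (w + a) * Q 0, Real.sqrt (w + b) * Q 1,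
        Real.sqrt (-(w + c)) * Q 2] ^ 2 =
      w * ((P 0 - Q 0) ^ 2 + (P 1 - Q 1) ^ 2 - (P 2 - Q 2) ^ 2) +
        (a * (P 0 - Q 0) ^ 2 + b * (P 1 - Q 1) ^ 2 - c * (P 2 - Q 2) ^ 2) := by
    rintro w ⟨hw1, hw2⟩
    have s1 := Real.sq_sqrt (show 0 ≤ w + a by linarith)
    have s2 := Real.sq_sqrt (show 0 ≤ w + b by linarith)
    have s3 := Real.sq_sqrt (show 0 ≤ -(w + c) by linarith)
    rw [dist_sq_E3]
    simp only [Matrix.cons_val]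
    linear_combination (P 0 - Q 0) ^ 2 * s1 + (P 1 - Q 1) ^ 2 * s2 + (P 2 - Q 2) ^ 2 * s3
  rcases lt_or_gt_of_ne h with h | h
  · right
    intro v hv w hw hvw
    refine lt_of_pow_lt_pow_left₀ 2 dist_nonneg ?_
    rw [key v hv, key w hw]
    nlinarith
  · left
    intro v hv w hw hvw
    refine lt_of_pow_lt_pow_left₀ 2 dist_nonneg ?_
    rw [key v hv, key w hw]
    nlinarith

lemma mem_confocalQuadric_iff (hba : b < a) (hu : u ∈ Ioo (-b) (-c)) {P : E3} :
    P ∈ confocalQuadric a b c u ↔ P 0 ^ 2 / Real.sqrt (u + a) ^ 2 + P 1 ^ 2 / Real.sqrt (u + b) ^ 2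
      - P 2 ^ 2 / Real.sqrt (-(u + c)) ^ 2 = 1 := by
  obtain ⟨hu1, hu2⟩ := hu
  rw [Real.sq_sqrt (by linarith), Real.sq_sqrt (by linarith), Real.sq_sqrt (by linarith), div_neg,
    sub_neg_eq_add]
  rfl

end Deform

/-! ### Lines of curvature -/

section Modulus

variable {a b c : ℝ}

lemma modulus₁_mem (hcb : c < b) (hba : b < a) : modulus₁ a b c ∈ Ioo (0 : ℝ) 1 := by
  unfold modulus₁
  constructor
  · exact Real.sqrt_pos.2 (div_pos (by linarith) (by linarith))
  · rw [Real.sqrt_lt' one_pos, one_pow, div_lt_one (by linarith)]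
    linarith

lemma modulus₂_mem (hcb : c < b) (hba : b < a) : modulus₂ a b c ∈ Ioo (0 : ℝ) 1 := by
  unfold modulus₂
  constructor
  · exact Real.sqrt_pos.2 (div_pos (by linarith) (by linarith))
  · rw [Real.sqrt_lt' one_pos, one_pow, div_lt_one (by linarith)]
    linarith

lemma modulus₁_sq (hcb : c < b) (hba : b < a) : (a - c) * modulus₁ a b c ^ 2 = a - b := by
  unfold modulus₁
  have : a - c ≠ 0 := by linarith
  rw [Real.sq_sqrt (div_nonneg (by linarith) (by linarith))]
  field_simp

lemma modulus₂_sq (hcb : c < b) (hba : b < a) : (a - c) * modulus₂ a b c ^ 2 = b - c := by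
  unfold modulus₂
  have : a - c ≠ 0 := by linarith
  rw [Real.sq_sqrt (div_nonneg (by linarith) (by linarith))]
  field_simp

end Modulus

section Vertex

variable {k : ℝ}

/-- The vertices in terms of half the sum and half the difference of the parameters. -/
lemma rulingVertex_eq_jacobi (hk : k ∈ Ioo (0 : ℝ) 1) (p q r ε : ℝ) {s m : ℝ}
    (h : FinPar k (s + m) (s - m)) :
    jacobiCn m k ≠ 0 ∧ rulingVertex p q r ε (jacobiAm k (s + m)) (jacobiAm k (s - m)) =
      !₂[p * (jacobiSn s k * jacobiDn m k / jacobiCn m k), q * (jacobiCn s k / jacobiCn m k),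
        -(r * (ε * (jacobiDn s k * jacobiSn m k / jacobiCn m k)))] := by
  obtain ⟨κ, hκ, k1, k2, k3, k4⟩ := exists_half_angle hk s m
  have hκ0 : κ ≠ 0 := by
    rintro rfl
    have := jacobiDen_pos hk s m
    rw [← hκ] at this
    simp at this
  unfold FinPar at h
  rw [k1, k2, k3, k4]
  refine ⟨mul_ne_zero hκ0 h, ?_⟩
  rw [rulingVertex, mul_div_mul_left _ _ hκ0, mul_div_mul_left _ _ hκ0, mul_div_mul_left _ _ hκ0]

lemma rulingVertex_add_period (hk : k ∈ Ioo (0 : ℝ) 1) (p q r ε τ χ : ℝ) (j : ℤ) :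
    rulingVertex p q r ε (jacobiAm k (τ + j * (4 * ellipticK k))) χ =
      rulingVertex p q r ε (jacobiAm k τ) χ := by
  have e1 : (jacobiAm k τ + j * (2 * Real.pi) + χ) / 2 = (jacobiAm k τ + χ) / 2 + j * Real.pi := by
    ring
  have e2 : (jacobiAm k τ + j * (2 * Real.pi) - χ) / 2 = (jacobiAm k τ - χ) / 2 + j * Real.pi := by
    ring
  have hj : ((-1 : ℝ) ^ j) ≠ 0 := zpow_ne_zero _ (by norm_num)
  rw [jacobiAm_add_four_K hk, rulingVertex, e1, e2]
  simp only [Real.sin_add_int_mul_pi, Real.cos_add_int_mul_pi, mul_div_mul_left _ _ hj]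
  rfl

/-- Two values `sn`, `cn` with equal squares and equal products agree up to a common sign. -/
lemma exists_eq_add_two_K (hk : k ∈ Ioo (0 : ℝ) 1) {s t : ℝ}
    (h1 : jacobiSn s k ^ 2 = jacobiSn t k ^ 2)
    (h2 : jacobiSn s k * jacobiCn s k = jacobiSn t k * jacobiCn t k) :
    ∃ j : ℤ, s = t + j * (2 * ellipticK k) := by
  have h3 := jacobiCn_sq k s
  have h4 := jacobiCn_sq k t
  have e : Real.sin (jacobiAm k s - jacobiAm k t) = 0 := by
    rw [Real.sin_sub]
    change jacobiSn s k * jacobiCn t k - jacobiCn s k * jacobiSn t k = 0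
    have : (jacobiSn s k * jacobiCn t k - jacobiCn s k * jacobiSn t k) ^ 2 = 0 := by
      linear_combination (jacobiSn s k ^ 2) * (h4 - h3 + h1) - jacobiCn s k ^ 2 * h1 +
        2 * jacobiSn s k * jacobiCn s k * h2
    exact pow_eq_zero_iff two_ne_zero |>.1 this
  obtain ⟨j, hj⟩ := Real.sin_eq_zero_iff.1 e
  exact ⟨j, jacobiAm_eq_add_int_mul_pi hk (by linarith)⟩

end Vertex

section Curvature

variable {a b c u μ : ℝ}

/-- A common point of two confocal quadrics in coordinates with respect to the semi-axes of the
first one: the second condition does not depend on `u`. -/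
lemma exists_normal_coords (hba : b < a) (hu : u ∈ Ioo (-b) (-c)) (hμ : μ ≠ u) {X : Fin 4 → ℝ}
    (h1 : X ∈ homQuadric a b c u) (h2 : X ∈ homQuadric a b c μ) :
    ∃ x y z, X 0 = Real.sqrt (u + a) * x ∧ X 1 = Real.sqrt (u + b) * y ∧
      X 2 = Real.sqrt (-(u + c)) * z ∧ x ^ 2 + y ^ 2 - z ^ 2 = X 3 ^ 2 ∧
      (μ + b) * (μ + c) * x ^ 2 + (μ + a) * (μ + c) * y ^ 2 - (μ + a) * (μ + b) * z ^ 2 = 0 := by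
  obtain ⟨hu1, hu2⟩ := hu
  have p1 : 0 < u + a := by linarith
  have p2 : 0 < u + b := by linarith
  have p3 : 0 < -(u + c) := by linarith
  have s1 := Real.sq_sqrt p1.le
  have s2 := Real.sq_sqrt p2.le
  have s3 := Real.sq_sqrt p3.le
  have n1 := (Real.sqrt_pos.2 p1).ne'
  have n2 := (Real.sqrt_pos.2 p2).ne'
  have n3 := (Real.sqrt_pos.2 p3).ne'
  generalize Real.sqrt (u + a) = p at *
  generalize Real.sqrt (u + b) = q at *
  generalize Real.sqrt (-(u + c)) = r at *
  obtain ⟨x, hx⟩ : ∃ x, X 0 = p * x := ⟨X 0 / p, by field_simp⟩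
  obtain ⟨y, hy⟩ : ∃ y, X 1 = q * y := ⟨X 1 / q, by field_simp⟩
  obtain ⟨z, hz⟩ : ∃ z, X 2 = r * z := ⟨X 2 / r, by field_simp⟩
  refine ⟨x, y, z, hx, hy, hz, ?_⟩
  simp only [homQuadric, mem_ofPred_eq, hx, hy, hz] at h1 h2
  have e1 : x ^ 2 + y ^ 2 - z ^ 2 = X 3 ^ 2 := by
    apply mul_left_cancel₀ (mul_ne_zero (mul_ne_zero p1.ne' p2.ne') (neg_ne_zero.1 p3.ne'))
    linear_combination h1 - (u + b) * (u + c) * x ^ 2 * s1 - (u + a) * (u + c) * y ^ 2 * s2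
      - (u + a) * (u + b) * z ^ 2 * s3
  refine ⟨e1, ?_⟩
  apply mul_left_cancel₀ (sub_ne_zero.2 hμ.symm)
  linear_combination h2 - (μ + b) * (μ + c) * x ^ 2 * s1 - (μ + a) * (μ + c) * y ^ 2 * s2
      - (μ + a) * (μ + b) * z ^ 2 * s3 - (μ + a) * (μ + b) * (μ + c) * e1

lemma eq_zero_of_coords {X : Fin 4 → ℝ} (h0 : X 0 = 0) (h1 : X 1 = 0) (h2 : X 2 = 0)
    (h3 : X 3 = 0) : X = 0 := by
  ext i; fin_cases i <;> assumption

/-- On a two-sheeted hyperboloid of the confocal system, `x y` has no zero on the intersection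
with the one-sheeted hyperboloid. -/
lemma xy_ne_zero (hcb : c < b) (hba : b < a) (hu : u ∈ Ioo (-b) (-c)) (hμ1 : -a < μ) (hμ2 : μ < -b)
    {X : Fin 4 → ℝ} (h0 : X ≠ 0)
    (h1 : X ∈ homQuadric a b c u) (h2 : X ∈ homQuadric a b c μ) : X 0 * X 1 ≠ 0 := by
  have hμ : μ ≠ u := by linarith [hu.1]
  obtain ⟨x, y, z, hx, hy, hz, e1, e2⟩ := exists_normal_coords hba hu hμ h1 h2
  intro hxy
  have p1 : 0 < μ + a := by linarith
  have p2 : μ + b < 0 := by linarith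
  have p3 : μ + c < 0 := by linarith
  have q1 : 0 < (μ + b) * (μ + c) := mul_pos_of_neg_of_neg p2 p3
  have q2 : 0 < (μ + a) * (-(μ + b)) := mul_pos p1 (by linarith)
  have q3 : 0 < (μ + a) * (-(μ + c)) := mul_pos p1 (by linarith)
  have hx2 := sq_nonneg x
  have hy2 := sq_nonneg y
  have hz2 := sq_nonneg z
  have hw2 := sq_nonneg (X 3)
  have sx := Real.sqrt_pos.2 (show 0 < u + a by linarith [hu.1])
  have sy := Real.sqrt_pos.2 (show 0 < u + b by linarith [hu.1])
  -- in either case the square of the last coordinate would be non-positive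
  have hz0 : z ^ 2 = 0 ∧ x ^ 2 = 0 ∧ y ^ 2 = 0 := by
    rcases mul_eq_zero.1 hxy with h | h
    · rw [hx] at h
      have hx0 : x ^ 2 = 0 := by
        rcases mul_eq_zero.1 h with h | h
        · exact absurd h sx.ne'
        · rw [h]; norm_num
      have e3 : (μ + a) * ((μ + c) * y ^ 2 - (μ + b) * z ^ 2) = 0 := by
        rw [hx0] at e2; linear_combination e2
      have e4 : (μ + c) * y ^ 2 - (μ + b) * z ^ 2 = 0 := by
        rcases mul_eq_zero.1 e3 with h | h
        · exact absurd h p1.ne'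
        · exact h
      have e5 : (b - c) * z ^ 2 = (μ + c) * X 3 ^ 2 := by
        rw [hx0] at e1; linear_combination (μ + c) * e1 - e4
      have e6 : 0 ≤ (b - c) * z ^ 2 := mul_nonneg (by linarith) hz2
      have e7 : (μ + c) * X 3 ^ 2 ≤ 0 := mul_nonpos_of_nonpos_of_nonneg p3.le hw2
      have e8 : (b - c) * z ^ 2 = 0 := by linarith
      have e9 : z ^ 2 = 0 := by
        rcases mul_eq_zero.1 e8 with h | h
        · linarith
        · exact h
      rw [e9] at e4
      refine ⟨e9, hx0, ?_⟩
      have : (μ + c) * y ^ 2 = 0 := by linarith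
      rcases mul_eq_zero.1 this with h | h
      · linarith
      · exact h
    · rw [hy] at h
      have hy0 : y ^ 2 = 0 := by
        rcases mul_eq_zero.1 h with h | h
        · exact absurd h sy.ne'
        · rw [h]; norm_num
      have e3 : (μ + b) * (μ + c) * x ^ 2 + (μ + a) * (-(μ + b)) * z ^ 2 = 0 := by
        rw [hy0] at e2; linear_combination e2
      have t1 := mul_nonneg q1.le hx2
      have t2 := mul_nonneg q2.le hz2
      refine ⟨?_, ?_, hy0⟩
      · have : (μ + a) * (-(μ + b)) * z ^ 2 = 0 := by linarith
        exact (mul_eq_zero.1 this).resolve_left q2.ne'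
      · have : (μ + b) * (μ + c) * x ^ 2 = 0 := by linarith
        exact (mul_eq_zero.1 this).resolve_left q1.ne'
  obtain ⟨z0, x0, y0⟩ := hz0
  have w0 : X 3 ^ 2 = 0 := by linarith
  have z0' := pow_eq_zero_iff two_ne_zero |>.1 z0
  have x0' := pow_eq_zero_iff two_ne_zero |>.1 x0
  have y0' := pow_eq_zero_iff two_ne_zero |>.1 y0
  exact h0 (eq_zero_of_coords (by rw [hx, x0', mul_zero]) (by rw [hy, y0', mul_zero])
    (by rw [hz, z0', mul_zero]) (pow_eq_zero_iff two_ne_zero |>.1 w0))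

/-- On an ellipsoid of the confocal system, `z w` has no zero on the intersection with the
one-sheeted hyperboloid. -/
lemma zw_ne_zero (hcb : c < b) (hba : b < a) (hu : u ∈ Ioo (-b) (-c)) (hμ1 : -c < μ)
    {X : Fin 4 → ℝ} (h0 : X ≠ 0)
    (h1 : X ∈ homQuadric a b c u) (h2 : X ∈ homQuadric a b c μ) : X 2 * X 3 ≠ 0 := by
  have hμ : μ ≠ u := by linarith [hu.2]
  obtain ⟨x, y, z, hx, hy, hz, e1, e2⟩ := exists_normal_coords hba hu hμ h1 h2
  intro hzw
  have p1 : 0 < μ + a := by linarith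
  have p2 : 0 < μ + b := by linarith
  have p3 : 0 < μ + c := by linarith
  have hx2 := sq_nonneg x
  have hy2 := sq_nonneg y
  have hz2 := sq_nonneg z
  have hw2 := sq_nonneg (X 3)
  have sz := Real.sqrt_pos.2 (show 0 < -(u + c) by linarith [hu.2])
  -- `e2` is a combination of `x²`, `y²`, `w²` with positive coefficients and of `z²`
  have e3 : (b + μ) * (a - c) * x ^ 2 + (μ + a) * (b - c) * y ^ 2 =
      (μ + a) * (μ + b) * X 3 ^ 2 := by linear_combination (μ + a) * (μ + b) * e1 - e2
  have q1 : 0 < (b + μ) * (a - c) := mul_pos (by linarith) (by linarith)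
  have q2 : 0 < (μ + a) * (b - c) := mul_pos (by linarith) (by linarith)
  have q3 : 0 < (μ + b) * (μ + c) := mul_pos p2 p3
  have q4 : 0 < (μ + a) * (μ + c) := mul_pos p1 p3
  have t1 := mul_nonneg q1.le hx2
  have t2 := mul_nonneg q2.le hy2
  have t3 := mul_nonneg q3.le hx2
  have t4 := mul_nonneg q4.le hy2
  have hxy : x ^ 2 = 0 ∧ y ^ 2 = 0 := by
    rcases mul_eq_zero.1 hzw with h | h
    · rw [hz] at h
      have hz0 : z = 0 := (mul_eq_zero.1 h).resolve_left sz.ne'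
      rw [hz0] at e2
      constructor
      · have : (μ + b) * (μ + c) * x ^ 2 = 0 := by linarith
        exact (mul_eq_zero.1 this).resolve_left q3.ne'
      · have : (μ + a) * (μ + c) * y ^ 2 = 0 := by linarith
        exact (mul_eq_zero.1 this).resolve_left q4.ne'
    · rw [h] at e3
      constructor
      · have : (b + μ) * (a - c) * x ^ 2 = 0 := by linarith
        exact (mul_eq_zero.1 this).resolve_left q1.ne'
      · have : (μ + a) * (b - c) * y ^ 2 = 0 := by linarith
        exact (mul_eq_zero.1 this).resolve_left q2.ne'
  obtain ⟨x0, y0⟩ := hxy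
  have z0 : z ^ 2 = 0 := by linarith
  have w0 : X 3 ^ 2 = 0 := by linarith
  have z0' := pow_eq_zero_iff two_ne_zero |>.1 z0
  have x0' := pow_eq_zero_iff two_ne_zero |>.1 x0
  have y0' := pow_eq_zero_iff two_ne_zero |>.1 y0
  exact h0 (eq_zero_of_coords (by rw [hx, x0', mul_zero]) (by rw [hy, y0', mul_zero])
    (by rw [hz, z0', mul_zero]) (pow_eq_zero_iff two_ne_zero |>.1 w0))

/-- A continuous function without zeros has the same sign at points which are joined. -/
lemma JoinedIn.mul_pos {X : Type} [TopologicalSpace X] {F : Set X} {x y : X} (h : JoinedIn F x y)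
    {f : X → ℝ} (hf : Continuous f) (h0 : ∀ z ∈ F, f z ≠ 0) : 0 < f x * f y := by
  obtain ⟨γ, hγ⟩ := h
  have hc : Continuous fun t => f (γ t) := hf.comp γ.continuous
  have hx : f x ≠ 0 := by have := h0 _ (hγ 0); rwa [γ.source] at this
  have hy : f y ≠ 0 := by have := h0 _ (hγ 1); rwa [γ.target] at this
  by_contra hn
  have hn : f x * f y < 0 := lt_of_le_of_ne (not_lt.1 hn) (mul_ne_zero hx hy)
  have hmem : (0 : ℝ) ∈ range fun t => f (γ t) := by
    rcases mul_neg_iff.1 hn with h | h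
    · exact mem_range_of_exists_le_of_exists_ge hc ⟨1, by simpa using h.2.le⟩
        ⟨0, by simpa using h.1.le⟩
    · exact mem_range_of_exists_le_of_exists_ge hc ⟨0, by simpa using h.1.le⟩
        ⟨1, by simpa using h.2.le⟩
  obtain ⟨t, ht⟩ := hmem
  exact h0 _ (hγ t) ht

/-- Points of a curve within a cone, given in homogeneous coordinates, are joined as points of
projective space. -/
lemma joinedIn_of_curve {F : Set (Fin 4 → ℝ)} (hF : ∀ X ∈ F, ∀ t : ℝ, t ≠ 0 → t • X ∈ F)
    {g : ℝ → Fin 4 → ℝ} (hg : Continuous g) (hgF : ∀ t, g t ∈ F) {κ κ' : ℝ} (h : κ ≠ 0)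
    (h' : κ' ≠ 0) (x y : ℝ) :
    JoinedIn F (κ • g x) (κ' • g y) ∨ JoinedIn F (κ • g x) (-(κ' • g y)) := by
  have key : ∀ l : ℝ, 0 < κ * l → JoinedIn F (κ • g x) (l • g y) := by
    intro l hl
    refine JoinedIn.ofLine (f := fun t => (κ * (1 - t) + t * l) • g (x + t * (y - x)))
      (Continuous.continuousOn (by fun_prop)) (by simp) (by simp) ?_
    rintro _ ⟨t, ht, rfl⟩
    refine hF _ (hgF _) _ ?_
    intro h0
    have h1 : κ * κ * (1 - t) + t * (κ * l) = 0 := by linear_combination κ * h0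
    have h2 : 0 < κ * κ := mul_self_pos.2 h
    rcases eq_or_lt_of_le ht.1 with h3 | h3
    · rw [← h3] at h1; linarith
    · have := mul_pos h3 hl
      have := mul_nonneg h2.le (sub_nonneg.2 ht.2)
      linarith
  rcases lt_or_gt_of_ne (mul_ne_zero h h') with h1 | h1
  · right
    rw [← neg_smul]
    exact key _ (by linarith)
  · exact Or.inl (key _ h1)

end Curvature

section CurvatureConnected

variable {a b c u μ : ℝ}

/-- The pencil condition for the vertex with parameters `s ± m` splits into the equations of the
two lines of curvature through this vertex. -/
lemma pencil_factor {k : ℝ} (hk : k ∈ Ioo (0 : ℝ) 1) (hac : a - c ≠ 0)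
    (h4 : (a - c) * k ^ 2 = a - b) (s m : ℝ) :
    (μ + b) * (μ + c) * (jacobiSn s k * jacobiDn m k) ^ 2 + (μ + a) * (μ + c) * jacobiCn s k ^ 2
      - (μ + a) * (μ + b) * (jacobiDn s k * jacobiSn m k) ^ 2 =
    (μ + a - (a - b) * jacobiSn s k ^ 2) *
      ((μ + c) * (1 - jacobiSn m k ^ 2) - (b - c) * jacobiSn m k ^ 2) := by
  have h1 := jacobiDn_sq hk s
  have h2 := jacobiDn_sq hk m
  have h3 := jacobiCn_sq k s
  apply mul_left_cancel₀ hac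
  rw [mul_pow, mul_pow, h1, h2, h3]
  linear_combination (-(μ + b) * (μ + c) * jacobiSn s k ^ 2 * jacobiSn m k ^ 2 +
    (μ + a) * (μ + b) * jacobiSn s k ^ 2 * jacobiSn m k ^ 2) * h4

/-- Homogeneous coordinates of the vertex with parameters `s ± m`. -/
def homVertex (k p q r ε s m : ℝ) : Fin 4 → ℝ :=
  ![p * (jacobiSn s k * jacobiDn m k), q * jacobiCn s k, -(r * (ε * (jacobiDn s k * jacobiSn m k))),
    jacobiCn m k]

lemma homCoord_rulingVertex {k : ℝ} (hk : k ∈ Ioo (0 : ℝ) 1) (p q r ε : ℝ) {s m : ℝ}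
    (h : FinPar k (s + m) (s - m)) :
    homCoord (rulingVertex p q r ε (jacobiAm k (s + m)) (jacobiAm k (s - m))) =
      (jacobiCn m k)⁻¹ • homVertex k p q r ε s m := by
  obtain ⟨h0, h1⟩ := rulingVertex_eq_jacobi hk p q r ε h
  rw [h1]
  ext i
  fin_cases i <;> simp [homCoord, homVertex] <;> field_simp

lemma homQuadric_smul {X : Fin 4 → ℝ} (hX : X ∈ homQuadric a b c u) (t : ℝ) :
    t • X ∈ homQuadric a b c u := by
  simp only [homQuadric, mem_ofPred_eq, Pi.smul_apply, smul_eq_mul] at *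
  linear_combination t ^ 2 * hX

lemma homQuadric_neg {X : Fin 4 → ℝ} (hX : -X ∈ homQuadric a b c u) : X ∈ homQuadric a b c u := by
  have := homQuadric_smul hX (-1)
  rwa [neg_smul, one_smul, neg_neg] at this

lemma homVertex_mem_iff {k : ℝ} (hk : k ∈ Ioo (0 : ℝ) 1) (hk2 : (a - c) * k ^ 2 = a - b)
    (hcb : c < b) (hba : b < a) (hu : u ∈ Ioo (-b) (-c)) {ε : ℝ}
    (hε : ε = 1 ∨ ε = -1) (s m : ℝ) :
    homVertex k (Real.sqrt (u + a)) (Real.sqrt (u + b)) (Real.sqrt (-(u + c))) ε s m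
        ∈ homQuadric a b c μ ↔
      (u - μ) * ((μ + a - (a - b) * jacobiSn s k ^ 2) *
        ((μ + c) * (1 - jacobiSn m k ^ 2) - (b - c) * jacobiSn m k ^ 2)) = 0 := by
  have hε2 : ε ^ 2 = 1 := by rcases hε with rfl | rfl <;> norm_num
  have s1 := Real.sq_sqrt (show 0 ≤ u + a by linarith [hu.1])
  have s2 := Real.sq_sqrt (show 0 ≤ u + b by linarith [hu.1])
  have s3 := Real.sq_sqrt (show 0 ≤ -(u + c) by linarith [hu.2])
  have h1 : jacobiDn s k ^ 2 = 1 - k ^ 2 * jacobiSn s k ^ 2 := jacobiDn_sq hk s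
  have h2 : jacobiDn m k ^ 2 = 1 - k ^ 2 * jacobiSn m k ^ 2 := jacobiDn_sq hk m
  have h3 := jacobiCn_sq k s
  have h4 := jacobiCn_sq k m
  have e : (jacobiSn s k * jacobiDn m k) ^ 2 + jacobiCn s k ^ 2 - (jacobiDn s k * jacobiSn m k) ^ 2 =
      jacobiCn m k ^ 2 := by
    rw [mul_pow, mul_pow, h1, h2, h3, h4]; ring
  rw [← pencil_factor hk (by linarith) hk2 s m, homQuadric, mem_ofPred_eq, ← sub_eq_zero]
  simp only [homVertex, Matrix.cons_val]
  generalize Real.sqrt (u + a) = p at *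
  generalize Real.sqrt (u + b) = q at *
  generalize Real.sqrt (-(u + c)) = r at *
  generalize jacobiSn s k * jacobiDn m k = x at *
  generalize jacobiDn s k * jacobiSn m k = z at *
  refine Eq.congr_left ?_
  linear_combination (μ + b) * (μ + c) * x ^ 2 * s1 + (μ + a) * (μ + c) * jacobiCn s k ^ 2 * s2 +
    (μ + a) * (μ + b) * ε ^ 2 * z ^ 2 * s3 - (μ + a) * (μ + b) * (u + c) * z ^ 2 * hε2
    + (μ + a) * (μ + b) * (μ + c) * e

lemma eq_of_sq_eq_sq_of_mul_pos {x y : ℝ} (h : x ^ 2 = y ^ 2) (hpos : x ≠ 0 → 0 < x * y) :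
    x = y := by
  by_cases hx : x = 0
  · rw [hx, zero_pow two_ne_zero] at h
    rw [hx, pow_eq_zero_iff two_ne_zero |>.1 h.symm]
  · rcases sq_eq_sq_iff_eq_or_eq_neg.1 h with h | h
    · exact h
    · have := hpos hx
      rw [h] at this
      linarith [mul_self_nonneg y]

/-- The two vertices with parameters `s ± m` and `s' ± m'` are connected by a line of curvature
only if `s = s'` or `m = m'` modulo half periods. -/
lemma CurvatureConnected.exists_period {k : ℝ} (hk : k ∈ Ioo (0 : ℝ) 1)
    (hk2 : (a - c) * k ^ 2 = a - b) (hcb : c < b) (hba : b < a) (hu : u ∈ Ioo (-b) (-c))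
    {ε : ℝ} (hε : ε = 1 ∨ ε = -1) {s m s' m' : ℝ}
    (hf : FinPar k (s + m) (s - m)) (hf' : FinPar k (s' + m') (s' - m'))
    (h : CurvatureConnected a b c u
      (rulingVertex (Real.sqrt (u + a)) (Real.sqrt (u + b)) (Real.sqrt (-(u + c))) ε
        (jacobiAm k (s + m)) (jacobiAm k (s - m)))
      (rulingVertex (Real.sqrt (u + a)) (Real.sqrt (u + b)) (Real.sqrt (-(u + c))) ε
        (jacobiAm k (s' + m')) (jacobiAm k (s' - m')))) :
    ∃ j : ℤ, s = s' + j * (2 * ellipticK k) ∨ m = m' + j * (2 * ellipticK k) := by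
  have sx := Real.sqrt_pos.2 (show 0 < u + a by linarith [hu.1])
  have sy := Real.sqrt_pos.2 (show 0 < u + b by linarith [hu.1])
  have sz := Real.sqrt_pos.2 (show 0 < -(u + c) by linarith [hu.2])
  obtain ⟨c0, -⟩ := rulingVertex_eq_jacobi hk 1 1 1 ε hf
  obtain ⟨c0', -⟩ := rulingVertex_eq_jacobi hk 1 1 1 ε hf'
  have hε2 : ε * ε = 1 := by rcases hε with rfl | rfl <;> norm_num
  obtain ⟨μ, hμ, h⟩ := h
  rw [homCoord_rulingVertex hk _ _ _ ε hf, homCoord_rulingVertex hk _ _ _ ε hf'] at h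
  have hS := (homVertex_mem_iff (μ := μ) hk hk2 hcb hba hu hε s m).1
  have hS' := (homVertex_mem_iff (μ := μ) hk hk2 hcb hba hu hε s' m').1
  have m1 : homVertex k (Real.sqrt (u + a)) (Real.sqrt (u + b)) (Real.sqrt (-(u + c))) ε s m
      ∈ homQuadric a b c μ := by
    have := homQuadric_smul (a := a) (b := b) (c := c) (u := μ)
      (by rcases h with h | h <;> exact h.source_mem.2.2) (jacobiCn m k)
    rwa [smul_smul, mul_inv_cancel₀ c0, one_smul] at this
  have m2 : homVertex k (Real.sqrt (u + a)) (Real.sqrt (u + b)) (Real.sqrt (-(u + c))) ε s' m'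
      ∈ homQuadric a b c μ := by
    have : (jacobiCn m' k)⁻¹ • homVertex k (Real.sqrt (u + a)) (Real.sqrt (u + b))
        (Real.sqrt (-(u + c))) ε s' m' ∈ homQuadric a b c μ := by
      rcases h with h | h
      · exact h.target_mem.2.2
      · exact homQuadric_neg h.target_mem.2.2
    have := homQuadric_smul this (jacobiCn m' k)
    rwa [smul_smul, mul_inv_cancel₀ c0', one_smul] at this
  replace m1 := (mul_eq_zero.1 (hS m1)).resolve_left (sub_ne_zero.2 hμ.symm)
  replace m2 := (mul_eq_zero.1 (hS' m2)).resolve_left (sub_ne_zero.2 hμ.symm)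
  clear hS hS'
  have d1 := jacobiDn_pos hk s
  have d2 := jacobiDn_pos hk m
  have d1' := jacobiDn_pos hk s'
  have d2' := jacobiDn_pos hk m'
  have r1 := jacobiCn_sq k s
  have r2 := jacobiCn_sq k m
  have r1' := jacobiCn_sq k s'
  have r2' := jacobiCn_sq k m'
  -- a product of two coordinates keeps its sign along a line of curvature without zeros
  have hsign : ∀ i j : Fin 4, (∀ X : Fin 4 → ℝ, X ≠ 0 → X ∈ homQuadric a b c u →
      X ∈ homQuadric a b c μ → X i * X j ≠ 0) → ∀ {x y x' y' : ℝ},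
      homVertex k (Real.sqrt (u + a)) (Real.sqrt (u + b)) (Real.sqrt (-(u + c))) ε s m i = x →
      homVertex k (Real.sqrt (u + a)) (Real.sqrt (u + b)) (Real.sqrt (-(u + c))) ε s m j = y →
      homVertex k (Real.sqrt (u + a)) (Real.sqrt (u + b)) (Real.sqrt (-(u + c))) ε s' m' i = x' →
      homVertex k (Real.sqrt (u + a)) (Real.sqrt (u + b)) (Real.sqrt (-(u + c))) ε s' m' j = y' →
      0 < (x * y) * (x' * y') := by
    rintro i j hij _ _ _ _ rfl rfl rfl rfl
    generalize homVertex k (Real.sqrt (u + a)) (Real.sqrt (u + b)) (Real.sqrt (-(u + c))) ε s m = U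
      at *
    generalize homVertex k (Real.sqrt (u + a)) (Real.sqrt (u + b)) (Real.sqrt (-(u + c))) ε s' m' =
      U' at *
    have hc : Continuous fun X : Fin 4 → ℝ => X i * X j := by fun_prop
    have q : 0 < ((jacobiCn m k)⁻¹ * (jacobiCn m' k)⁻¹) ^ 2 :=
      pow_two_pos_of_ne_zero (mul_ne_zero (inv_ne_zero c0) (inv_ne_zero c0'))
    refine (mul_pos_iff_of_pos_left q).1 ?_
    rcases h with h | h
    · refine (h.mul_pos hc fun X hX => hij X hX.1 hX.2.1 hX.2.2).trans_eq ?_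
      simp only [Pi.smul_apply, smul_eq_mul]
      ring
    · refine (h.mul_pos hc fun X hX => hij X hX.1 hX.2.1 hX.2.2).trans_eq ?_
      simp only [Pi.neg_apply, Pi.smul_apply, smul_eq_mul]
      ring
  clear h
  have hab : 0 < a - b := by linarith
  have hbc : 0 < b - c := by linarith
  -- the range of the parameters of the two-sheeted hyperboloids
  have range1 : ∀ t, μ + a - (a - b) * jacobiSn t k ^ 2 = 0 → μ ≤ -b := by
    intro t ht
    have e3 : 0 ≤ (a - b) * jacobiCn t k ^ 2 := mul_nonneg hab.le (sq_nonneg _)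
    rw [jacobiCn_sq k t] at e3
    linarith
  -- the range of the parameters of the ellipsoids
  have range3 : ∀ t, jacobiCn t k ≠ 0 → (μ + c) * (1 - jacobiSn t k ^ 2) -
      (b - c) * jacobiSn t k ^ 2 = 0 → -c ≤ μ := by
    intro t ht0 ht
    have e2 : 0 < jacobiCn t k ^ 2 := pow_two_pos_of_ne_zero ht0
    have e3 : 0 ≤ (b - c) * jacobiSn t k ^ 2 := mul_nonneg hbc.le (sq_nonneg _)
    rw [← jacobiCn_sq k t] at ht
    by_contra hn
    have : (μ + c) * jacobiCn t k ^ 2 < 0 := mul_neg_of_neg_of_pos (by linarith) e2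
    linarith
  rcases mul_eq_zero.1 m1 with f1 | f1 <;> rcases mul_eq_zero.1 m2 with f2 | f2
  · have hsq : jacobiSn s k ^ 2 = jacobiSn s' k ^ 2 := by
      apply mul_left_cancel₀ hab.ne'
      linarith
    have hprod : jacobiSn s k * jacobiCn s k = jacobiSn s' k * jacobiCn s' k := by
      refine eq_of_sq_eq_sq_of_mul_pos (by rw [mul_pow, mul_pow, r1, r1', hsq]) fun hz => ?_
      obtain ⟨z1, z2⟩ := mul_ne_zero_iff.1 hz
      have y1 : 0 < (a - b) * jacobiSn s k ^ 2 := mul_pos hab (pow_two_pos_of_ne_zero z1)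
      have y2 : 0 < (a - b) * jacobiCn s k ^ 2 := mul_pos hab (pow_two_pos_of_ne_zero z2)
      rw [r1] at y2
      have := hsign 0 1 (fun X => xy_ne_zero hcb hba hu (by linarith) (by linarith)) rfl rfl rfl rfl
      simp only [homVertex, Matrix.cons_val] at this
      generalize Real.sqrt (u + a) = p at *
      generalize Real.sqrt (u + b) = q at *
      refine (mul_pos_iff_of_pos_left
        (mul_pos (mul_pos (mul_pos sx sx) (mul_pos sy sy)) (mul_pos d2 d2'))).1
        (this.trans_eq ?_)
      ring
    obtain ⟨j, hj⟩ := exists_eq_add_two_K hk hsq hprod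
    exact ⟨j, Or.inl hj⟩
  · have := range1 s f1
    have := range3 m' c0' f2
    linarith
  · have := range3 m c0 f1
    have := range1 s' f2
    linarith
  · have hμc := range3 m c0 f1
    have hsq : jacobiSn m k ^ 2 = jacobiSn m' k ^ 2 := by
      apply mul_left_cancel₀ (show μ + b ≠ 0 by linarith)
      linarith
    have hprod : jacobiSn m k * jacobiCn m k = jacobiSn m' k * jacobiCn m' k := by
      refine eq_of_sq_eq_sq_of_mul_pos (by rw [mul_pow, mul_pow, r2, r2', hsq]) fun hz => ?_
      obtain ⟨z1, z2⟩ := mul_ne_zero_iff.1 hz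
      have y1 : 0 < (b - c) * jacobiSn m k ^ 2 := mul_pos hbc (pow_two_pos_of_ne_zero z1)
      have hμc' : -c < μ := by
        rcases eq_or_lt_of_le hμc with h | h
        · rw [← h] at f1; linarith
        · exact h
      have := hsign 2 3 (fun X => zw_ne_zero hcb hba hu hμc') rfl rfl rfl rfl
      simp only [homVertex, Matrix.cons_val] at this
      generalize Real.sqrt (-(u + c)) = r at *
      refine (mul_pos_iff_of_pos_left (mul_pos (mul_pos sz sz) (mul_pos d1 d1'))).1
        (this.trans_eq ?_)
      linear_combination (r * r * (jacobiDn s k * jacobiDn s' k) *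
        (jacobiSn m k * jacobiCn m k * (jacobiSn m' k * jacobiCn m' k))) * hε2
    obtain ⟨j, hj⟩ := exists_eq_add_two_K hk hsq hprod
    exact ⟨j, Or.inr hj⟩

/-- Vertices with a common parameter `s` or `m` are connected by a line of curvature. -/
lemma curvatureConnected_of_eq {k : ℝ} (hk : k ∈ Ioo (0 : ℝ) 1)
    (hk2 : (a - c) * k ^ 2 = a - b) (hcb : c < b) (hba : b < a) (hu : u ∈ Ioo (-b) (-c))
    {ε : ℝ} (hε : ε = 1 ∨ ε = -1) {s m s' m' : ℝ}
    (hf : FinPar k (s + m) (s - m))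
    (hf' : FinPar k (s' + m') (s' - m')) (h : s = s' ∨ m = m') :
    CurvatureConnected a b c u
      (rulingVertex (Real.sqrt (u + a)) (Real.sqrt (u + b)) (Real.sqrt (-(u + c))) ε
        (jacobiAm k (s + m)) (jacobiAm k (s - m)))
      (rulingVertex (Real.sqrt (u + a)) (Real.sqrt (u + b)) (Real.sqrt (-(u + c))) ε
        (jacobiAm k (s' + m')) (jacobiAm k (s' - m'))) := by
  have sz := Real.sqrt_pos.2 (show 0 < -(u + c) by linarith [hu.2])
  obtain ⟨c0, -⟩ := rulingVertex_eq_jacobi hk 1 1 1 ε hf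
  obtain ⟨c0', -⟩ := rulingVertex_eq_jacobi hk 1 1 1 ε hf'
  have hε0 : ε ≠ 0 := by rcases hε with rfl | rfl <;> norm_num
  have hcone : ∀ μ, ∀ X ∈ {X : Fin 4 → ℝ | X ≠ 0 ∧ X ∈ homQuadric a b c u ∧ X ∈ homQuadric a b c μ},
      ∀ t : ℝ, t ≠ 0 →
      t • X ∈ {X : Fin 4 → ℝ | X ≠ 0 ∧ X ∈ homQuadric a b c u ∧ X ∈ homQuadric a b c μ} :=
    fun μ X hX t ht => ⟨smul_ne_zero ht hX.1, homQuadric_smul hX.2.1 t, homQuadric_smul hX.2.2 t⟩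
  have hne : ∀ s m, homVertex k (Real.sqrt (u + a)) (Real.sqrt (u + b))
      (Real.sqrt (-(u + c))) ε s m ≠ 0 := by
    intro s m h0
    have e2 := congrFun h0 2
    have e3 := congrFun h0 3
    simp only [homVertex, Matrix.cons_val, Pi.zero_apply, neg_eq_zero, mul_eq_zero, sz.ne', hε0,
      (jacobiDn_pos hk s).ne', false_or] at e2 e3
    have := jacobi_sn_sq_add_cn_sq k m
    rw [e2, e3] at this
    norm_num at this
  have hQu : ∀ s m, homVertex k (Real.sqrt (u + a)) (Real.sqrt (u + b))
      (Real.sqrt (-(u + c))) ε s m ∈ homQuadric a b c u := by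
    intro s m
    rw [homVertex_mem_iff hk hk2 hcb hba hu hε]
    ring
  have b1 := continuous_jacobiSn hk
  have b2 := continuous_jacobiCn hk
  have b3 := continuous_jacobiDn hk
  unfold CurvatureConnected
  simp only [homCoord_rulingVertex hk _ _ _ ε hf, homCoord_rulingVertex hk _ _ _ ε hf']
  rcases h with rfl | rfl
  · have e1 := jacobiCn_sq k s
    have e3 : 0 ≤ (a - b) * jacobiCn s k ^ 2 :=
      mul_nonneg (by linarith) (sq_nonneg _)
    rw [e1] at e3
    refine ⟨-a + (a - b) * jacobiSn s k ^ 2, by linarith [hu.1], ?_⟩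
    refine joinedIn_of_curve (hcone _) (g := fun t => homVertex k (Real.sqrt (u + a))
      (Real.sqrt (u + b)) (Real.sqrt (-(u + c))) ε s t) ?_ (fun t => ⟨hne s t, hQu s t, ?_⟩)
      (inv_ne_zero c0) (inv_ne_zero c0') m m'
    · refine continuous_pi fun i => ?_
      fin_cases i <;> simp only [homVertex] <;> simp <;> fun_prop
    · rw [homVertex_mem_iff hk hk2 hcb hba hu hε]
      ring
  · have e1 := jacobiCn_sq k m
    have e3 : 0 ≤ (b - c) * jacobiSn m k ^ 2 / jacobiCn m k ^ 2 :=
      div_nonneg (mul_nonneg (by linarith) (sq_nonneg _)) (sq_nonneg _)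
    refine ⟨-c + (b - c) * jacobiSn m k ^ 2 / jacobiCn m k ^ 2,
      by linarith [hu.2], ?_⟩
    refine joinedIn_of_curve (hcone _) (g := fun t => homVertex k (Real.sqrt (u + a))
      (Real.sqrt (u + b)) (Real.sqrt (-(u + c))) ε t m) ?_ (fun t => ⟨hne t m, hQu t m, ?_⟩)
      (inv_ne_zero c0) (inv_ne_zero c0') s s'
    · refine continuous_pi fun i => ?_
      fin_cases i <;> simp only [homVertex] <;> simp <;> fun_prop
    · rw [homVertex_mem_iff hk hk2 hcb hba hu hε, ← e1]
      field_simp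
      ring

end CurvatureConnected

/-! ### AC-grids in terms of elliptic parameters -/

section MeshPair

variable {k : ℝ}

/-- Two sequences of elliptic parameters which belong to a grid: all vertices are finite, any three
consecutive lines of either sequence are distinct, and all steps of the two sequences agree up to
sign and periods. -/
structure MeshPair (k : ℝ) (τ σ : ℤ → ℝ) : Prop where
  fin : ∀ n n', FinPar k (τ n) (σ n')
  rel : ∀ n n', MeshRel k (τ (n + 1) - τ n) (σ (n' + 1) - σ n')
  fst_ne_one : ∀ n, ¬ SamePar k (τ n) (τ (n + 1))
  fst_ne_two : ∀ n, ¬ SamePar k (τ n) (τ (n + 2))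
  snd_ne_one : ∀ n, ¬ SamePar k (σ n) (σ (n + 1))
  snd_ne_two : ∀ n, ¬ SamePar k (σ n) (σ (n + 2))

lemma MeshRel.neg_left {x y : ℝ} (h : MeshRel k x y) : MeshRel k (-x) y := by
  obtain ⟨j, h | h⟩ := h
  · refine ⟨-j, Or.inr ?_⟩
    rw [h]; push_cast; ring
  · refine ⟨-j, Or.inl ?_⟩
    rw [h]; push_cast; ring

lemma MeshRel.of_common {x y z : ℝ} (h : MeshRel k x z) (h' : MeshRel k y z) : MeshRel k x y := by
  obtain ⟨i, h | h⟩ := h <;> obtain ⟨j, h' | h'⟩ := h'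
  · exact ⟨i - j, Or.inl (by push_cast; linarith)⟩
  · exact ⟨i + j, Or.inr (by push_cast; linarith)⟩
  · exact ⟨i + j, Or.inr (by push_cast; linarith)⟩
  · exact ⟨i - j, Or.inl (by push_cast; linarith)⟩

/-- A step by half a period would let the next but one line coincide. -/
lemma MeshPair.fst_step_ne (hk : k ∈ Ioo (0 : ℝ) 1) {τ σ : ℤ → ℝ} (h : MeshPair k τ σ) (n j : ℤ) :
    τ (n + 1) - τ n ≠ j * (2 * ellipticK k) := by
  intro hj
  obtain ⟨i, hi⟩ := (h.rel (n + 1) 0).of_common (h.rel n 0)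
  rw [show n + 1 + 1 = n + 2 by ring] at hi
  refine h.fst_ne_two n (SamePar.symm ((samePar_iff hk).2 ?_))
  rcases hi with hi | hi
  · refine ⟨i + j, ?_⟩
    push_cast
    linear_combination hi + 2 * hj
  · exact ⟨i, by linear_combination hi⟩

lemma FinPar.add_period (hk : k ∈ Ioo (0 : ℝ) 1) {τ σ : ℝ} (h : FinPar k τ σ) (j : ℤ) :
    FinPar k (τ + j * (4 * ellipticK k)) σ := by
  unfold FinPar at *
  rw [jacobiAm_add_four_K hk, show (jacobiAm k τ + j * (2 * Real.pi) - jacobiAm k σ) / 2 =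
    (jacobiAm k τ - jacobiAm k σ) / 2 + j * Real.pi by ring, Real.cos_add_int_mul_pi]
  exact mul_ne_zero (zpow_ne_zero _ (by norm_num)) h

end MeshPair

section ACGrid

variable {a b c u k : ℝ}

/-- If two vertices are connected by a line of curvature, then the differences of their parameters
agree up to sign and periods. -/
lemma CurvatureConnected.meshRel (hk : k ∈ Ioo (0 : ℝ) 1)
    (hk2 : (a - c) * k ^ 2 = a - b) (hcb : c < b) (hba : b < a) (hu : u ∈ Ioo (-b) (-c))
    {ε : ℝ} (hε : ε = 1 ∨ ε = -1) {τ σ τ' σ' : ℝ} (hf : FinPar k τ σ) (hf' : FinPar k τ' σ')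
    (h : CurvatureConnected a b c u
      (rulingVertex (Real.sqrt (u + a)) (Real.sqrt (u + b)) (Real.sqrt (-(u + c))) ε
        (jacobiAm k τ) (jacobiAm k σ))
      (rulingVertex (Real.sqrt (u + a)) (Real.sqrt (u + b)) (Real.sqrt (-(u + c))) ε
        (jacobiAm k τ') (jacobiAm k σ'))) : MeshRel k (τ' - τ) (σ' - σ) := by
  obtain ⟨s, m, rfl, rfl⟩ : ∃ s m, τ = s + m ∧ σ = s - m :=
    ⟨(τ + σ) / 2, (τ - σ) / 2, by ring, by ring⟩
  obtain ⟨s', m', rfl, rfl⟩ : ∃ s m, τ' = s + m ∧ σ' = s - m :=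
    ⟨(τ' + σ') / 2, (τ' - σ') / 2, by ring, by ring⟩
  obtain ⟨j, hj | hj⟩ := h.exists_period hk hk2 hcb hba hu hε hf hf'
  · refine ⟨-j, Or.inr ?_⟩
    rw [hj]; push_cast; ring
  · refine ⟨-j, Or.inl ?_⟩
    rw [hj]; push_cast; ring

/-- Conversely, vertices are connected by a line of curvature if the differences of their
parameters agree up to sign and periods. -/
lemma curvatureConnected_of_meshRel (hk : k ∈ Ioo (0 : ℝ) 1)
    (hk2 : (a - c) * k ^ 2 = a - b) (hcb : c < b) (hba : b < a) (hu : u ∈ Ioo (-b) (-c))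
    {ε : ℝ} (hε : ε = 1 ∨ ε = -1) {τ σ τ' σ' : ℝ} (hf : FinPar k τ σ) (hf' : FinPar k τ' σ')
    (h : MeshRel k (τ' - τ) (σ' - σ)) :
    CurvatureConnected a b c u
      (rulingVertex (Real.sqrt (u + a)) (Real.sqrt (u + b)) (Real.sqrt (-(u + c))) ε
        (jacobiAm k τ) (jacobiAm k σ))
      (rulingVertex (Real.sqrt (u + a)) (Real.sqrt (u + b)) (Real.sqrt (-(u + c))) ε
        (jacobiAm k τ') (jacobiAm k σ')) := by
  obtain ⟨j, h⟩ := h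
  obtain ⟨ρ, rfl⟩ : ∃ ρ, τ' = ρ + j * (4 * ellipticK k) :=
    ⟨τ' - j * (4 * ellipticK k), by ring⟩
  replace hf' := hf'.add_period hk (-j)
  rw [show ρ + j * (4 * ellipticK k) + (-j : ℤ) * (4 * ellipticK k) = ρ by push_cast; ring] at hf'
  rw [rulingVertex_add_period hk]
  obtain ⟨s, m, rfl, rfl⟩ : ∃ s m, τ = s + m ∧ σ = s - m :=
    ⟨(τ + σ) / 2, (τ - σ) / 2, by ring, by ring⟩
  obtain ⟨s', m', rfl, rfl⟩ : ∃ s m, ρ = s + m ∧ σ' = s - m :=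
    ⟨(ρ + σ') / 2, (ρ - σ') / 2, by ring, by ring⟩
  refine curvatureConnected_of_eq hk hk2 hcb hba hu hε hf hf' ?_
  rcases h with h | h
  · right; linarith
  · left; linarith

lemma acGrid_axes_pos (hba : b < a) (hu : u ∈ Ioo (-b) (-c)) :
    0 < Real.sqrt (u + a) ∧ 0 < Real.sqrt (u + b) ∧ 0 < Real.sqrt (-(u + c)) :=
  ⟨Real.sqrt_pos.2 (by linarith [hu.1]), Real.sqrt_pos.2 (by linarith [hu.1]),
    Real.sqrt_pos.2 (by linarith [hu.2])⟩

/-- Every AC-grid is given by two sequences of elliptic parameters. -/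
theorem IsACGrid.exists_meshPair (hk : k ∈ Ioo (0 : ℝ) 1)
    (hk2 : (a - c) * k ^ 2 = a - b) (hcb : c < b) (hba : b < a) (hu : u ∈ Ioo (-b) (-c))
    {G : LineGrid E3} (hG : IsACGrid a b c u G) :
    ∃ ε : ℝ, ∃ τ σ : ℤ → ℝ, (ε = 1 ∨ ε = -1) ∧ MeshPair k τ σ ∧
      G = acGrid a b c u ε (fun n => jacobiAm k (τ n)) (fun n => jacobiAm k (σ n)) := by
  obtain ⟨hp, hq, hr⟩ := acGrid_axes_pos hba hu
  have h1 : ∀ n, ∃ ε φ, (ε = 1 ∨ ε = -1) ∧ G.fst n =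
      ruling (Real.sqrt (u + a)) (Real.sqrt (u + b)) (Real.sqrt (-(u + c))) ε φ := fun n =>
    exists_eq_ruling hp hq hr (hG.grid.line_fst n) (hG.grid.vertex_fst n 0) fun Q hQ =>
      (mem_confocalQuadric_iff hba hu).1 (hG.fst_asymptotic n hQ)
  have h2 : ∀ n, ∃ ε φ, (ε = 1 ∨ ε = -1) ∧ G.snd n =
      ruling (Real.sqrt (u + a)) (Real.sqrt (u + b)) (Real.sqrt (-(u + c))) ε φ := fun n =>
    exists_eq_ruling hp hq hr (hG.grid.line_snd n) (hG.grid.vertex_snd 0 n) fun Q hQ =>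
      (mem_confocalQuadric_iff hba hu).1 (hG.snd_asymptotic n hQ)
  choose e φ he hφ using h1
  choose e' χ he' hχ using h2
  have hopp : ∀ n n', e' n' = -e n := by
    intro n n'
    have hne : e n ≠ e' n' := by
      intro h
      have v1 := hG.grid.vertex_fst n n'
      have v2 := hG.grid.vertex_snd n n'
      rw [hφ n] at v1
      rw [hχ n', ← h] at v2
      obtain ⟨c1, c2⟩ := angle_eq_of_mem_ruling hp.ne' hq.ne' hr.ne' v1 v2
      apply hG.families n n'
      rw [hφ n, hχ n', ← h]
      exact ruling_congr c1 c2
    rcases he n with h | h <;> rcases he' n' with h' | h' <;> rw [h, h'] at hne ⊢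
    · exact absurd rfl hne
    · rw [neg_neg]
    · exact absurd rfl hne
  have hfst : ∀ n, e n = e 0 := fun n => by
    have := hopp n 0
    have := hopp 0 0
    linarith
  have am : ∀ x, jacobiAm k (ellipticF k x) = x := jacobiAm_ellipticF hk
  replace hφ : ∀ n, G.fst n = ruling (Real.sqrt (u + a)) (Real.sqrt (u + b))
      (Real.sqrt (-(u + c))) (e 0) (jacobiAm k (ellipticF k (φ n))) := fun n => by
    rw [hφ n, hfst n, am]
  replace hχ : ∀ n, G.snd n = ruling (Real.sqrt (u + a)) (Real.sqrt (u + b))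
      (Real.sqrt (-(u + c))) (-e 0) (jacobiAm k (ellipticF k (χ n))) := fun n => by
    rw [hχ n, hopp 0 n, am]
  have hv : ∀ n n', FinPar k (ellipticF k (φ n)) (ellipticF k (χ n')) ∧ G.vertex n n' =
      rulingVertex (Real.sqrt (u + a)) (Real.sqrt (u + b)) (Real.sqrt (-(u + c))) (e 0)
        (jacobiAm k (ellipticF k (φ n))) (jacobiAm k (ellipticF k (χ n'))) := by
    intro n n'
    have v1 := hG.grid.vertex_fst n n'
    have v2 := hG.grid.vertex_snd n n'
    rw [hφ n] at v1
    rw [hχ n'] at v2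
    exact eq_rulingVertex hp.ne' hq.ne' hr.ne' (he 0) v1 v2
  refine ⟨e 0, fun n => ellipticF k (φ n), fun n => ellipticF k (χ n), he 0, ⟨fun n n' => (hv n n').1,
    fun n n' => ?_, fun n h => hG.grid.fst_ne_one n ?_, fun n h => hG.grid.fst_ne_two n ?_,
    fun n h => hG.grid.snd_ne_one n ?_, fun n h => hG.grid.snd_ne_two n ?_⟩,
    LineGrid.ext' hφ hχ fun n n' => (hv n n').2⟩
  · have hd := hG.diagonal n n'
    rw [(hv n n').2, (hv (n + 1) (n' + 1)).2] at hd
    exact hd.meshRel hk hk2 hcb hba hu (he 0) (hv n n').1 (hv (n + 1) (n' + 1)).1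
  · rw [hφ, hφ]; exact ruling_congr h.1 h.2
  · rw [hφ, hφ]; exact ruling_congr h.1 h.2
  · rw [hχ, hχ]; exact ruling_congr h.1 h.2
  · rw [hχ, hχ]; exact ruling_congr h.1 h.2

/-- Conversely, any two sequences of elliptic parameters as above give rise to an AC-grid on each
of the confocal hyperboloids. -/
theorem MeshPair.isACGrid (hk : k ∈ Ioo (0 : ℝ) 1)
    (hk2 : (a - c) * k ^ 2 = a - b) (hcb : c < b) (hba : b < a) (hu : u ∈ Ioo (-b) (-c))
    {ε : ℝ} (hε : ε = 1 ∨ ε = -1) {τ σ : ℤ → ℝ} (h : MeshPair k τ σ) :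
    IsACGrid a b c u (acGrid a b c u ε (fun n => jacobiAm k (τ n)) (fun n => jacobiAm k (σ n))) := by
  obtain ⟨hp, hq, hr⟩ := acGrid_axes_pos hba hu
  have hε' : -ε = 1 ∨ -ε = -1 := by rcases hε with rfl | rfl <;> norm_num
  refine ⟨⟨fun n => finrank_lineThrough (ruling_dir_ne_zero hp.ne' hq.ne' hε),
    fun n => finrank_lineThrough (ruling_dir_ne_zero hp.ne' hq.ne' hε'),
    fun n n' => (rulingVertex_mem hε (h.fin n n')).1,
    fun n n' => (rulingVertex_mem hε (h.fin n n')).2,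
    fun n hn => h.fst_ne_one n (angle_eq_of_ruling_eq hp.ne' hq.ne' hr.ne' hn),
    fun n hn => h.fst_ne_two n (angle_eq_of_ruling_eq hp.ne' hq.ne' hr.ne' hn),
    fun n hn => h.snd_ne_one n (angle_eq_of_ruling_eq hp.ne' hq.ne' hr.ne' hn),
    fun n hn => h.snd_ne_two n (angle_eq_of_ruling_eq hp.ne' hq.ne' hr.ne' hn)⟩,
    fun n P hP => (mem_confocalQuadric_iff hba hu).2
      (mem_ruling_quadric hp.ne' hq.ne' hr.ne' hε hP),
    fun n P hP => (mem_confocalQuadric_iff hba hu).2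
      (mem_ruling_quadric hp.ne' hq.ne' hr.ne' hε' hP),
    fun n n' => ruling_ne_ruling_neg hp.ne' hq.ne' hr.ne' hε,
    fun n n' => curvatureConnected_of_meshRel hk hk2 hcb hba hu hε (h.fin n n')
      (h.fin (n + 1) (n' + 1)) (h.rel n n'),
    fun n n' => curvatureConnected_of_meshRel hk hk2 hcb hba hu hε (h.fin (n + 1) n')
      (h.fin n (n' + 1)) ?_⟩
  have := (h.rel n n').neg_left
  rwa [neg_sub] at this

/-- The diagonals of the quadrilaterals change monotonically under the deformation, as their
end points do not lie on a common line of the hyperboloid. -/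
lemma strictMono_or_strictAnti_diagonal (hba : b < a) (hu : u ∈ Ioo (-b) (-c)) {ε : ℝ}
    (hε : ε = 1 ∨ ε = -1) {τ σ τ' σ' : ℝ} (h : FinPar k τ σ) (h' : FinPar k τ' σ')
    (hτ : ¬ SamePar k τ τ') (hσ : ¬ SamePar k σ σ') {P Q : E3}
    (hP : P = rulingVertex (Real.sqrt (u + a)) (Real.sqrt (u + b)) (Real.sqrt (-(u + c))) ε
      (jacobiAm k τ) (jacobiAm k σ))
    (hQ : Q = rulingVertex (Real.sqrt (u + a)) (Real.sqrt (u + b)) (Real.sqrt (-(u + c))) ε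
      (jacobiAm k τ') (jacobiAm k σ')) :
    StrictMonoOn (fun v => dist (deform a b c u v P) (deform a b c u v Q)) (Icc (-b) (-c)) ∨
      StrictAntiOn (fun v => dist (deform a b c u v P) (deform a b c u v Q)) (Icc (-b) (-c)) := by
  have key : EqOn (fun v => dist
      (!₂[Real.sqrt (v + a) * rulingVertex 1 1 1 ε (jacobiAm k τ) (jacobiAm k σ) 0,
        Real.sqrt (v + b) * rulingVertex 1 1 1 ε (jacobiAm k τ) (jacobiAm k σ) 1,
        Real.sqrt (-(v + c)) * rulingVertex 1 1 1 ε (jacobiAm k τ) (jacobiAm k σ) 2] : E3)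
      !₂[Real.sqrt (v + a) * rulingVertex 1 1 1 ε (jacobiAm k τ') (jacobiAm k σ') 0,
        Real.sqrt (v + b) * rulingVertex 1 1 1 ε (jacobiAm k τ') (jacobiAm k σ') 1,
        Real.sqrt (-(v + c)) * rulingVertex 1 1 1 ε (jacobiAm k τ') (jacobiAm k σ') 2])
      (fun v => dist (deform a b c u v P) (deform a b c u v Q)) (Icc (-b) (-c)) := by
    intro v hv
    simp only [hP, hQ, deform_rulingVertex hba hu hv]
    rw [rulingVertex_eq_normal (Real.sqrt (v + a)), rulingVertex_eq_normal (Real.sqrt (v + a))]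
  rcases strictMono_or_strictAnti_dist hba (c := c) (rulingVertex_null_ne hε h h' hτ hσ) with hm | hm
  · exact Or.inl (hm.congr key)
  · exact Or.inr (hm.congr key)

end ACGrid

/-! ### Lines and circles in the plane -/

section Plane

variable {P V x y : E2} {S : EuclideanGeometry.Sphere E2}

/-- The affine function which vanishes on the line through `P` with direction `V`. -/
def lineForm (P V x : E2) : ℝ := (x 0 - P 0) * V 1 - (x 1 - P 1) * V 0

lemma norm_sq_pos_E2 (hV : V ≠ 0) : 0 < V 0 ^ 2 + V 1 ^ 2 := by
  by_contra hn
  have h0 := sq_nonneg (V 0)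
  have h1 := sq_nonneg (V 1)
  exact hV (E2.ext (pow_eq_zero_iff two_ne_zero |>.1 (by linarith))
    (pow_eq_zero_iff two_ne_zero |>.1 (by linarith)))

lemma dist_sq_E2 (P Q : E2) : dist P Q ^ 2 = (P 0 - Q 0) ^ 2 + (P 1 - Q 1) ^ 2 := by
  rw [EuclideanSpace.dist_eq, Real.sq_sqrt (Finset.sum_nonneg fun _ _ => sq_nonneg _),
    Fin.sum_univ_two, Real.dist_eq, Real.dist_eq, sq_abs, sq_abs]

lemma inner_E2 (x y : E2) : inner ℝ x y = x 0 * y 0 + x 1 * y 1 := by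
  rw [PiLp.inner_apply, Fin.sum_univ_two]
  simp [mul_comm]

lemma mem_lineThrough_E2 : x ∈ lineThrough P V ↔
    ∃ t : ℝ, x 0 = P 0 + t * V 0 ∧ x 1 = P 1 + t * V 1 := by
  rw [mem_lineThrough]
  refine exists_congr fun t => ⟨?_, fun h => E2.ext ?_ ?_⟩
  · rintro rfl
    simp
  · simpa using h.1
  · simpa using h.2

lemma mem_lineThrough_iff_lineForm (hV : V ≠ 0) : x ∈ lineThrough P V ↔ lineForm P V x = 0 := by
  rw [mem_lineThrough_E2, lineForm]
  constructor
  · rintro ⟨t, h0, h1⟩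
    rw [h0, h1]
    ring
  · intro h
    have hpos := norm_sq_pos_E2 hV
    refine ⟨((x 0 - P 0) * V 0 + (x 1 - P 1) * V 1) / (V 0 ^ 2 + V 1 ^ 2), ?_, ?_⟩
    · field_simp
      linear_combination V 1 * h
    · field_simp
      linear_combination -V 0 * h

lemma lineForm_eq_of_mem (hx : x ∈ lineThrough P V) (z : E2) : lineForm P V z = lineForm x V z := by
  obtain ⟨t, h0, h1⟩ := mem_lineThrough_E2.1 hx
  rw [lineForm, lineForm, h0, h1]
  ring

/-- A point of a line at distance `R` from the centre of a circle of radius `R` touching the line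
is the foot of the perpendicular. -/
lemma mem_sphere_iff_of_tangent (hV : V ≠ 0) (hS : 0 < S.radius) (hx : x ∈ lineThrough P V)
    (h : lineForm P V S.center ^ 2 = S.radius ^ 2 * (V 0 ^ 2 + V 1 ^ 2)) :
    x ∈ S ↔ (S.center 0 - x 0) * V 0 + (S.center 1 - x 1) * V 1 = 0 := by
  have hpos := norm_sq_pos_E2 hV
  rw [lineForm_eq_of_mem hx, lineForm] at h
  rw [EuclideanGeometry.mem_sphere, ← sq_eq_sq₀ dist_nonneg hS.le, dist_sq_E2]
  constructor
  · intro h'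
    refine pow_eq_zero_iff two_ne_zero |>.1 ?_
    linear_combination (V 0 ^ 2 + V 1 ^ 2) * h' - h
  · intro h'
    apply mul_right_cancel₀ hpos.ne'
    linear_combination h + ((S.center 0 - x 0) * V 0 + (S.center 1 - x 1) * V 1) * h'

lemma isTangent_lineThrough_iff (hV : V ≠ 0) (hS : 0 < S.radius) :
    S.IsTangent (lineThrough P V) ↔
      lineForm P V S.center ^ 2 = S.radius ^ 2 * (V 0 ^ 2 + V 1 ^ 2) := by
  have hpos := norm_sq_pos_E2 hV
  constructor
  · rintro ⟨p, hp⟩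
    have h1 := hp.mem_sphere
    rw [EuclideanGeometry.mem_sphere, ← sq_eq_sq₀ dist_nonneg hS.le, dist_sq_E2] at h1
    have h2 : p + V ∈ lineThrough P V := by
      obtain ⟨t, h0, h1⟩ := mem_lineThrough_E2.1 hp.mem_space
      refine mem_lineThrough_E2.2 ⟨t + 1, ?_, ?_⟩
      · rw [PiLp.add_apply, h0]; ring
      · rw [PiLp.add_apply, h1]; ring
    have h3 := hp.inner_left_eq_zero_of_mem h2
    rw [vsub_eq_sub, vsub_eq_sub, add_sub_cancel_left, inner_E2, PiLp.sub_apply,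
      PiLp.sub_apply] at h3
    rw [lineForm_eq_of_mem hp.mem_space, lineForm]
    linear_combination (V 0 ^ 2 + V 1 ^ 2) * h1 - (V 0 * (p 0 - S.center 0) +
      V 1 * (p 1 - S.center 1)) * h3
  · intro h
    set t := ((S.center 0 - P 0) * V 0 + (S.center 1 - P 1) * V 1) / (V 0 ^ 2 + V 1 ^ 2) with ht
    have ht' : t * (V 0 ^ 2 + V 1 ^ 2) = (S.center 0 - P 0) * V 0 + (S.center 1 - P 1) * V 1 := by
      rw [ht, div_mul_cancel₀ _ hpos.ne']
    have hf : (S.center 0 - (P + t • V) 0) * V 0 + (S.center 1 - (P + t • V) 1) * V 1 = 0 := by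
      simp only [PiLp.add_apply, PiLp.smul_apply, smul_eq_mul]
      linear_combination -ht'
    have hm : P + t • V ∈ lineThrough P V := mem_lineThrough.2 ⟨t, rfl⟩
    refine ⟨P + t • V, (mem_sphere_iff_of_tangent hV hS hm h).2 hf, hm, ?_⟩
    intro z hz
    rw [EuclideanGeometry.Sphere.mem_orthRadius_iff_inner_left, inner_E2]
    obtain ⟨w, hw⟩ := mem_lineThrough.1 hz
    rw [hw]
    simp only [PiLp.add_apply, PiLp.smul_apply, smul_eq_mul, vsub_eq_sub, PiLp.sub_apply] at hf ⊢
    linear_combination (t - w) * hf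

lemma sOppSide_lineThrough_iff (hV : V ≠ 0) :
    (lineThrough P V).SOppSide x y ↔ lineForm P V x * lineForm P V y < 0 := by
  rw [AffineSubspace.SOppSide, AffineSubspace.wOppSide_iff_exists_wbtw,
    mem_lineThrough_iff_lineForm hV, mem_lineThrough_iff_lineForm hV]
  have hseg : ∀ t : ℝ, lineForm P V (AffineMap.lineMap x y t) =
      (1 - t) * lineForm P V x + t * lineForm P V y := by
    intro t
    simp only [AffineMap.lineMap_apply_module, lineForm, PiLp.add_apply, PiLp.smul_apply,
      smul_eq_mul]
    ring
  constructor
  · rintro ⟨⟨p, hp, t, ht, rfl⟩, hx, hy⟩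
    rw [mem_lineThrough_iff_lineForm hV, hseg] at hp
    by_contra hn
    have hpos : 0 < lineForm P V x * lineForm P V y :=
      lt_of_le_of_ne (not_lt.1 hn) (mul_ne_zero hx hy).symm
    have e : (1 - t) * (lineForm P V x * lineForm P V x) +
      t * (lineForm P V x * lineForm P V y) = 0 := by linear_combination lineForm P V x * hp
    have e1 := mul_self_pos.2 hx
    have e2 := mul_nonneg (sub_nonneg.2 ht.2) e1.le
    rcases eq_or_lt_of_le ht.1 with h | h
    · rw [← h] at e; linarith
    · have := mul_pos h hpos
      linarith
  · intro h
    have hx : lineForm P V x ≠ 0 := left_ne_zero_of_mul h.ne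
    have hy : lineForm P V y ≠ 0 := right_ne_zero_of_mul h.ne
    refine ⟨?_, hx, hy⟩
    have hd : lineForm P V x - lineForm P V y ≠ 0 := by
      intro h0
      rw [sub_eq_zero] at h0
      rw [h0] at h
      linarith [mul_self_nonneg (lineForm P V y)]
    refine ⟨_, ?_, lineForm P V x / (lineForm P V x - lineForm P V y), ?_, rfl⟩
    · rw [mem_lineThrough_iff_lineForm hV, hseg]
      field_simp
      ring
    · rcases mul_neg_iff.1 h with ⟨h1, h2⟩ | ⟨h1, h2⟩
      · exact ⟨div_nonneg h1.le (by linarith), (div_le_one (by linarith)).2 (by linarith)⟩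
      · exact ⟨div_nonneg_of_nonpos h1.le (by linarith),
          (div_le_one_of_neg (by linarith)).2 (by linarith)⟩

end Plane

/-! ### Circumscribed quadrilaterals in terms of elliptic parameters -/

section CircleModel

variable {k ν s : ℝ} {N : LineGrid E2} {τ σ : ℤ → ℝ} {F : E2} {cA cB cG : E2 → ℝ}

/-- The lines of the planar grid `N` have elliptic parameters `τ n`, `σ n'` such that the signed
distance of the point `C` from a line is `A + B sn + G cn`, divided by `± ν dn`, with coefficients
`A`, `B`, `G` which are functions of `C`. The sign `s` distinguishes the side of the lines on which
the point `F` lies. -/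
structure CircleModel (k ν s : ℝ) (N : LineGrid E2) (τ σ : ℤ → ℝ) (F : E2)
    (cA cB cG : E2 → ℝ) : Prop where
  scale : 0 < ν
  sign : s = 1 ∨ s = -1
  tangent_fst : ∀ n, ∀ S : EuclideanGeometry.Sphere E2, 0 < S.radius → (S.IsTangent (N.fst n) ↔
    circM k (cA S.center) (cB S.center) (cG S.center) (τ n) ^ 2 =
      (ν * S.radius) ^ 2 * jacobiDn (τ n) k ^ 2)
  tangent_snd : ∀ n, ∀ S : EuclideanGeometry.Sphere E2, 0 < S.radius → (S.IsTangent (N.snd n) ↔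
    circM k (cA S.center) (cB S.center) (cG S.center) (σ n) ^ 2 =
      (ν * S.radius) ^ 2 * jacobiDn (σ n) k ^ 2)
  side_fst : ∀ n C, (N.fst n).SOppSide F C ↔ 0 < s * circM k (cA C) (cB C) (cG C) (τ n)
  side_snd : ∀ n C, (N.snd n).SOppSide F C ↔ 0 < s * circM k (cA C) (cB C) (cG C) (σ n)
  eq_iff : ∀ n n', N.fst n = N.snd n' ↔ SamePar k (τ n) (σ n')
  mem_iff : ∀ n n', ∀ S : EuclideanGeometry.Sphere E2, 0 < S.radius → SamePar k (τ n) (σ n') →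
    S.IsTangent (N.fst n) →
    (N.vertex n n' ∈ S ↔ ContactAt k (cA S.center) (cB S.center) (cG S.center) (τ n))

/-- The condition "exactly one of the two lines separates" as a condition on signs. -/
lemma xor_sign_iff (hs : s = 1 ∨ s = -1) {x y d e r : ℝ} (hd : 0 < d) (he : 0 < e) (hr : 0 < r)
    (hx : x ^ 2 = r ^ 2 * d ^ 2) (hy : y ^ 2 = r ^ 2 * e ^ 2) :
    Xor (0 < s * x) (0 < s * y) ↔
      (x = r * d ∧ y = -r * e) ∨ (x = -r * d ∧ y = r * e) := by
  rw [← mul_pow] at hx hy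
  have h1 := mul_pos hr hd
  have h2 := mul_pos hr he
  rw [neg_mul, neg_mul]
  generalize r * d = X at *
  generalize r * e = Y at *
  have n1 : X ≠ -X := by linarith
  have n2 : Y ≠ -Y := by linarith
  rcases hs with rfl | rfl <;> rcases sq_eq_sq_iff_eq_or_eq_neg.1 hx with rfl | rfl <;>
    rcases sq_eq_sq_iff_eq_or_eq_neg.1 hy with rfl | rfl <;>
    simp [Xor, h1, h2, h1.le, h2.le, n1, n2, n1.symm, n2.symm]

lemma CircleModel.exists_circData (hM : CircleModel k ν s N τ σ F cA cB cG)
    (hk : k ∈ Ioo (0 : ℝ) 1) {n n' : ℤ} (h : Circumscribes F N n n') :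
    ∃ A B G ρ, CircData k A B G ρ (τ n) (τ (n + 1)) (σ n') (σ (n' + 1)) := by
  obtain ⟨S, hS, t1, t2, t3, t4, o1, o2, hc⟩ := h
  have hr := mul_pos hM.scale hS
  have e1 := (hM.tangent_fst n S hS).1 t1
  have e2 := (hM.tangent_fst (n + 1) S hS).1 t2
  have e3 := (hM.tangent_snd n' S hS).1 t3
  have e4 := (hM.tangent_snd (n' + 1) S hS).1 t4
  rw [hM.side_fst, hM.side_fst, xor_sign_iff hM.sign (jacobiDn_pos hk _) (jacobiDn_pos hk _) hr
    e1 e2] at o1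
  rw [hM.side_snd, hM.side_snd, xor_sign_iff hM.sign (jacobiDn_pos hk _) (jacobiDn_pos hk _) hr
    e3 e4] at o2
  have hcc : ∀ i ∈ ({n, n + 1} : Set ℤ), ∀ j ∈ ({n', n' + 1} : Set ℤ), S.IsTangent (N.fst i) →
      SamePar k (τ i) (σ j) →
      ContactAt k (cA S.center) (cB S.center) (cG S.center) (τ i) ∨
        SamePar k (τ (2 * n + 1 - i)) (σ (2 * n' + 1 - j)) := by
    intro i hi j hj ht hsame
    rcases hc i hi j hj ((hM.eq_iff i j).2 hsame) with h | h
    · exact Or.inl ((hM.mem_iff i j S hS hsame ht).1 h)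
    · exact Or.inr ((hM.eq_iff _ _).1 h)
  have c11 := hcc n (by simp) n' (by simp) t1
  have c12 := hcc n (by simp) (n' + 1) (by simp) t1
  have c21 := hcc (n + 1) (by simp) n' (by simp) t2
  have c22 := hcc (n + 1) (by simp) (n' + 1) (by simp) t2
  simp only [show ∀ m : ℤ, 2 * m + 1 - m = m + 1 from fun m => by ring,
    show ∀ m : ℤ, 2 * m + 1 - (m + 1) = m from fun m => by ring] at c11 c12 c21 c22
  rcases o1 with ⟨o1, o1'⟩ | ⟨o1, o1'⟩
  · exact ⟨_, _, _, ν * S.radius, hr.ne', o1, o1', o2, c11, c12, c21, c22⟩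
  · refine ⟨_, _, _, -(ν * S.radius), neg_ne_zero.2 hr.ne', o1, ?_, ?_, c11, c12, c21, c22⟩
    · rwa [neg_neg]
    · rwa [neg_neg, or_comm]

lemma CircleModel.circumscribes (hM : CircleModel k ν s N τ σ F cA cB cG)
    (hk : k ∈ Ioo (0 : ℝ) 1) {n n' : ℤ} {C : E2} {ρ : ℝ}
    (h : CircData k (cA C) (cB C) (cG C) ρ (τ n) (τ (n + 1)) (σ n') (σ (n' + 1))) :
    Circumscribes F N n n' := by
  have hS : 0 < |ρ| / ν := div_pos (abs_pos.2 h.ne) hM.scale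
  have hr : ν * (|ρ| / ν) = |ρ| := mul_div_cancel₀ _ hM.scale.ne'
  have hsq : ∀ {x d : ℝ}, x = ρ * d ∨ x = -ρ * d → x ^ 2 = |ρ| ^ 2 * d ^ 2 := by
    rintro x d (rfl | rfl) <;> rw [sq_abs] <;> ring
  have hor : ∀ {x d y e : ℝ}, (x = ρ * d ∧ y = -ρ * e) ∨ (x = -ρ * d ∧ y = ρ * e) →
      (x = |ρ| * d ∧ y = -|ρ| * e) ∨ (x = -|ρ| * d ∧ y = |ρ| * e) := by
    intro x d y e h
    rcases abs_choice ρ with h' | h' <;> rw [h']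
    · exact h
    · rwa [neg_neg, or_comm]
  have e1 := hsq (Or.inl h.one)
  have e2 := hsq (Or.inr h.two)
  have e3 := hsq (h.other.imp And.left And.left)
  have e4 := hsq (h.other.symm.imp And.right And.right)
  have t1 := (hM.tangent_fst n ⟨C, |ρ| / ν⟩ hS).2 (by rw [hr]; exact e1)
  have t2 := (hM.tangent_fst (n + 1) ⟨C, |ρ| / ν⟩ hS).2 (by rw [hr]; exact e2)
  refine ⟨⟨C, |ρ| / ν⟩, hS, t1, t2,
    (hM.tangent_snd n' ⟨C, |ρ| / ν⟩ hS).2 (by rw [hr]; exact e3),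
    (hM.tangent_snd (n' + 1) ⟨C, |ρ| / ν⟩ hS).2 (by rw [hr]; exact e4), ?_, ?_, ?_⟩
  · rw [hM.side_fst, hM.side_fst, xor_sign_iff hM.sign (jacobiDn_pos hk _) (jacobiDn_pos hk _)
      (abs_pos.2 h.ne) e1 e2]
    exact hor (Or.inl ⟨h.one, h.two⟩)
  · rw [hM.side_snd, hM.side_snd, xor_sign_iff hM.sign (jacobiDn_pos hk _) (jacobiDn_pos hk _)
      (abs_pos.2 h.ne) e3 e4]
    exact hor h.other
  · intro i hi j hj hij
    have hsame := (hM.eq_iff i j).1 hij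
    rw [hM.eq_iff]
    have h1 : ∀ m : ℤ, 2 * m + 1 - m = m + 1 := fun m => by ring
    have h2 : ∀ m : ℤ, 2 * m + 1 - (m + 1) = m := fun m => by ring
    rcases hi with rfl | rfl <;> rcases hj with rfl | rfl <;> simp only [h1, h2] <;>
      rw [hM.mem_iff _ _ _ hS hsame (by assumption)]
    · exact h.c11 hsame
    · exact h.c12 hsame
    · exact h.c21 hsame
    · exact h.c22 hsame

end CircleModel

/-! ### Nets of tangents of an ellipse -/

section Ellipse

variable {k p q ε φ χ τ σ : ℝ}

/-- The tangent of the ellipse `x²/p² + y²/q² = 1` at the point `(p sin φ, q cos φ)`; the sign `ε`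
only affects the orientation. -/
def ellipseLine (p q ε φ : ℝ) : AffineSubspace ℝ E2 :=
  lineThrough !₂[p * Real.sin φ, q * Real.cos φ] !₂[p * (ε * Real.cos φ), -(q * (ε * Real.sin φ))]

/-- The grid of the tangents of an ellipse with angles `φ n` and `χ n'`. -/
def ellipseGrid (p q ε : ℝ) (φ χ : ℤ → ℝ) : LineGrid E2 where
  fst n := ellipseLine p q ε (φ n)
  snd n := ellipseLine p q (-ε) (χ n)
  vertex n n' := !₂[p * (Real.sin ((φ n + χ n') / 2) / Real.cos ((φ n - χ n') / 2)),
    q * (Real.cos ((φ n + χ n') / 2) / Real.cos ((φ n - χ n') / 2))]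

/-- The hyperboloid collapses into the plane `z = 0`. -/
lemma rulingGrid_eq_map_embXY (p q ε : ℝ) (φ χ : ℤ → ℝ) :
    rulingGrid p q 0 ε φ χ = (ellipseGrid p q ε φ χ).map embXY := by
  have hl : ∀ ε φ, ruling p q 0 ε φ = (ellipseLine p q ε φ).map embXY := by
    intro ε φ
    rw [ellipseLine, map_lineThrough, ruling]
    rfl
  refine LineGrid.ext' (fun n => hl _ _) (fun n => hl _ _) fun n n' => ?_
  refine E3.ext rfl rfl ?_
  change -(0 * _) = (0 : ℝ)
  ring

lemma ellipseLine_dir_ne_zero (hp : p ≠ 0) (hq : q ≠ 0) (hε : ε = 1 ∨ ε = -1) (φ : ℝ) :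
    (!₂[p * (ε * Real.cos φ), -(q * (ε * Real.sin φ))] : E2) ≠ 0 := by
  intro h
  have hε0 : ε ≠ 0 := by rcases hε with rfl | rfl <;> norm_num
  have h0 : p * (ε * Real.cos φ) = 0 := congrArg (fun x : E2 => x 0) h
  have h1 : -(q * (ε * Real.sin φ)) = 0 := congrArg (fun x : E2 => x 1) h
  simp only [neg_eq_zero, mul_eq_zero, hp, hq, hε0, false_or] at h0 h1
  have := Real.sin_sq_add_cos_sq φ
  rw [h0, h1] at this
  norm_num at this

lemma mem_ellipseLine {P : E2} : P ∈ ellipseLine p q ε φ ↔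
    ∃ t : ℝ, P 0 = p * (Real.sin φ + t * (ε * Real.cos φ)) ∧
      P 1 = q * (Real.cos φ - t * (ε * Real.sin φ)) := by
  rw [ellipseLine, mem_lineThrough_E2]
  refine exists_congr fun t => ?_
  simp only [Matrix.cons_val]
  constructor <;> rintro ⟨h0, h1⟩ <;> constructor <;> linarith

lemma ellipseLine_congr (hε : ε = 1 ∨ ε = -1) (h1 : Real.sin φ = Real.sin χ)
    (h2 : Real.cos φ = Real.cos χ) : ellipseLine p q ε φ = ellipseLine p q (-ε) χ := by
  have hε0 : ε ≠ 0 := by rcases hε with rfl | rfl <;> norm_num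
  refine lineThrough_eq_of (t := 0) (x := -1) ?_ ?_ (by norm_num)
  · rw [h1, h2]; simp
  · rw [h1, h2]
    apply E2.ext <;> simp

lemma lineForm_ellipseLine (hp : p ≠ 0) (hq : q ≠ 0) (x : E2) :
    lineForm !₂[p * Real.sin φ, q * Real.cos φ] !₂[p * (ε * Real.cos φ), -(q * (ε * Real.sin φ))] x =
      -(ε * (p * q)) * (-1 + x 0 / p * Real.sin φ + x 1 / q * Real.cos φ) := by
  simp only [lineForm, Matrix.cons_val]
  field_simp
  linear_combination p * q * ε * Real.sin_sq_add_cos_sq φ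

lemma eq_of_ellipseLine_eq (hp : p ≠ 0) (hq : q ≠ 0) (hε : ε = 1 ∨ ε = -1) {ε' : ℝ}
    (h : ellipseLine p q ε φ = ellipseLine p q ε' χ) :
    Real.sin φ = Real.sin χ ∧ Real.cos φ = Real.cos χ := by
  have hε0 : ε ≠ 0 := by rcases hε with rfl | rfl <;> norm_num
  have h1 : !₂[p * Real.sin χ, q * Real.cos χ] ∈ ellipseLine p q ε φ := by
    rw [h]; exact self_mem_lineThrough _ _
  rw [ellipseLine, mem_lineThrough_iff_lineForm (ellipseLine_dir_ne_zero hp hq hε φ),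
    lineForm_ellipseLine hp hq] at h1
  have h2 := (mul_eq_zero.1 h1).resolve_left (neg_ne_zero.2 (mul_ne_zero hε0 (mul_ne_zero hp hq)))
  simp only [Matrix.cons_val, mul_div_cancel_left₀ _ hp,
    mul_div_cancel_left₀ _ hq] at h2
  have e : (Real.sin φ - Real.sin χ) ^ 2 + (Real.cos φ - Real.cos χ) ^ 2 = 0 := by
    linear_combination Real.sin_sq_add_cos_sq φ + Real.sin_sq_add_cos_sq χ - 2 * h2
  have e1 := sq_nonneg (Real.sin φ - Real.sin χ)
  have e2 := sq_nonneg (Real.cos φ - Real.cos χ)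
  constructor
  · exact sub_eq_zero.1 (pow_eq_zero_iff two_ne_zero |>.1 (by linarith))
  · exact sub_eq_zero.1 (pow_eq_zero_iff two_ne_zero |>.1 (by linarith))

lemma ellipseLine_eq_iff (hp : p ≠ 0) (hq : q ≠ 0) (hε : ε = 1 ∨ ε = -1) :
    ellipseLine p q ε φ = ellipseLine p q (-ε) χ ↔
      Real.sin φ = Real.sin χ ∧ Real.cos φ = Real.cos χ :=
  ⟨eq_of_ellipseLine_eq hp hq hε, fun h => ellipseLine_congr hε h.1 h.2⟩

lemma touchesConic_ellipseLine (hp : p ≠ 0) (hq : q ≠ 0) (ε φ : ℝ) :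
    TouchesConic (p ^ 2) (q ^ 2) (ellipseLine p q ε φ) := by
  intro P hP V hV
  obtain ⟨t, h0, h1⟩ := mem_ellipseLine.1 hP
  rw [ellipseLine, direction_lineThrough, Submodule.mem_span_singleton] at hV
  obtain ⟨x, rfl⟩ := hV
  simp only [h0, h1, PiLp.smul_apply, smul_eq_mul, Matrix.cons_val]
  have e := Real.sin_sq_add_cos_sq φ
  have e1 : p * (Real.sin φ + t * (ε * Real.cos φ)) * (x * (p * (ε * Real.cos φ))) / p ^ 2 +
      q * (Real.cos φ - t * (ε * Real.sin φ)) * (x * -(q * (ε * Real.sin φ))) / q ^ 2 =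
      t * ε ^ 2 * x := by
    field_simp
    linear_combination t * ε ^ 2 * x * e
  have e2 : (x * (p * (ε * Real.cos φ))) ^ 2 / p ^ 2 + (x * -(q * (ε * Real.sin φ))) ^ 2 / q ^ 2 =
      ε ^ 2 * x ^ 2 := by
    field_simp
    linear_combination ε ^ 2 * x ^ 2 * e
  have e3 : (p * (Real.sin φ + t * (ε * Real.cos φ))) ^ 2 / p ^ 2 +
      (q * (Real.cos φ - t * (ε * Real.sin φ))) ^ 2 / q ^ 2 - 1 = t ^ 2 * ε ^ 2 := by
    field_simp
    linear_combination (1 + t ^ 2 * ε ^ 2) * e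
  rw [e1, e2, e3]
  ring

/-- The vertex of coincident tangents of an ellipse is the point of contact. -/
lemma half_angle_div_of_eq (h : Real.cos ((φ - χ) / 2) ≠ 0) (h1 : Real.sin φ = Real.sin χ)
    (h2 : Real.cos φ = Real.cos χ) :
    Real.sin ((φ + χ) / 2) / Real.cos ((φ - χ) / 2) = Real.sin φ ∧
      Real.cos ((φ + χ) / 2) / Real.cos ((φ - χ) / 2) = Real.cos φ := by
  obtain ⟨e1, e2, e3, e4⟩ := sin_half_identities φ χ
  rw [← h1, ← h2] at e3 e4
  rw [div_eq_iff h, div_eq_iff h]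
  constructor <;> linarith

lemma exists_ellipse_vertex (hε : ε = 1 ∨ ε = -1) (h : Real.cos ((φ - χ) / 2) ≠ 0) :
    !₂[p * (Real.sin ((φ + χ) / 2) / Real.cos ((φ - χ) / 2)),
      q * (Real.cos ((φ + χ) / 2) / Real.cos ((φ - χ) / 2))] ∈ ellipseLine p q ε φ ∧
    !₂[p * (Real.sin ((φ + χ) / 2) / Real.cos ((φ - χ) / 2)),
      q * (Real.cos ((φ + χ) / 2) / Real.cos ((φ - χ) / 2))] ∈ ellipseLine p q (-ε) χ := by
  obtain ⟨h1, h2⟩ := rulingVertex_mem (p := p) (q := q) (r := 1) hε h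
  obtain ⟨t, t1, t2, -⟩ := mem_ruling.1 h1
  obtain ⟨t', t1', t2', -⟩ := mem_ruling.1 h2
  exact ⟨mem_ellipseLine.2 ⟨t, t1, t2⟩, mem_ellipseLine.2 ⟨t', t1', t2'⟩⟩

lemma isTangent_ellipseLine_iff (hk : k ∈ Ioo (0 : ℝ) 1) (hp : 0 < p) (hq : 0 < q)
    (hkp : q ^ 2 = p ^ 2 * (1 - k ^ 2)) (hε : ε = 1 ∨ ε = -1) {S : EuclideanGeometry.Sphere E2}
    (hS : 0 < S.radius) :
    S.IsTangent (ellipseLine p q ε (jacobiAm k τ)) ↔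
      circM k (-1) (S.center 0 / p) (S.center 1 / q) τ ^ 2 =
        (1 / q * S.radius) ^ 2 * jacobiDn τ k ^ 2 := by
  have hε2 : ε ^ 2 = 1 := by rcases hε with rfl | rfl <;> norm_num
  rw [ellipseLine, isTangent_lineThrough_iff (ellipseLine_dir_ne_zero hp.ne' hq.ne' hε _) hS,
    lineForm_ellipseLine hp.ne' hq.ne']
  change (-(ε * (p * q)) * circM k (-1) (S.center 0 / p) (S.center 1 / q) τ) ^ 2 =
    S.radius ^ 2 * ((p * (ε * jacobiCn τ k)) ^ 2 + (-(q * (ε * jacobiSn τ k))) ^ 2) ↔ _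
  generalize circM k (-1) (S.center 0 / p) (S.center 1 / q) τ = M
  have e : (p * (ε * jacobiCn τ k)) ^ 2 + (-(q * (ε * jacobiSn τ k))) ^ 2 =
      p ^ 2 * jacobiDn τ k ^ 2 := by
    rw [jacobiDn_sq hk]
    linear_combination (p ^ 2 * jacobiCn τ k ^ 2 + q ^ 2 * jacobiSn τ k ^ 2) * hε2 +
      p ^ 2 * jacobiCn_sq k τ + jacobiSn τ k ^ 2 * hkp
  rw [e]
  have e' : (-(ε * (p * q)) * M) ^ 2 = p ^ 2 * (q ^ 2 * M ^ 2) := by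
    linear_combination p ^ 2 * q ^ 2 * M ^ 2 * hε2
  rw [e', show S.radius ^ 2 * (p ^ 2 * jacobiDn τ k ^ 2) =
    p ^ 2 * (S.radius ^ 2 * jacobiDn τ k ^ 2) by ring, mul_right_inj' (by positivity),
    show (1 / q * S.radius) ^ 2 * jacobiDn τ k ^ 2 = S.radius ^ 2 * jacobiDn τ k ^ 2 / q ^ 2 by
      field_simp, eq_div_iff (by positivity), mul_comm]

lemma sOppSide_ellipseLine_iff (hk : k ∈ Ioo (0 : ℝ) 1) (hp : 0 < p) (hq : 0 < q)
    (hkp : q ^ 2 = p ^ 2 * (1 - k ^ 2)) (hε : ε = 1 ∨ ε = -1) {C : E2} :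
    (ellipseLine p q ε (jacobiAm k τ)).SOppSide !₂[Real.sqrt (p ^ 2 - q ^ 2), 0] C ↔
      0 < 1 * circM k (-1) (C 0 / p) (C 1 / q) τ := by
  have hε2 : ε ^ 2 = 1 := by rcases hε with rfl | rfl <;> norm_num
  rw [ellipseLine, sOppSide_lineThrough_iff (ellipseLine_dir_ne_zero hp.ne' hq.ne' hε _),
    lineForm_ellipseLine hp.ne' hq.ne', lineForm_ellipseLine hp.ne' hq.ne',
    show p ^ 2 - q ^ 2 = (k * p) ^ 2 by rw [hkp]; ring, Real.sqrt_sq (mul_pos hk.1 hp).le]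
  change -(ε * (p * q)) * (-1 + k * p / p * jacobiSn τ k + 0 / q * jacobiCn τ k) *
    (-(ε * (p * q)) * circM k (-1) (C 0 / p) (C 1 / q) τ) < 0 ↔ _
  generalize circM k (-1) (C 0 / p) (C 1 / q) τ = M
  have hf : 0 < 1 - k * jacobiSn τ k := by
    have := Real.sin_le_one (jacobiAm k τ)
    have h1 : k * jacobiSn τ k ≤ k * 1 := mul_le_mul_of_nonneg_left this hk.1.le
    linarith [hk.2]
  have hpos : 0 < p ^ 2 * q ^ 2 * (1 - k * jacobiSn τ k) := by positivity
  rw [mul_div_cancel_right₀ _ hp.ne', show -(ε * (p * q)) * (-1 + k * jacobiSn τ k + 0 / q *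
    jacobiCn τ k) * (-(ε * (p * q)) * M) = -(p ^ 2 * q ^ 2 * (1 - k * jacobiSn τ k) * M) by
    linear_combination p ^ 2 * q ^ 2 * M * (k * jacobiSn τ k - 1) * hε2, neg_lt_zero, one_mul]
  exact mul_pos_iff_of_pos_left hpos

/-- The grid of the tangents of an ellipse as a model for the circle conditions. -/
lemma circleModel_ellipseGrid (hk : k ∈ Ioo (0 : ℝ) 1) (hp : 0 < p) (hq : 0 < q)
    (hkp : q ^ 2 = p ^ 2 * (1 - k ^ 2)) (hε : ε = 1 ∨ ε = -1) {τ σ : ℤ → ℝ}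
    (hfin : ∀ n n', FinPar k (τ n) (σ n')) :
    CircleModel k (1 / q) 1
      (ellipseGrid p q ε (fun n => jacobiAm k (τ n)) fun n => jacobiAm k (σ n)) τ σ
      !₂[Real.sqrt (p ^ 2 - q ^ 2), 0] (fun _ => -1) (fun C => C 0 / p) fun C => C 1 / q := by
  have hε' : -ε = 1 ∨ -ε = -1 := by rcases hε with rfl | rfl <;> norm_num
  have hε2 : ε ^ 2 = 1 := by rcases hε with rfl | rfl <;> norm_num
  refine ⟨by positivity, Or.inl rfl, fun n S hS => isTangent_ellipseLine_iff hk hp hq hkp hε hS,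
    fun n S hS => isTangent_ellipseLine_iff hk hp hq hkp hε' hS,
    fun n C => sOppSide_ellipseLine_iff hk hp hq hkp hε,
    fun n C => sOppSide_ellipseLine_iff hk hp hq hkp hε',
    fun n n' => ellipseLine_eq_iff hp.ne' hq.ne' hε, fun n n' S hS hsame ht => ?_⟩
  have hv := half_angle_div_of_eq (hfin n n') hsame.1 hsame.2
  have hm := (exists_ellipse_vertex (p := p) (q := q) hε (hfin n n')).1
  have hV := ellipseLine_dir_ne_zero hp.ne' hq.ne' hε (jacobiAm k (τ n))
  have ht' := (isTangent_lineThrough_iff hV hS).1 ht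
  have := mem_sphere_iff_of_tangent hV hS hm ht'
  change !₂[_, _] ∈ S ↔ _
  rw [this, hv.1, hv.2]
  change (S.center 0 - p * jacobiSn (τ n) k) * (p * (ε * jacobiCn (τ n) k)) +
    (S.center 1 - q * jacobiCn (τ n) k) * -(q * (ε * jacobiSn (τ n) k)) = 0 ↔ _
  have hε0 : ε ≠ 0 := by rcases hε with rfl | rfl <;> norm_num
  obtain ⟨x, hx⟩ : ∃ x, S.center 0 = p * x := ⟨S.center 0 / p, by field_simp⟩
  obtain ⟨y, hy⟩ : ∃ y, S.center 1 = q * y := ⟨S.center 1 / q, by field_simp⟩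
  have key : (p * x - p * jacobiSn (τ n) k) * (p * (ε * jacobiCn (τ n) k)) +
      (q * y - q * jacobiCn (τ n) k) * -(q * (ε * jacobiSn (τ n) k)) =
      ε * p ^ 2 * (x * jacobiCn (τ n) k - (1 - k ^ 2) * y * jacobiSn (τ n) k +
        k ^ 2 * -1 * (jacobiSn (τ n) k * jacobiCn (τ n) k)) := by
    linear_combination ε * jacobiSn (τ n) k * (jacobiCn (τ n) k - y) * hkp
  rw [ContactAt, hx, hy, mul_div_cancel_left₀ _ hp.ne', mul_div_cancel_left₀ _ hq.ne', key]
  exact mul_eq_zero_iff_left (mul_ne_zero hε0 (pow_ne_zero 2 hp.ne'))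

/-- The AC-grids with given parameters collapse to IC-nets bounded by an ellipse. -/
theorem MeshPair.isICNetOn_ellipseGrid (hk : k ∈ Ioo (0 : ℝ) 1) (hp : 0 < p) (hq : 0 < q)
    (hkp : q ^ 2 = p ^ 2 * (1 - k ^ 2)) (hε : ε = 1 ∨ ε = -1) {τ σ : ℤ → ℝ}
    (h : MeshPair k τ σ) :
    IsICNetOn (p ^ 2) (q ^ 2)
      (ellipseGrid p q ε (fun n => jacobiAm k (τ n)) fun n => jacobiAm k (σ n)) := by
  have hε' : -ε = 1 ∨ -ε = -1 := by rcases hε with rfl | rfl <;> norm_num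
  refine ⟨⟨fun n => finrank_lineThrough (ellipseLine_dir_ne_zero hp.ne' hq.ne' hε _),
    fun n => finrank_lineThrough (ellipseLine_dir_ne_zero hp.ne' hq.ne' hε' _),
    fun n n' => (exists_ellipse_vertex hε (h.fin n n')).1,
    fun n n' => (exists_ellipse_vertex hε (h.fin n n')).2,
    fun n hn => h.fst_ne_one n (eq_of_ellipseLine_eq hp.ne' hq.ne' hε hn),
    fun n hn => h.fst_ne_two n (eq_of_ellipseLine_eq hp.ne' hq.ne' hε hn),
    fun n hn => h.snd_ne_one n (eq_of_ellipseLine_eq hp.ne' hq.ne' hε' hn),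
    fun n hn => h.snd_ne_two n (eq_of_ellipseLine_eq hp.ne' hq.ne' hε' hn)⟩,
    fun n => touchesConic_ellipseLine hp.ne' hq.ne' _ _,
    fun n => touchesConic_ellipseLine hp.ne' hq.ne' _ _, fun n n' hn => ?_, fun n n' => ?_⟩
  · obtain ⟨h1, h2⟩ := eq_of_ellipseLine_eq hp.ne' hq.ne' hε hn
    obtain ⟨e1, e2⟩ := half_angle_div_of_eq (h.fin n n') h1 h2
    change (p * _) ^ 2 / p ^ 2 + (q * _) ^ 2 / q ^ 2 = 1
    rw [e1, e2]
    field_simp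
    exact Real.sin_sq_add_cos_sq _
  · obtain ⟨B, G, ρ, hD⟩ := exists_circData_ellipse hk (h.rel n n') (h.fst_step_ne hk n)
      (h.fin n n') (h.fin (n + 1) n')
    refine (circleModel_ellipseGrid hk hp hq hkp hε h.fin).circumscribes hk
      (C := !₂[p * B, q * G]) (ρ := ρ) ?_
    have e1 : (!₂[p * B, q * G] : E2) 0 / p = B := mul_div_cancel_left₀ _ hp.ne'
    have e2 : (!₂[p * B, q * G] : E2) 1 / q = G := mul_div_cancel_left₀ _ hq.ne'
    rw [e1, e2]
    exact hD

end Ellipse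

/-! ### Nets of tangents of a hyperbola -/

section Hyperbola

variable {k p r ε φ χ τ σ : ℝ}

/-- The tangent of the hyperbola `x²/p² - z²/r² = 1` which meets the axis `z = 0` in the point
`(p sin φ, 0)`; the sign `ε` distinguishes the two tangents through this point. -/
def hyperbolaLine (p r ε φ : ℝ) : AffineSubspace ℝ E2 :=
  lineThrough !₂[p * Real.sin φ, 0] !₂[p * (ε * Real.cos φ), r]

/-- The grid of the tangents of a hyperbola with angles `φ n` and `χ n'`, where the sequences use
opposite signs. -/
def hyperbolaGrid (p r ε : ℝ) (φ χ : ℤ → ℝ) : LineGrid E2 where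
  fst n := hyperbolaLine p r ε (φ n)
  snd n := hyperbolaLine p r (-ε) (χ n)
  vertex n n' := !₂[p * (Real.sin ((φ n + χ n') / 2) / Real.cos ((φ n - χ n') / 2)),
    -(r * (ε * (Real.sin ((φ n - χ n') / 2) / Real.cos ((φ n - χ n') / 2))))]

/-- The hyperboloid collapses into the plane `y = 0`. -/
lemma rulingGrid_eq_map_embXZ (p r ε : ℝ) (φ χ : ℤ → ℝ) :
    rulingGrid p 0 r ε φ χ = (hyperbolaGrid p r ε φ χ).map embXZ := by
  have hl : ∀ ε φ, ruling p 0 r ε φ = (hyperbolaLine p r ε φ).map embXZ := by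
    intro ε φ
    rw [hyperbolaLine, map_lineThrough, ruling]
    congr 1
    · refine E3.ext rfl ?_ rfl
      change 0 * _ = (0 : ℝ)
      ring
    · refine E3.ext rfl ?_ rfl
      change -(0 * _) = (0 : ℝ)
      ring
  refine LineGrid.ext' (fun n => hl _ _) (fun n => hl _ _) fun n n' => ?_
  refine E3.ext rfl ?_ rfl
  change 0 * _ = (0 : ℝ)
  ring

lemma hyperbolaLine_dir_ne_zero (hr : r ≠ 0) (x : ℝ) : (!₂[x, r] : E2) ≠ 0 :=
  fun h => hr (congrArg (fun x : E2 => x 1) h)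

lemma mem_hyperbolaLine {P : E2} : P ∈ hyperbolaLine p r ε φ ↔
    ∃ t : ℝ, P 0 = p * (Real.sin φ + t * (ε * Real.cos φ)) ∧ P 1 = r * t := by
  rw [hyperbolaLine, mem_lineThrough_E2]
  refine exists_congr fun t => ?_
  simp only [Matrix.cons_val]
  constructor <;> rintro ⟨h0, h1⟩ <;> constructor <;> linarith

lemma hyperbolaLine_congr {ε' : ℝ} (h1 : Real.sin φ = Real.sin χ)
    (h2 : ε * Real.cos φ = ε' * Real.cos χ) :
    hyperbolaLine p r ε φ = hyperbolaLine p r ε' χ := by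
  rw [hyperbolaLine, hyperbolaLine, h1, h2]

lemma eq_of_hyperbolaLine_eq (hp : p ≠ 0) (hr : r ≠ 0) {ε' : ℝ}
    (h : hyperbolaLine p r ε φ = hyperbolaLine p r ε' χ) :
    Real.sin φ = Real.sin χ ∧ ε * Real.cos φ = ε' * Real.cos χ := by
  have h1 : !₂[p * Real.sin χ, 0] ∈ hyperbolaLine p r ε φ := by
    rw [h]; exact self_mem_lineThrough _ _
  have h2 : !₂[p * Real.sin χ + p * (ε' * Real.cos χ), r] ∈ hyperbolaLine p r ε φ := by
    rw [h]
    refine mem_hyperbolaLine.2 ⟨1, ?_, ?_⟩ <;> simp only [Matrix.cons_val] <;> ring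
  obtain ⟨t, h3, h4⟩ := mem_hyperbolaLine.1 h1
  obtain ⟨t', h5, h6⟩ := mem_hyperbolaLine.1 h2
  simp only [Matrix.cons_val] at h3 h4 h5 h6
  have ht : t = 0 := (mul_eq_zero.1 h4.symm).resolve_left hr
  have ht' : t' = 1 := mul_left_cancel₀ hr (by linarith)
  rw [ht] at h3
  rw [ht'] at h5
  have e1 : Real.sin φ = Real.sin χ := mul_left_cancel₀ hp (by linarith)
  rw [e1] at h5
  exact ⟨e1, mul_left_cancel₀ hp (by linarith)⟩

lemma lineForm_hyperbolaLine (hp : p ≠ 0) (hr : r ≠ 0) (x : E2) :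
    lineForm !₂[p * Real.sin φ, 0] !₂[p * (ε * Real.cos φ), r] x =
      p * r * (x 0 / p + -1 * Real.sin φ + -(ε * (x 1 / r)) * Real.cos φ) := by
  simp only [lineForm, Matrix.cons_val]
  field_simp
  ring

lemma touchesConic_hyperbolaLine (hp : p ≠ 0) (hr : r ≠ 0) (hε : ε = 1 ∨ ε = -1) (φ : ℝ) :
    TouchesConic (p ^ 2) (-r ^ 2) (hyperbolaLine p r ε φ) := by
  have hε2 : ε ^ 2 = 1 := by rcases hε with rfl | rfl <;> norm_num
  intro P hP V hV
  obtain ⟨t, h0, h1⟩ := mem_hyperbolaLine.1 hP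
  rw [hyperbolaLine, direction_lineThrough, Submodule.mem_span_singleton] at hV
  obtain ⟨x, rfl⟩ := hV
  simp only [h0, h1, PiLp.smul_apply, smul_eq_mul, Matrix.cons_val]
  have e := Real.cos_sq' φ
  have e1 : p * (Real.sin φ + t * (ε * Real.cos φ)) * (x * (p * (ε * Real.cos φ))) / p ^ 2 +
      r * t * (x * r) / -r ^ 2 = x * Real.sin φ * (ε * Real.cos φ - t * Real.sin φ) := by
    field_simp
    linear_combination x * t * Real.cos φ ^ 2 * hε2 + x * t * e
  have e2 : (x * (p * (ε * Real.cos φ))) ^ 2 / p ^ 2 + (x * r) ^ 2 / -r ^ 2 =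
      -(x ^ 2 * Real.sin φ ^ 2) := by
    field_simp
    linear_combination x ^ 2 * Real.cos φ ^ 2 * hε2 + x ^ 2 * e
  have e3 : (p * (Real.sin φ + t * (ε * Real.cos φ))) ^ 2 / p ^ 2 +
      (r * t) ^ 2 / -r ^ 2 - 1 = -(ε * Real.cos φ - t * Real.sin φ) ^ 2 := by
    field_simp
    linear_combination (Real.cos φ ^ 2 + t ^ 2 * Real.cos φ ^ 2) * hε2 + (1 + t ^ 2) * e
  rw [e1, e2, e3]
  ring

/-- The vertex of coincident tangents of a hyperbola is the point of contact. -/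
lemma half_angle_div_of_eq_neg (h : Real.cos ((φ - χ) / 2) ≠ 0) (h1 : Real.sin φ = Real.sin χ)
    (h2 : Real.cos φ = -Real.cos χ) :
    Real.sin φ ≠ 0 ∧ Real.sin ((φ + χ) / 2) / Real.cos ((φ - χ) / 2) = 1 / Real.sin φ ∧
      Real.sin ((φ - χ) / 2) / Real.cos ((φ - χ) / 2) = -(Real.cos φ / Real.sin φ) := by
  obtain ⟨e1, e2, e3, e4⟩ := sin_half_identities φ χ
  have h2' : Real.cos χ = -Real.cos φ := by linarith
  rw [← h1, h2'] at e3 e4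
  have e := Real.sin_sq_add_cos_sq φ
  have e5 : Real.cos φ * Real.cos ((φ - χ) / 2) + Real.sin φ * Real.sin ((φ - χ) / 2) = 0 := by
    linarith
  have hs : Real.sin φ ≠ 0 := by
    intro h0
    rw [h0] at e e5
    have hc : Real.cos φ = 0 := by
      rcases mul_eq_zero.1 (show Real.cos φ * Real.cos ((φ - χ) / 2) = 0 by linarith) with h' | h'
      · exact h'
      · exact absurd h' h
    rw [hc] at e
    norm_num at e
  refine ⟨hs, ?_, ?_⟩
  · rw [div_eq_div_iff h hs]
    linear_combination Real.sin φ * e1 + Real.cos ((φ - χ) / 2) * e - Real.cos φ * e5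
  · rw [div_eq_iff h]
    field_simp
    linarith

lemma exists_hyperbola_vertex (hε : ε = 1 ∨ ε = -1) (h : Real.cos ((φ - χ) / 2) ≠ 0) :
    !₂[p * (Real.sin ((φ + χ) / 2) / Real.cos ((φ - χ) / 2)),
      -(r * (ε * (Real.sin ((φ - χ) / 2) / Real.cos ((φ - χ) / 2))))] ∈ hyperbolaLine p r ε φ ∧
    !₂[p * (Real.sin ((φ + χ) / 2) / Real.cos ((φ - χ) / 2)),
      -(r * (ε * (Real.sin ((φ - χ) / 2) / Real.cos ((φ - χ) / 2))))] ∈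
        hyperbolaLine p r (-ε) χ := by
  obtain ⟨h1, h2⟩ := rulingVertex_mem (p := p) (q := 1) (r := r) hε h
  obtain ⟨t, t1, -, t2⟩ := mem_ruling.1 h1
  obtain ⟨t', t1', -, t2'⟩ := mem_ruling.1 h2
  exact ⟨mem_hyperbolaLine.2 ⟨t, t1, t2⟩, mem_hyperbolaLine.2 ⟨t', t1', t2'⟩⟩

lemma jacobiSn_two_K_sub (hk : k ∈ Ioo (0 : ℝ) 1) (s : ℝ) :
    jacobiSn (2 * ellipticK k - s) k = jacobiSn s k := by
  rw [jacobiSn, jacobiAm_two_K_sub hk, Real.sin_pi_sub, jacobiSn]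

lemma jacobiCn_two_K_sub (hk : k ∈ Ioo (0 : ℝ) 1) (s : ℝ) :
    jacobiCn (2 * ellipticK k - s) k = -jacobiCn s k := by
  rw [jacobiCn, jacobiAm_two_K_sub hk, Real.cos_pi_sub, jacobiCn]

lemma jacobiDn_two_K_sub (hk : k ∈ Ioo (0 : ℝ) 1) (s : ℝ) :
    jacobiDn (2 * ellipticK k - s) k = jacobiDn s k := by
  rw [jacobiDn, jacobiSn_two_K_sub hk, jacobiDn]

lemma circM_two_K_sub (hk : k ∈ Ioo (0 : ℝ) 1) (A B G s : ℝ) :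
    circM k A B G (2 * ellipticK k - s) = circM k A B (-G) s := by
  rw [circM, circM, jacobiSn_two_K_sub hk, jacobiCn_two_K_sub hk]
  ring

lemma isTangent_hyperbolaLine_iff (hk : k ∈ Ioo (0 : ℝ) 1) (hp : 0 < p) (hr : 0 < r)
    (hkp : r ^ 2 * k ^ 2 = p ^ 2 * (1 - k ^ 2)) (hε : ε = 1 ∨ ε = -1)
    {S : EuclideanGeometry.Sphere E2} (hS : 0 < S.radius) :
    S.IsTangent (hyperbolaLine p r ε (jacobiAm k τ)) ↔
      circM k (S.center 0 / p) (-1) (-(ε * (S.center 1 / r))) τ ^ 2 =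
        (1 / (k * r) * S.radius) ^ 2 * jacobiDn τ k ^ 2 := by
  have hk0 := hk.1
  have hε2 : ε ^ 2 = 1 := by rcases hε with rfl | rfl <;> norm_num
  rw [hyperbolaLine, isTangent_lineThrough_iff (hyperbolaLine_dir_ne_zero hr.ne' _) hS,
    lineForm_hyperbolaLine hp.ne' hr.ne']
  change (p * r * circM k (S.center 0 / p) (-1) (-(ε * (S.center 1 / r))) τ) ^ 2 =
    S.radius ^ 2 * ((p * (ε * jacobiCn τ k)) ^ 2 + r ^ 2) ↔ _
  generalize circM k (S.center 0 / p) (-1) (-(ε * (S.center 1 / r))) τ = M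
  have e : k ^ 2 * ((p * (ε * jacobiCn τ k)) ^ 2 + r ^ 2) = p ^ 2 * jacobiDn τ k ^ 2 := by
    rw [jacobiDn_sq hk]
    linear_combination k ^ 2 * (p ^ 2 * jacobiCn τ k ^ 2) * hε2 +
      k ^ 2 * p ^ 2 * jacobiCn_sq k τ + hkp
  rw [← mul_right_inj' (show k ^ 2 ≠ 0 by positivity),
    show k ^ 2 * (S.radius ^ 2 * ((p * (ε * jacobiCn τ k)) ^ 2 + r ^ 2)) =
      p ^ 2 * (S.radius ^ 2 * jacobiDn τ k ^ 2) by linear_combination S.radius ^ 2 * e,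
    show k ^ 2 * (p * r * M) ^ 2 = p ^ 2 * (M ^ 2 * (k * r) ^ 2) by ring,
    mul_right_inj' (by positivity),
    show (1 / (k * r) * S.radius) ^ 2 * jacobiDn τ k ^ 2 =
      S.radius ^ 2 * jacobiDn τ k ^ 2 / (k * r) ^ 2 by field_simp, eq_div_iff (by positivity)]

lemma sOppSide_hyperbolaLine_iff (hk : k ∈ Ioo (0 : ℝ) 1) (hp : 0 < p) (hr : 0 < r)
    (hkp : r ^ 2 * k ^ 2 = p ^ 2 * (1 - k ^ 2)) {C : E2} :
    (hyperbolaLine p r ε (jacobiAm k τ)).SOppSide !₂[Real.sqrt (p ^ 2 - -r ^ 2), 0] C ↔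
      0 < -1 * circM k (C 0 / p) (-1) (-(ε * (C 1 / r))) τ := by
  have hk0 := hk.1
  rw [hyperbolaLine, sOppSide_lineThrough_iff (hyperbolaLine_dir_ne_zero hr.ne' _),
    lineForm_hyperbolaLine hp.ne' hr.ne', lineForm_hyperbolaLine hp.ne' hr.ne',
    show p ^ 2 - -r ^ 2 = (p / k) ^ 2 by field_simp; linarith, Real.sqrt_sq (by positivity)]
  change p * r * (p / k / p + -1 * jacobiSn τ k + -(ε * (0 / r)) * jacobiCn τ k) *
    (p * r * circM k (C 0 / p) (-1) (-(ε * (C 1 / r))) τ) < 0 ↔ _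
  generalize circM k (C 0 / p) (-1) (-(ε * (C 1 / r))) τ = M
  have hf : 0 < 1 - k * jacobiSn τ k := by
    have := Real.sin_le_one (jacobiAm k τ)
    have h1 : k * jacobiSn τ k ≤ k * 1 := mul_le_mul_of_nonneg_left this hk.1.le
    linarith [hk.2]
  have hpos : 0 < p ^ 2 * r ^ 2 * (1 - k * jacobiSn τ k) / k := by positivity
  rw [show p * r * (p / k / p + -1 * jacobiSn τ k + -(ε * (0 / r)) * jacobiCn τ k) * (p * r * M) =
    -(p ^ 2 * r ^ 2 * (1 - k * jacobiSn τ k) / k * (-1 * M)) by field_simp; ring, neg_lt_zero]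
  exact mul_pos_iff_of_pos_left hpos

/-- The grid of the tangents of a hyperbola as a model for the circle conditions. The second
sequence is reparametrised by `σ ↦ 2K - σ`, as it uses the opposite sign `-ε`. -/
lemma circleModel_hyperbolaGrid (hk : k ∈ Ioo (0 : ℝ) 1) (hp : 0 < p) (hr : 0 < r)
    (hkp : r ^ 2 * k ^ 2 = p ^ 2 * (1 - k ^ 2)) (hε : ε = 1 ∨ ε = -1) {τ σ : ℤ → ℝ}
    (hfin : ∀ n n', FinPar k (τ n) (σ n')) :
    CircleModel k (1 / (k * r)) (-1)
      (hyperbolaGrid p r ε (fun n => jacobiAm k (τ n)) fun n => jacobiAm k (σ n)) τ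
      (fun n => 2 * ellipticK k - σ n) !₂[Real.sqrt (p ^ 2 - -r ^ 2), 0] (fun C => C 0 / p)
      (fun _ => -1) fun C => -(ε * (C 1 / r)) := by
  have hk0 := hk.1
  have hε' : -ε = 1 ∨ -ε = -1 := by rcases hε with rfl | rfl <;> norm_num
  have hε2 : ε ^ 2 = 1 := by rcases hε with rfl | rfl <;> norm_num
  have hε0 : ε ≠ 0 := by rcases hε with rfl | rfl <;> norm_num
  refine ⟨by positivity, Or.inr rfl, fun n S hS => isTangent_hyperbolaLine_iff hk hp hr hkp hε hS,
    fun n S hS => ?_, fun n C => sOppSide_hyperbolaLine_iff hk hp hr hkp, fun n C => ?_,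
    fun n n' => ?_, fun n n' S hS hsame ht => ?_⟩
  · simp only [circM_two_K_sub hk, jacobiDn_two_K_sub hk]
    refine (isTangent_hyperbolaLine_iff hk hp hr hkp hε' hS).trans ?_
    rw [neg_mul]
  · simp only [circM_two_K_sub hk]
    refine (sOppSide_hyperbolaLine_iff hk hp hr hkp).trans ?_
    rw [neg_mul ε]
  · rw [SamePar, jacobiSn_two_K_sub hk, jacobiCn_two_K_sub hk]
    have hcos : ∀ x y : ℝ, ε * x = -ε * y ↔ x = -y := fun x y => by
      rw [neg_mul, ← mul_neg, mul_right_inj' hε0]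
    exact ⟨fun h => (eq_of_hyperbolaLine_eq hp.ne' hr.ne' h).imp id (hcos _ _).1,
      fun h => hyperbolaLine_congr h.1 ((hcos _ _).2 h.2)⟩
  · rw [SamePar, jacobiSn_two_K_sub hk, jacobiCn_two_K_sub hk] at hsame
    obtain ⟨hs, hv1, hv2⟩ := half_angle_div_of_eq_neg (hfin n n') hsame.1 hsame.2
    have hm := (exists_hyperbola_vertex (p := p) (r := r) hε (hfin n n')).1
    have hV := hyperbolaLine_dir_ne_zero hr.ne' (p * (ε * Real.cos (jacobiAm k (τ n))))
    have ht' := (isTangent_lineThrough_iff hV hS).1 ht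
    have := mem_sphere_iff_of_tangent hV hS hm ht'
    change !₂[_, _] ∈ S ↔ _
    rw [this, hv1, hv2]
    change (S.center 0 - p * (1 / jacobiSn (τ n) k)) * (p * (ε * jacobiCn (τ n) k)) +
      (S.center 1 - -(r * (ε * -(jacobiCn (τ n) k / jacobiSn (τ n) k)))) * r = 0 ↔ _
    change jacobiSn (τ n) k ≠ 0 at hs
    obtain ⟨x, hx⟩ : ∃ x, S.center 0 = p * x := ⟨S.center 0 / p, by field_simp⟩
    obtain ⟨y, hy⟩ : ∃ y, S.center 1 = r * y := ⟨S.center 1 / r, by field_simp⟩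
    have key : k ^ 2 * jacobiSn (τ n) k * ε *
        ((p * x - p * (1 / jacobiSn (τ n) k)) * (p * (ε * jacobiCn (τ n) k)) +
        (r * y - -(r * (ε * -(jacobiCn (τ n) k / jacobiSn (τ n) k)))) * r) =
        p ^ 2 * (-1 * jacobiCn (τ n) k - (1 - k ^ 2) * -(ε * y) * jacobiSn (τ n) k +
          k ^ 2 * x * (jacobiSn (τ n) k * jacobiCn (τ n) k)) := by
      field_simp
      linear_combination (ε * y * jacobiSn (τ n) k - ε ^ 2 * jacobiCn (τ n) k) * hkp +
        p ^ 2 * jacobiCn (τ n) k * (k ^ 2 * x * jacobiSn (τ n) k - 1) * hε2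
    rw [ContactAt, hx, hy, mul_div_cancel_left₀ _ hp.ne', mul_div_cancel_left₀ _ hr.ne',
      ← mul_eq_zero_iff_left (mul_ne_zero (mul_ne_zero (pow_ne_zero 2 hk0.ne') hs) hε0), key]
    exact mul_eq_zero_iff_left (pow_ne_zero 2 hp.ne')

/-- The AC-grids with given parameters collapse to IC-nets bounded by a hyperbola. -/
theorem MeshPair.isICNetOn_hyperbolaGrid (hk : k ∈ Ioo (0 : ℝ) 1) (hp : 0 < p) (hr : 0 < r)
    (hkp : r ^ 2 * k ^ 2 = p ^ 2 * (1 - k ^ 2)) (hε : ε = 1 ∨ ε = -1) {τ σ : ℤ → ℝ}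
    (h : MeshPair k τ σ) :
    IsICNetOn (p ^ 2) (-r ^ 2)
      (hyperbolaGrid p r ε (fun n => jacobiAm k (τ n)) fun n => jacobiAm k (σ n)) := by
  have hε' : -ε = 1 ∨ -ε = -1 := by rcases hε with rfl | rfl <;> norm_num
  have hε0 : ε ≠ 0 := by rcases hε with rfl | rfl <;> norm_num
  have hε2 : ε ^ 2 = 1 := by rcases hε with rfl | rfl <;> norm_num
  have hfst : ∀ m n, hyperbolaLine p r ε (jacobiAm k (τ m)) = hyperbolaLine p r ε (jacobiAm k (τ n))
      → SamePar k (τ m) (τ n) := fun m n hn =>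
    (eq_of_hyperbolaLine_eq hp.ne' hr.ne' hn).imp id fun h => mul_left_cancel₀ hε0 h
  have hsnd : ∀ m n, hyperbolaLine p r (-ε) (jacobiAm k (σ m)) =
      hyperbolaLine p r (-ε) (jacobiAm k (σ n)) → SamePar k (σ m) (σ n) := fun m n hn =>
    (eq_of_hyperbolaLine_eq hp.ne' hr.ne' hn).imp id fun h =>
      mul_left_cancel₀ (neg_ne_zero.2 hε0) h
  refine ⟨⟨fun n => finrank_lineThrough (hyperbolaLine_dir_ne_zero hr.ne' _),
    fun n => finrank_lineThrough (hyperbolaLine_dir_ne_zero hr.ne' _),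
    fun n n' => (exists_hyperbola_vertex hε (h.fin n n')).1,
    fun n n' => (exists_hyperbola_vertex hε (h.fin n n')).2,
    fun n hn => h.fst_ne_one n (hfst _ _ hn), fun n hn => h.fst_ne_two n (hfst _ _ hn),
    fun n hn => h.snd_ne_one n (hsnd _ _ hn), fun n hn => h.snd_ne_two n (hsnd _ _ hn)⟩,
    fun n => touchesConic_hyperbolaLine hp.ne' hr.ne' hε _,
    fun n => touchesConic_hyperbolaLine hp.ne' hr.ne' hε' _, fun n n' hn => ?_, fun n n' => ?_⟩
  · obtain ⟨h1, h2⟩ := eq_of_hyperbolaLine_eq hp.ne' hr.ne' hn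
    rw [neg_mul, ← mul_neg] at h2
    obtain ⟨e0, e1, e2⟩ := half_angle_div_of_eq_neg (h.fin n n') h1 (mul_left_cancel₀ hε0 h2)
    change (p * _) ^ 2 / p ^ 2 + (-(r * (ε * _))) ^ 2 / -r ^ 2 = 1
    rw [e1, e2]
    field_simp
    linear_combination -Real.sin_sq_add_cos_sq (jacobiAm k (τ n)) -
      Real.cos (jacobiAm k (τ n)) ^ 2 * hε2
  · obtain ⟨A, G, ρ, hD⟩ := exists_circData_hyperbola hk (h.rel n n') (h.fst_step_ne hk n)
      (h.fin n n') (h.fin (n + 1) n')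
    refine (circleModel_hyperbolaGrid hk hp hr hkp hε h.fin).circumscribes hk
      (C := !₂[p * A, r * (-(ε * G))]) (ρ := ρ) ?_
    have e1 : (!₂[p * A, r * (-(ε * G))] : E2) 0 / p = A := mul_div_cancel_left₀ _ hp.ne'
    have e2 : -(ε * ((!₂[p * A, r * (-(ε * G))] : E2) 1 / r)) = G := by
      change -(ε * (r * (-(ε * G)) / r)) = G
      rw [mul_div_cancel_left₀ _ hr.ne']
      linear_combination G * hε2
    rw [e1, e2]
    exact hD

end Hyperbola

/-! ### Elliptic parameters of IC-nets -/

section ICNet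

variable {k p q r ε φ χ : ℝ}

lemma mem_lineThrough_of_dir {E : Type} [NormedAddCommGroup E] [InnerProductSpace ℝ E] (P V : E) :
    V ∈ (lineThrough P V).direction := by
  rw [direction_lineThrough]
  exact Submodule.mem_span_singleton_self V

/-- In coordinates with respect to the semi-axes, a tangent of the ellipse has distance `1` from
the centre. -/
lemma exists_eq_ellipseLine (hp : p ≠ 0) (hq : q ≠ 0) (hε : ε = 1 ∨ ε = -1)
    {L : AffineSubspace ℝ E2} (hL : Module.finrank ℝ L.direction = 1) {P : E2} (hP : P ∈ L)
    (h : TouchesConic (p ^ 2) (q ^ 2) L) : ∃ φ, L = ellipseLine p q ε φ := by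
  have hε0 : ε ≠ 0 := by rcases hε with rfl | rfl <;> norm_num
  obtain ⟨V, hV, rfl⟩ := exists_eq_lineThrough hL hP
  have e := h P hP V (mem_lineThrough_of_dir P V)
  obtain ⟨x, hx⟩ : ∃ x, P 0 = p * x := ⟨P 0 / p, by field_simp⟩
  obtain ⟨y, hy⟩ : ∃ y, P 1 = q * y := ⟨P 1 / q, by field_simp⟩
  obtain ⟨u, hu⟩ : ∃ u, V 0 = p * u := ⟨V 0 / p, by field_simp⟩
  obtain ⟨v, hv⟩ : ∃ v, V 1 = q * v := ⟨V 1 / q, by field_simp⟩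
  rw [hx, hy, hu, hv] at e
  have e' : (x * v - y * u) ^ 2 = u ^ 2 + v ^ 2 := by
    field_simp at e
    linear_combination -e
  set D := x * v - y * u with hD
  have hD0 : D ≠ 0 := by
    intro h0
    rw [h0] at e'
    have h1 := sq_nonneg u
    have h2 := sq_nonneg v
    refine hV (E2.ext ?_ ?_)
    · rw [hu, pow_eq_zero_iff two_ne_zero |>.1 (show u ^ 2 = 0 by linarith)]; simp
    · rw [hv, pow_eq_zero_iff two_ne_zero |>.1 (show v ^ 2 = 0 by linarith)]; simp
  obtain ⟨φ, h1, h2⟩ := exists_angle (x := v / D) (y := -u / D) (by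
    field_simp
    linarith)
  refine ⟨φ, lineThrough_eq_of (t := (-x * u - y * v) / D ^ 2) (x := -ε / D) ?_ ?_
    (div_ne_zero (neg_ne_zero.2 hε0) hD0)⟩
  · apply E2.ext
    · simp only [PiLp.add_apply, PiLp.smul_apply, smul_eq_mul, Matrix.cons_val, hx, hu, h1]
      field_simp
      linear_combination v * hD - x * e'
    · simp only [PiLp.add_apply, PiLp.smul_apply, smul_eq_mul, Matrix.cons_val, hy, hv, h2]
      field_simp
      linear_combination -u * hD - y * e'
  · apply E2.ext
    · simp only [PiLp.smul_apply, smul_eq_mul, Matrix.cons_val, hu, h2]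
      ring
    · simp only [PiLp.smul_apply, smul_eq_mul, Matrix.cons_val, hv, h1]
      ring

/-- The discriminant condition excludes lines of the form `z = const`. -/
lemma exists_eq_hyperbolaLine (hp : p ≠ 0) (hr : r ≠ 0) (hε : ε = 1 ∨ ε = -1)
    {L : AffineSubspace ℝ E2} (hL : Module.finrank ℝ L.direction = 1) {P : E2} (hP : P ∈ L)
    (h : TouchesConic (p ^ 2) (-r ^ 2) L) : ∃ φ, L = hyperbolaLine p r ε φ := by
  have hε2 : ε ^ 2 = 1 := by rcases hε with rfl | rfl <;> norm_num
  obtain ⟨V, hV, rfl⟩ := exists_eq_lineThrough hL hP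
  have e := h P hP V (mem_lineThrough_of_dir P V)
  obtain ⟨x, hx⟩ : ∃ x, P 0 = p * x := ⟨P 0 / p, by field_simp⟩
  obtain ⟨z, hz⟩ : ∃ z, P 1 = r * z := ⟨P 1 / r, by field_simp⟩
  obtain ⟨u, hu⟩ : ∃ u, V 0 = p * u := ⟨V 0 / p, by field_simp⟩
  obtain ⟨w, hw⟩ : ∃ w, V 1 = r * w := ⟨V 1 / r, by field_simp⟩
  rw [hx, hz, hu, hw] at e
  have e' : (x * w - z * u) ^ 2 + u ^ 2 = w ^ 2 := by
    have e1 : p * x * (p * u) / p ^ 2 + r * z * (r * w) / -r ^ 2 = x * u - z * w := by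
      field_simp; ring
    have e2 : (p * u) ^ 2 / p ^ 2 + (r * w) ^ 2 / -r ^ 2 = u ^ 2 - w ^ 2 := by field_simp; ring
    have e3 : (p * x) ^ 2 / p ^ 2 + (r * z) ^ 2 / -r ^ 2 - 1 = x ^ 2 - z ^ 2 - 1 := by
      field_simp; ring
    rw [e1, e2, e3] at e
    linear_combination e
  have hw0 : w ≠ 0 := by
    intro h0
    have h1 := sq_nonneg (x * w - z * u)
    have h2 := sq_nonneg u
    refine hV (E2.ext ?_ ?_)
    · rw [h0] at e' h1
      rw [hu, pow_eq_zero_iff two_ne_zero |>.1 (show u ^ 2 = 0 by linarith)]; simp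
    · rw [hw, h0]; simp
  obtain ⟨φ, h1, h2⟩ := exists_angle (x := (x * w - z * u) / w) (y := ε * u / w) (by
    field_simp
    linear_combination e' + u ^ 2 * hε2)
  refine ⟨φ, lineThrough_eq_of (t := -(z / w)) (x := 1 / w) ?_ ?_ (one_div_ne_zero hw0)⟩
  · apply E2.ext
    · simp only [PiLp.add_apply, PiLp.smul_apply, smul_eq_mul, Matrix.cons_val, hx, hu, h1]
      field_simp
      ring
    · simp only [PiLp.add_apply, PiLp.smul_apply, smul_eq_mul, Matrix.cons_val, hz, hw]
      field_simp
      ring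
  · apply E2.ext
    · simp only [PiLp.smul_apply, smul_eq_mul, Matrix.cons_val, hu, h2]
      field_simp
      linear_combination u * hε2
    · simp only [PiLp.smul_apply, smul_eq_mul, Matrix.cons_val, hw]
      field_simp

lemma eq_ellipse_vertex (hp : p ≠ 0) (hq : q ≠ 0) (hε : ε = 1 ∨ ε = -1) {P : E2}
    (h1 : P ∈ ellipseLine p q ε φ) (h2 : P ∈ ellipseLine p q (-ε) χ)
    (hc : ellipseLine p q ε φ = ellipseLine p q (-ε) χ → P 0 ^ 2 / p ^ 2 + P 1 ^ 2 / q ^ 2 = 1) :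
    Real.cos ((φ - χ) / 2) ≠ 0 ∧
      P = !₂[p * (Real.sin ((φ + χ) / 2) / Real.cos ((φ - χ) / 2)),
        q * (Real.cos ((φ + χ) / 2) / Real.cos ((φ - χ) / 2))] := by
  rw [ellipseLine_eq_iff hp hq hε] at hc
  obtain ⟨t, a1, b1⟩ := mem_ellipseLine.1 h1
  obtain ⟨t', a2, b2⟩ := mem_ellipseLine.1 h2
  obtain ⟨x, hx⟩ : ∃ x, P 0 = p * x := ⟨P 0 / p, by field_simp⟩
  obtain ⟨y, hy⟩ : ∃ y, P 1 = q * y := ⟨P 1 / q, by field_simp⟩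
  rw [hx] at a1 a2 hc
  rw [hy] at b1 b2 hc
  have a1 := mul_left_cancel₀ hp a1
  have a2 := mul_left_cancel₀ hp a2
  have b1 := mul_left_cancel₀ hq b1
  have b2 := mul_left_cancel₀ hq b2
  have l1 : x * Real.sin φ + y * Real.cos φ = 1 := by
    rw [a1, b1]
    linear_combination Real.sin_sq_add_cos_sq φ
  have l2 : x * Real.sin χ + y * Real.cos χ = 1 := by
    rw [a2, b2]
    linear_combination Real.sin_sq_add_cos_sq χ
  have hφ : φ = (φ + χ) / 2 + (φ - χ) / 2 := by ring
  have hχ : χ = (φ + χ) / 2 - (φ - χ) / 2 := by ring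
  have s1 : Real.sin φ = _ := (congrArg Real.sin hφ).trans (Real.sin_add _ _)
  have c1 : Real.cos φ = _ := (congrArg Real.cos hφ).trans (Real.cos_add _ _)
  have s2 : Real.sin χ = _ := (congrArg Real.sin hχ).trans (Real.sin_sub _ _)
  have c2 : Real.cos χ = _ := (congrArg Real.cos hχ).trans (Real.cos_sub _ _)
  have i1 := Real.sin_sq_add_cos_sq ((φ + χ) / 2)
  have i2 := Real.sin_sq_add_cos_sq ((φ - χ) / 2)
  rw [s1, c1] at l1
  rw [s2, c2] at l2
  rw [s1, c1, s2, c2] at hc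
  generalize Real.sin ((φ + χ) / 2) = S at *
  generalize Real.cos ((φ + χ) / 2) = C at *
  generalize Real.sin ((φ - χ) / 2) = s at *
  generalize Real.cos ((φ - χ) / 2) = c at *
  have f1 : (x * S + y * C) * c = 1 := by linarith
  have f2 : s * (x * C - y * S) = 0 := by linarith
  have hc0 : c ≠ 0 := right_ne_zero_of_mul (by rw [f1]; norm_num)
  have f3 : x * C - y * S = 0 := by
    rcases mul_eq_zero.1 f2 with hs | h
    · have hxy := hc ⟨by rw [hs]; ring, by rw [hs]; ring⟩
      have hxy' : x ^ 2 + y ^ 2 = 1 := by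
        field_simp at hxy
        exact hxy
      refine pow_eq_zero_iff two_ne_zero |>.1 ?_
      have hcc : c ^ 2 = 1 := by rw [hs] at i2; linarith
      linear_combination (x ^ 2 + y ^ 2) * i1 + hxy' - (x * S + y * C) ^ 2 * (-hcc) -
        ((x * S + y * C) * c + 1) * f1
    · exact h
  refine ⟨hc0, E2.ext ?_ ?_⟩
  · simp only [Matrix.cons_val, hx]
    field_simp
    linear_combination -c * x * i1 + S * f1 + C * c * f3
  · simp only [Matrix.cons_val, hy]
    field_simp
    linear_combination -c * y * i1 + C * f1 - S * c * f3

lemma eq_hyperbola_vertex (hp : p ≠ 0) (hr : r ≠ 0) (hε : ε = 1 ∨ ε = -1) {P : E2}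
    (h1 : P ∈ hyperbolaLine p r ε φ) (h2 : P ∈ hyperbolaLine p r (-ε) χ)
    (hc : hyperbolaLine p r ε φ = hyperbolaLine p r (-ε) χ →
      P 0 ^ 2 / p ^ 2 + P 1 ^ 2 / -r ^ 2 = 1) :
    Real.cos ((φ - χ) / 2) ≠ 0 ∧
      P = !₂[p * (Real.sin ((φ + χ) / 2) / Real.cos ((φ - χ) / 2)),
        -(r * (ε * (Real.sin ((φ - χ) / 2) / Real.cos ((φ - χ) / 2))))] := by
  have hε2 : ε ^ 2 = 1 := by rcases hε with rfl | rfl <;> norm_num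
  obtain ⟨t, a1, b1⟩ := mem_hyperbolaLine.1 h1
  obtain ⟨t', a2, b2⟩ := mem_hyperbolaLine.1 h2
  have ht : t' = t := mul_left_cancel₀ hr (by linarith)
  rw [ht] at a2
  obtain ⟨x, hx⟩ : ∃ x, P 0 = p * x := ⟨P 0 / p, by field_simp⟩
  rw [hx] at a1 a2 hc
  rw [b1] at hc
  have a1 := mul_left_cancel₀ hp a1
  have a2 := mul_left_cancel₀ hp a2
  have hφ : φ = (φ + χ) / 2 + (φ - χ) / 2 := by ring
  have hχ : χ = (φ + χ) / 2 - (φ - χ) / 2 := by ring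
  have s1 : Real.sin φ = _ := (congrArg Real.sin hφ).trans (Real.sin_add _ _)
  have c1 : Real.cos φ = _ := (congrArg Real.cos hφ).trans (Real.cos_add _ _)
  have s2 : Real.sin χ = _ := (congrArg Real.sin hχ).trans (Real.sin_sub _ _)
  have c2 : Real.cos χ = _ := (congrArg Real.cos hχ).trans (Real.cos_sub _ _)
  have i1 := Real.sin_sq_add_cos_sq ((φ + χ) / 2)
  have i2 := Real.sin_sq_add_cos_sq ((φ - χ) / 2)
  have i3 := Real.sin_sq_add_cos_sq φ
  have hc' : Real.sin φ = Real.sin χ → Real.cos φ = -Real.cos χ →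
      (p * x) ^ 2 / p ^ 2 + (r * t) ^ 2 / -r ^ 2 = 1 := fun g1 g2 =>
    hc (hyperbolaLine_congr g1 (by rw [g2]; ring))
  have half := half_angle_div_of_eq_neg (φ := φ) (χ := χ)
  rw [s1, c1] at a1
  rw [s2, c2] at a2
  rw [s1, c1, s2, c2] at hc'
  rw [s1, c1] at i3
  generalize Real.sin ((φ + χ) / 2) = S at *
  generalize Real.cos ((φ + χ) / 2) = C at *
  generalize Real.sin ((φ - χ) / 2) = s at *
  generalize Real.cos ((φ - χ) / 2) = c at *
  have f1 : C * (s + t * ε * c) = 0 := by linarith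
  have f2 : s + t * ε * c = 0 := by
    rcases mul_eq_zero.1 f1 with hC | h
    · have hxt := hc' (by rw [hC]; ring) (by rw [hC]; ring)
      have hxt' : x ^ 2 - t ^ 2 = 1 := by
        rw [show (p * x) ^ 2 / p ^ 2 + (r * t) ^ 2 / -r ^ 2 = x ^ 2 - t ^ 2 by
          field_simp; ring] at hxt
        exact hxt
      have hS : S ^ 2 = 1 := by rw [hC] at i1; linarith
      rw [hC] at a1
      have hx' : x = S * (c - t * ε * s) := by linarith
      refine pow_eq_zero_iff two_ne_zero |>.1 ?_
      rw [hx'] at hxt'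
      linear_combination -hxt' + (c - t * ε * s) ^ 2 * hS + (1 + t ^ 2 * ε ^ 2) * i2 + t ^ 2 * hε2
    · exact h
  have hc0 : c ≠ 0 := by
    rintro rfl
    have hs : s = 0 := by linarith
    rw [hs] at i2
    norm_num at i2
  have ht' : t = -(ε * (s / c)) := by
    field_simp
    linear_combination ε * f2 - t * c * hε2
  refine ⟨hc0, E2.ext ?_ ?_⟩
  · simp only [Matrix.cons_val, hx]
    congr 1
    rw [eq_div_iff hc0, a1]
    linear_combination S * i2 + (C * c - S * s) * f2
  · simp only [Matrix.cons_val, b1]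
    rw [ht']
    ring

/-- The tangents of an IC-net on an ellipse are given by elliptic parameters with the relations of an
AC-grid. -/
theorem IsICNetOn.exists_meshPair_ellipse (hk : k ∈ Ioo (0 : ℝ) 1) (hp : 0 < p) (hq : 0 < q)
    (hkp : q ^ 2 = p ^ 2 * (1 - k ^ 2)) {N : LineGrid E2} (hN : IsICNetOn (p ^ 2) (q ^ 2) N) :
    ∃ τ σ, MeshPair k τ σ ∧
      N = ellipseGrid p q 1 (fun n => jacobiAm k (τ n)) fun n => jacobiAm k (σ n) := by
  have h1 : ∀ n, ∃ τ, N.fst n = ellipseLine p q 1 (jacobiAm k τ) := fun n => by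
    obtain ⟨φ, hφ⟩ := exists_eq_ellipseLine hp.ne' hq.ne' (Or.inl rfl) (hN.grid.line_fst n)
      (hN.grid.vertex_fst n 0) (hN.fst_touches n)
    exact ⟨ellipticF k φ, by rw [hφ, jacobiAm_ellipticF hk]⟩
  have h2 : ∀ n, ∃ τ, N.snd n = ellipseLine p q (-1) (jacobiAm k τ) := fun n => by
    obtain ⟨φ, hφ⟩ := exists_eq_ellipseLine hp.ne' hq.ne' (Or.inr rfl) (hN.grid.line_snd n)
      (hN.grid.vertex_snd 0 n) (hN.snd_touches n)
    exact ⟨ellipticF k φ, by rw [hφ, jacobiAm_ellipticF hk]⟩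
  choose τ hτ using h1
  choose σ hσ using h2
  have hv := fun n n' => eq_ellipse_vertex (φ := jacobiAm k (τ n)) (χ := jacobiAm k (σ n'))
    hp.ne' hq.ne' (Or.inl rfl) (hτ n ▸ hN.grid.vertex_fst n n') (hσ n' ▸ hN.grid.vertex_snd n n')
    (by rw [← hτ, ← hσ]; exact hN.contact n n')
  have hfin : ∀ n n', FinPar k (τ n) (σ n') := fun n n' => (hv n n').1
  have hNeq : N = ellipseGrid p q 1 (fun n => jacobiAm k (τ n)) fun n => jacobiAm k (σ n) :=
    LineGrid.ext' hτ hσ fun n n' => (hv n n').2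
  have hcongr : ∀ ε x y, SamePar k x y →
      ellipseLine p q ε (jacobiAm k x) = ellipseLine p q ε (jacobiAm k y) := by
    intro ε x y h
    unfold ellipseLine
    change lineThrough !₂[p * jacobiSn x k, q * jacobiCn x k]
      !₂[p * (ε * jacobiCn x k), -(q * (ε * jacobiSn x k))] = _
    rw [h.1, h.2]
    rfl
  refine ⟨τ, σ, ⟨hfin, fun n n' => ?_, fun n h => hN.grid.fst_ne_one n ?_,
    fun n h => hN.grid.fst_ne_two n ?_, fun n h => hN.grid.snd_ne_one n ?_,
    fun n h => hN.grid.snd_ne_two n ?_⟩, hNeq⟩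
  · have hcirc := hN.circle n n'
    rw [hNeq] at hcirc
    obtain ⟨A, B, G, ρ, hD⟩ := (circleModel_ellipseGrid hk hp hq hkp (Or.inl rfl)
      hfin).exists_circData hk hcirc
    exact hD.meshRel hk
  · rw [hτ, hτ]; exact hcongr _ _ _ h
  · rw [hτ, hτ]; exact hcongr _ _ _ h
  · rw [hσ, hσ]; exact hcongr _ _ _ h
  · rw [hσ, hσ]; exact hcongr _ _ _ h

/-- The tangents of an IC-net on a hyperbola are given by elliptic parameters with the relations of
an AC-grid. -/
theorem IsICNetOn.exists_meshPair_hyperbola (hk : k ∈ Ioo (0 : ℝ) 1) (hp : 0 < p) (hr : 0 < r)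
    (hkp : r ^ 2 * k ^ 2 = p ^ 2 * (1 - k ^ 2)) {N : LineGrid E2}
    (hN : IsICNetOn (p ^ 2) (-r ^ 2) N) :
    ∃ τ σ, MeshPair k τ σ ∧
      N = hyperbolaGrid p r 1 (fun n => jacobiAm k (τ n)) fun n => jacobiAm k (σ n) := by
  have h1 : ∀ n, ∃ τ, N.fst n = hyperbolaLine p r 1 (jacobiAm k τ) := fun n => by
    obtain ⟨φ, hφ⟩ := exists_eq_hyperbolaLine hp.ne' hr.ne' (Or.inl rfl) (hN.grid.line_fst n)
      (hN.grid.vertex_fst n 0) (hN.fst_touches n)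
    exact ⟨ellipticF k φ, by rw [hφ, jacobiAm_ellipticF hk]⟩
  have h2 : ∀ n, ∃ τ, N.snd n = hyperbolaLine p r (-1) (jacobiAm k τ) := fun n => by
    obtain ⟨φ, hφ⟩ := exists_eq_hyperbolaLine hp.ne' hr.ne' (Or.inr rfl) (hN.grid.line_snd n)
      (hN.grid.vertex_snd 0 n) (hN.snd_touches n)
    exact ⟨ellipticF k φ, by rw [hφ, jacobiAm_ellipticF hk]⟩
  choose τ hτ using h1
  choose σ hσ using h2
  have hv := fun n n' => eq_hyperbola_vertex (φ := jacobiAm k (τ n)) (χ := jacobiAm k (σ n'))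
    hp.ne' hr.ne' (Or.inl rfl) (hτ n ▸ hN.grid.vertex_fst n n') (hσ n' ▸ hN.grid.vertex_snd n n')
    (by rw [← hτ, ← hσ]; exact hN.contact n n')
  have hfin : ∀ n n', FinPar k (τ n) (σ n') := fun n n' => (hv n n').1
  have hNeq : N = hyperbolaGrid p r 1 (fun n => jacobiAm k (τ n)) fun n => jacobiAm k (σ n) :=
    LineGrid.ext' hτ hσ fun n n' => (hv n n').2
  have hcongr : ∀ ε x y, SamePar k x y →
      hyperbolaLine p r ε (jacobiAm k x) = hyperbolaLine p r ε (jacobiAm k y) := fun ε x y h =>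
    hyperbolaLine_congr h.1 (congrArg (ε * ·) h.2)
  refine ⟨τ, σ, ⟨hfin, fun n n' => ?_, fun n h => hN.grid.fst_ne_one n ?_,
    fun n h => hN.grid.fst_ne_two n ?_, fun n h => hN.grid.snd_ne_one n ?_,
    fun n h => hN.grid.snd_ne_two n ?_⟩, hNeq⟩
  · have hcirc := hN.circle n n'
    rw [hNeq] at hcirc
    obtain ⟨A, B, G, ρ, hD⟩ := (circleModel_hyperbolaGrid hk hp hr hkp (Or.inl rfl)
      hfin).exists_circData hk hcirc
    have := (hD.meshRel hk).neg_right
    rwa [show -(2 * ellipticK k - σ (n' + 1) - (2 * ellipticK k - σ n')) =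
      σ (n' + 1) - σ n' by ring] at this
  · rw [hτ, hτ]; exact hcongr _ _ _ h
  · rw [hτ, hτ]; exact hcongr _ _ _ h
  · rw [hσ, hσ]; exact hcongr _ _ _ h
  · rw [hσ, hσ]; exact hcongr _ _ _ h

end ICNet

/-! ### The deformation and its planar limits -/

section Limits

variable {a b c u k ε : ℝ} {τ σ : ℤ → ℝ}

lemma LineGrid.map_refl (N : LineGrid E2) :
    N.map (AffineIsometryEquiv.refl ℝ E2).toAffineIsometry.toAffineMap = N :=
  LineGrid.ext' (fun n => AffineSubspace.map_id (N.fst n))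
    (fun n => AffineSubspace.map_id (N.snd n)) fun _ _ => rfl

lemma IsICNetOn.isICeNet {A B : ℝ} {N : LineGrid E2} (h : IsICNetOn A B N) (hB : 0 < B)
    (hA : B < A) : IsICeNet N :=
  ⟨A, B, AffineIsometryEquiv.refl ℝ E2, hB, hA, by rwa [LineGrid.map_refl]⟩

lemma IsICNetOn.isIChNet {A B : ℝ} {N : LineGrid E2} (h : IsICNetOn A B N) (hB : B < 0)
    (hA : 0 < A) : IsIChNet N :=
  ⟨A, B, AffineIsometryEquiv.refl ℝ E2, hB, hA, by rwa [LineGrid.map_refl]⟩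

/-- The planar limit of an AC-grid which is bounded by the focal ellipse. -/
def focalEllipseGrid (a b c ε : ℝ) (φ χ : ℤ → ℝ) : LineGrid E2 :=
  ellipseGrid (Real.sqrt (a - c)) (Real.sqrt (b - c)) ε φ χ

/-- The planar limit of an AC-grid which is bounded by the focal hyperbola. -/
def focalHyperbolaGrid (a b c ε : ℝ) (φ χ : ℤ → ℝ) : LineGrid E2 :=
  hyperbolaGrid (Real.sqrt (a - b)) (Real.sqrt (b - c)) ε φ χ

lemma acGrid_neg_c (a b c ε : ℝ) (φ χ : ℤ → ℝ) :
    acGrid a b c (-c) ε φ χ = (focalEllipseGrid a b c ε φ χ).map embXY := by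
  rw [focalEllipseGrid, ← rulingGrid_eq_map_embXY, acGrid, neg_add_cancel, neg_zero,
    Real.sqrt_zero, neg_add_eq_sub, neg_add_eq_sub]

lemma acGrid_neg_b (a b c ε : ℝ) (φ χ : ℤ → ℝ) :
    acGrid a b c (-b) ε φ χ = (focalHyperbolaGrid a b c ε φ χ).map embXZ := by
  rw [focalHyperbolaGrid, ← rulingGrid_eq_map_embXZ, acGrid, neg_add_cancel,
    Real.sqrt_zero, neg_add_eq_sub, neg_add_eq_sub, neg_sub]

lemma focal_axes_sq (hcb : c < b) (hba : b < a) :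
    Real.sqrt (a - c) ^ 2 = a - c ∧ Real.sqrt (b - c) ^ 2 = b - c ∧ Real.sqrt (a - b) ^ 2 = a - b :=
  ⟨Real.sq_sqrt (by linarith), Real.sq_sqrt (by linarith), Real.sq_sqrt (by linarith)⟩

lemma focalEllipse_modulus (hk2 : (a - c) * k ^ 2 = a - b) (hcb : c < b) (hba : b < a) :
    Real.sqrt (b - c) ^ 2 = Real.sqrt (a - c) ^ 2 * (1 - k ^ 2) := by
  obtain ⟨h1, h2, -⟩ := focal_axes_sq hcb hba
  rw [h1, h2]
  linarith

lemma focalHyperbola_modulus (hk2 : (a - c) * k ^ 2 = a - b) (hcb : c < b) (hba : b < a) :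
    Real.sqrt (b - c) ^ 2 * k ^ 2 = Real.sqrt (a - b) ^ 2 * (1 - k ^ 2) := by
  obtain ⟨-, h2, h3⟩ := focal_axes_sq hcb hba
  rw [h2, h3]
  linarith

lemma MeshPair.isICNetOn_focalEllipse (hk : k ∈ Ioo (0 : ℝ) 1) (hk2 : (a - c) * k ^ 2 = a - b)
    (hcb : c < b) (hba : b < a) (hε : ε = 1 ∨ ε = -1) (h : MeshPair k τ σ) :
    IsICNetOn (a - c) (b - c)
      (focalEllipseGrid a b c ε (fun n => jacobiAm k (τ n)) fun n => jacobiAm k (σ n)) := by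
  have := h.isICNetOn_ellipseGrid hk (Real.sqrt_pos.2 (show 0 < a - c by linarith))
    (Real.sqrt_pos.2 (show 0 < b - c by linarith)) (focalEllipse_modulus hk2 hcb hba) hε
  rwa [(focal_axes_sq hcb hba).1,
    (focal_axes_sq hcb hba).2.1] at this

lemma MeshPair.isICNetOn_focalHyperbola (hk : k ∈ Ioo (0 : ℝ) 1) (hk2 : (a - c) * k ^ 2 = a - b)
    (hcb : c < b) (hba : b < a) (hε : ε = 1 ∨ ε = -1) (h : MeshPair k τ σ) :
    IsICNetOn (a - b) (c - b)
      (focalHyperbolaGrid a b c ε (fun n => jacobiAm k (τ n)) fun n => jacobiAm k (σ n)) := by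
  have := h.isICNetOn_hyperbolaGrid hk (Real.sqrt_pos.2 (show 0 < a - b by linarith))
    (Real.sqrt_pos.2 (show 0 < b - c by linarith)) (focalHyperbola_modulus hk2 hcb hba) hε
  rwa [(focal_axes_sq hcb hba).2.1,
    (focal_axes_sq hcb hba).2.2, neg_sub] at this

/-- The deformation of the AC-grid with given parameters between its two planar limits. -/
theorem MeshPair.acDeformation (hk : k ∈ Ioo (0 : ℝ) 1) (hk2 : (a - c) * k ^ 2 = a - b)
    (hcb : c < b) (hba : b < a) (hu : u ∈ Ioo (-b) (-c)) (hε : ε = 1 ∨ ε = -1)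
    (h : MeshPair k τ σ) :
    ACDeformation a b c u
      (acGrid a b c u ε (fun n => jacobiAm k (τ n)) fun n => jacobiAm k (σ n))
      (focalEllipseGrid a b c ε (fun n => jacobiAm k (τ n)) fun n => jacobiAm k (σ n))
      (focalHyperbolaGrid a b c ε (fun n => jacobiAm k (τ n)) fun n => jacobiAm k (σ n)) where
  hcb := hcb
  hba := hba
  hu := hu
  isACGrid v hv := by
    rw [acGrid_map_deform hba hu (Ioo_subset_Icc_self hv)]
    exact h.isACGrid hk hk2 hcb hba hv hε
  start := acGrid_map_deform hba hu (Ioo_subset_Icc_self hu) _ _ _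
  continuous P := continuousOn_deform a b c u P _
  isometric v hv := by
    have hε' : -ε = 1 ∨ -ε = -1 := by rcases hε with rfl | rfl <;> norm_num
    exact ⟨fun n P hP Q hQ => dist_deform_ruling hba hu hv hε hP hQ,
      fun n P hP Q hQ => dist_deform_ruling hba hu hv hε' hP hQ⟩
  limit_c := by
    rw [acGrid_map_deform hba hu ⟨by linarith, le_rfl⟩, acGrid_neg_c]
  limit_b := by
    rw [acGrid_map_deform hba hu ⟨le_rfl, by linarith⟩, acGrid_neg_b]

/-- Every IC-net bounded by an ellipse is the planar limit of AC-grids. -/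
theorem IsICeNet.exists_acDeformation {N : LineGrid E2} (hN : IsICeNet N) :
    ∃ (a b c u : ℝ) (G : LineGrid E3) (φ : E2 ≃ᵃⁱ[ℝ] E2) (N' : LineGrid E2),
      IsIChNet N' ∧ ACDeformation a b c u G (N.map φ.toAffineIsometry.toAffineMap) N' := by
  obtain ⟨A, B, ψ, hB, hA, hN⟩ := hN
  have hk := modulus₁_mem hB hA
  have hk2 := modulus₁_sq hB hA
  obtain ⟨h1, h2, -⟩ := focal_axes_sq hB hA
  have hN' : IsICNetOn (Real.sqrt (A - 0) ^ 2) (Real.sqrt (B - 0) ^ 2)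
      (N.map ψ.toAffineIsometry.toAffineMap) := by rwa [h1, h2, sub_zero, sub_zero]
  obtain ⟨τ, σ, h, hNeq⟩ := hN'.exists_meshPair_ellipse hk
    (Real.sqrt_pos.2 (by linarith)) (Real.sqrt_pos.2 (by linarith))
    (focalEllipse_modulus hk2 hB hA)
  have hD := h.acDeformation hk hk2 hB hA (u := -(B / 2)) ⟨by linarith, by linarith⟩ (Or.inl rfl)
  rw [focalEllipseGrid, ← hNeq] at hD
  refine ⟨A, B, 0, -(B / 2), _, ψ, _, ?_, hD⟩
  exact (h.isICNetOn_focalHyperbola hk hk2 hB hA (Or.inl rfl)).isIChNet (by linarith) (by linarith)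

/-- Every IC-net bounded by a hyperbola is the planar limit of AC-grids. -/
theorem IsIChNet.exists_acDeformation {N : LineGrid E2} (hN : IsIChNet N) :
    ∃ (a b c u : ℝ) (G : LineGrid E3) (φ : E2 ≃ᵃⁱ[ℝ] E2) (N' : LineGrid E2),
      IsICeNet N' ∧ ACDeformation a b c u G N' (N.map φ.toAffineIsometry.toAffineMap) := by
  obtain ⟨A, B, ψ, hB, hA, hN⟩ := hN
  have hk := modulus₁_mem hB hA
  have hk2 := modulus₁_sq hB hA
  obtain ⟨-, h2, h3⟩ := focal_axes_sq hB hA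
  have hN' : IsICNetOn (Real.sqrt (A - 0) ^ 2) (-Real.sqrt (0 - B) ^ 2)
      (N.map ψ.toAffineIsometry.toAffineMap) := by rwa [h3, h2, sub_zero, neg_sub, sub_zero]
  obtain ⟨τ, σ, h, hNeq⟩ := hN'.exists_meshPair_hyperbola hk
    (Real.sqrt_pos.2 (by linarith)) (Real.sqrt_pos.2 (by linarith))
    (focalHyperbola_modulus hk2 hB hA)
  have hD := h.acDeformation hk hk2 hB hA (u := -(B / 2)) ⟨by linarith, by linarith⟩ (Or.inl rfl)
  rw [focalHyperbolaGrid, ← hNeq] at hD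
  refine ⟨A, 0, B, -(B / 2), _, ψ, _, ?_, hD⟩
  exact (h.isICNetOn_focalEllipse hk hk2 hB hA (Or.inl rfl)).isICeNet (by linarith) (by linarith)

end Limits

/-! ### Equidistant elliptic parameters -/

section Steps

variable {k : ℝ} {τ σ : ℤ → ℝ}

lemma MeshRel.symm {x y : ℝ} (h : MeshRel k x y) : MeshRel k y x := by
  obtain ⟨j, h | h⟩ := h
  · exact ⟨-j, Or.inl (by push_cast; linarith)⟩
  · exact ⟨j, Or.inr (by linarith)⟩

lemma FinPar.symm {x y : ℝ} (h : FinPar k x y) : FinPar k y x := by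
  unfold FinPar at *
  rwa [show (jacobiAm k y - jacobiAm k x) / 2 = -((jacobiAm k x - jacobiAm k y) / 2) by ring,
    Real.cos_neg]

lemma MeshPair.symm (h : MeshPair k τ σ) : MeshPair k σ τ :=
  ⟨fun n n' => (h.fin n' n).symm, fun n n' => (h.rel n' n).symm, h.snd_ne_one, h.snd_ne_two,
    h.fst_ne_one, h.fst_ne_two⟩

lemma samePar_of_steps (hk : k ∈ Ioo (0 : ℝ) 1) {x : ℝ}
    (h : ∀ n, SamePar k (τ (n + 1)) (τ n + x)) (n : ℤ) : SamePar k (τ n) (τ 0 + n * x) := by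
  induction n using Int.induction_on with
  | zero => exact (samePar_iff hk).2 ⟨0, by simp⟩
  | succ i ih =>
    refine (h i).trans ?_
    have := ih.add hk x
    rwa [show τ 0 + (i : ℤ) * x + x = τ 0 + ((i : ℤ) + 1 : ℤ) * x by push_cast; ring] at this
  | pred i ih =>
    have h1 := (h (-i - 1)).symm.sub hk x
    rw [sub_add_cancel, add_sub_cancel_right] at h1
    refine h1.trans ?_
    have := ih.sub hk x
    rwa [show τ 0 + ((-(i : ℤ) : ℤ) : ℝ) * x - x = τ 0 + ((-(i : ℤ) - 1 : ℤ) : ℝ) * x by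
      push_cast; ring] at this

/-- All steps of the first sequence are equal up to periods, since the steps of opposite sign would
let the next but one line coincide. -/
lemma MeshPair.samePar_fst (hk : k ∈ Ioo (0 : ℝ) 1) (h : MeshPair k τ σ) (n : ℤ) :
    SamePar k (τ n) (τ 0 + n * (τ 1 - τ 0)) := by
  have hstep : ∀ n, SamePar k (τ (n + 1 + 1) - τ (n + 1)) (τ (n + 1) - τ n) := by
    intro n
    obtain ⟨i, hi | hi⟩ := (h.rel (n + 1) 0).of_common (h.rel n 0)
    · exact (samePar_iff hk).2 ⟨i, hi⟩
    · refine absurd (SamePar.symm ((samePar_iff hk).2 ⟨i, ?_⟩)) (h.fst_ne_two n)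
      rw [show n + 1 + 1 = n + 2 by ring] at hi
      linarith
  have hall := samePar_of_steps (τ := fun n => τ (n + 1) - τ n) (x := 0) hk fun n => by
    simpa using hstep n
  refine samePar_of_steps hk (fun n => ?_) n
  have := (hall n).add hk (τ n)
  simpa [add_comm] using this

/-- The parameters of a grid form arithmetic progressions with the same or opposite differences. -/
lemma MeshPair.exists_progression (hk : k ∈ Ioo (0 : ℝ) 1) (h : MeshPair k τ σ) :
    ∃ δ : ℝ, (∀ j : ℤ, δ ≠ j * ellipticK k) ∧
      (∀ n j : ℤ, δ * n + ((τ 0 - σ 0) / 2 + ellipticK k) ≠ 2 * j * ellipticK k) ∧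
      (∀ n : ℤ, SamePar k (τ n) (τ 0 + n * (2 * δ))) ∧
      ((∀ n : ℤ, SamePar k (σ n) (σ 0 + n * (2 * δ))) ∨
        ∀ n : ℤ, SamePar k (σ (-n)) (σ 0 + n * (2 * δ))) := by
  have hτ := h.samePar_fst hk
  have hσ := h.symm.samePar_fst hk
  have hd : 2 * ((τ 1 - τ 0) / 2) = τ 1 - τ 0 := by ring
  refine ⟨(τ 1 - τ 0) / 2, fun j hj => h.fst_step_ne hk 0 j ?_, fun n j hj => ?_,
    fun n => by rw [hd]; exact hτ n, ?_⟩
  · rw [zero_add]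
    linarith
  · obtain ⟨i, hi⟩ := (samePar_iff hk).1 (hτ n)
    have hf := (h.fin n 0).add_period hk (-i)
    refine hf ((cos_half_sub_eq_zero_iff hk).2 ⟨j - 1, ?_⟩)
    rw [hi]
    push_cast
    linear_combination 2 * hj
  · obtain ⟨j, hj⟩ := h.rel 0 0
    rw [zero_add] at hj
    rw [hd]
    have hmul : ∀ (n : ℤ) {x y : ℝ}, (∃ j : ℤ, x = y + j * (4 * ellipticK k)) →
        SamePar k (σ 0 + n * x) (σ 0 + n * y) := by
      rintro n x y ⟨j, hj⟩
      refine (samePar_iff hk).2 ⟨n * j, ?_⟩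
      rw [hj]
      push_cast
      ring
    rcases hj with hj | hj
    · exact Or.inl fun n => (hσ n).trans (hmul n ⟨-j, by push_cast; linarith⟩)
    · refine Or.inr fun n => (hσ (-n)).trans ?_
      rw [show σ 0 + ((-n : ℤ) : ℝ) * (σ 1 - σ 0) = σ 0 + n * (-(σ 1 - σ 0)) by push_cast; ring]
      exact hmul n ⟨-j, by push_cast; linarith⟩

lemma meshPair_of_progression (hk : k ∈ Ioo (0 : ℝ) 1) {δ s₁ s₃ : ℝ}
    (h1 : ∀ j : ℤ, δ ≠ j * ellipticK k) (h2 : ∀ n j : ℤ, δ * n + s₃ ≠ 2 * j * ellipticK k) :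
    MeshPair k (fun n => s₁ + (s₃ - ellipticK k) + n * (2 * δ))
      fun n => s₁ - (s₃ - ellipticK k) + n * (2 * δ) := by
  have hne1 : ∀ (x : ℝ) (n : ℤ), ¬ SamePar k (x + n * (2 * δ)) (x + (n + 1 : ℤ) * (2 * δ)) := by
    intro x n h
    obtain ⟨j, hj⟩ := (samePar_iff hk).1 h
    push_cast at hj
    refine h1 (-(2 * j)) ?_
    push_cast
    linarith
  have hne2 : ∀ (x : ℝ) (n : ℤ), ¬ SamePar k (x + n * (2 * δ)) (x + (n + 2 : ℤ) * (2 * δ)) := by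
    intro x n h
    obtain ⟨j, hj⟩ := (samePar_iff hk).1 h
    push_cast at hj
    refine h1 (-j) ?_
    push_cast
    linarith
  refine ⟨fun n n' h => ?_, fun n n' => ⟨0, Or.inl ?_⟩, hne1 _, hne2 _, hne1 _, hne2 _⟩
  · obtain ⟨j, hj⟩ := (cos_half_sub_eq_zero_iff hk).1 h
    refine h2 (n - n') (j + 1) ?_
    push_cast
    linarith
  · push_cast
    ring

end Steps

/-! ### The parametrisation by elliptic functions -/

section Parametrisation

variable {a b c : ℝ}

lemma rulingVertex_swap (p q r ε φ χ : ℝ) :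
    rulingVertex p q r (-ε) φ χ = rulingVertex p q r ε χ φ := by
  have e1 : (φ - χ) / 2 = -((χ - φ) / 2) := by ring
  rw [rulingVertex, rulingVertex, add_comm φ χ, e1, Real.cos_neg, Real.sin_neg]
  congr 4
  ring

lemma rulingVertex_congr_fst {k : ℝ} (hk : k ∈ Ioo (0 : ℝ) 1) (p q r ε χ : ℝ) {τ τ' : ℝ}
    (h : SamePar k τ τ') :
    rulingVertex p q r ε (jacobiAm k τ) χ = rulingVertex p q r ε (jacobiAm k τ') χ := by
  obtain ⟨j, rfl⟩ := (samePar_iff hk).1 h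
  exact rulingVertex_add_period hk p q r ε τ' χ j

/-- The elliptic parameter of a vertex matters only up to periods. -/
lemma rulingVertex_congr {k : ℝ} (hk : k ∈ Ioo (0 : ℝ) 1) (p q r ε : ℝ) {τ τ' σ σ' : ℝ}
    (h : SamePar k τ τ') (h' : SamePar k σ σ') :
    rulingVertex p q r ε (jacobiAm k τ) (jacobiAm k σ) =
      rulingVertex p q r ε (jacobiAm k τ') (jacobiAm k σ') := by
  rw [rulingVertex_congr_fst hk p q r ε _ h, ← rulingVertex_swap, rulingVertex_congr_fst hk p q r _ _ h',
    rulingVertex_swap]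

lemma ellipticK_jacobi_nonneg {k s : ℝ} (hk : k ∈ Ioo (0 : ℝ) 1) (hs : s ∈ Icc 0 (ellipticK k)) :
    0 ≤ jacobiAm k s ∧ jacobiAm k s ≤ Real.pi / 2 ∧ 0 ≤ jacobiSn s k ∧ 0 ≤ jacobiCn s k := by
  have h0 : 0 ≤ jacobiAm k s := by
    rw [← jacobiAm_zero hk]; exact (strictMono_jacobiAm hk).monotone hs.1
  have h1 : jacobiAm k s ≤ Real.pi / 2 := by
    rw [← jacobiAm_ellipticK hk]; exact (strictMono_jacobiAm hk).monotone hs.2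
  have := Real.pi_pos
  exact ⟨h0, h1, Real.sin_nonneg_of_nonneg_of_le_pi h0 (by linarith),
    Real.cos_nonneg_of_neg_pi_div_two_le_of_le (by linarith) h1⟩

lemma paramU₂_zero (hcb : c < b) (hba : b < a) : paramU₂ a b c 0 = -c := by
  rw [paramU₂, jacobiSn_zero (modulus₂_mem hcb hba)]
  ring

lemma paramU₂_K (hcb : c < b) (hba : b < a) :
    paramU₂ a b c (ellipticK (modulus₂ a b c)) = -b := by
  rw [paramU₂, jacobiSn_K (modulus₂_mem hcb hba)]
  ring

theorem bijOn_paramU₂ (hcb : c < b) (hba : b < a) :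
    BijOn (paramU₂ a b c) (Icc 0 (ellipticK (modulus₂ a b c))) (Icc (-b) (-c)) := by
  have hk := modulus₂_mem hcb hba
  have hK := (ellipticK_pos hk).le
  refine ⟨fun s hs => ?_, fun s hs t ht hst => ?_, ?_⟩
  · have h1 := sq_nonneg (jacobiSn s (modulus₂ a b c))
    have h2 := sq_nonneg (jacobiCn s (modulus₂ a b c))
    rw [jacobiCn_sq] at h2
    have h3 := mul_nonneg (sub_nonneg.2 hcb.le) h1
    have h4 := mul_nonneg (sub_nonneg.2 hcb.le) h2
    constructor <;> rw [paramU₂] <;> linarith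
  · obtain ⟨s0, s1, s2, -⟩ := ellipticK_jacobi_nonneg hk hs
    obtain ⟨t0, t1, t2, -⟩ := ellipticK_jacobi_nonneg hk ht
    rw [paramU₂, paramU₂] at hst
    have h1 : jacobiSn s (modulus₂ a b c) ^ 2 = jacobiSn t (modulus₂ a b c) ^ 2 :=
      mul_left_cancel₀ (show b - c ≠ 0 by linarith) (by linarith)
    have h2 := (sq_eq_sq₀ s2 t2).1 h1
    have := Real.pi_pos
    exact (strictMono_jacobiAm hk).injective
      (Real.injOn_sin ⟨by linarith, s1⟩ ⟨by linarith, t1⟩ h2)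
  · have hcont : Continuous (paramU₂ a b c) := by
      have := continuous_jacobiSn hk
      unfold paramU₂
      fun_prop
    have := intermediate_value_Icc' hK hcont.continuousOn
    rwa [paramU₂_zero hcb hba, paramU₂_K hcb hba] at this

lemma paramU₂_mem_Ioo (hcb : c < b) (hba : b < a) {s : ℝ}
    (hs : s ∈ Ioo 0 (ellipticK (modulus₂ a b c))) : paramU₂ a b c s ∈ Ioo (-b) (-c) := by
  have hbij := bijOn_paramU₂ hcb hba
  have hK := (ellipticK_pos (modulus₂_mem hcb hba)).le
  have hs' := Ioo_subset_Icc_self hs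
  obtain ⟨h1, h2⟩ := hbij.mapsTo hs'
  constructor
  · refine lt_of_le_of_ne h1 fun h => hs.2.ne (hbij.injOn hs' (right_mem_Icc.2 hK) ?_)
    rw [paramU₂_K hcb hba, h]
  · refine lt_of_le_of_ne h2 fun h => hs.1.ne' (hbij.injOn hs' (left_mem_Icc.2 hK) ?_)
    rw [paramU₂_zero hcb hba, h]

lemma jacobiDn_K_modulus (hcb : c < b) (hba : b < a) :
    jacobiDn (ellipticK (modulus₁ a b c)) (modulus₁ a b c) = modulus₂ a b c := by
  have h1 := modulus₁_sq hcb hba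
  have h2 := modulus₂_sq hcb hba
  rw [jacobiDn, jacobiSn_K (modulus₁_mem hcb hba),
    show 1 - modulus₁ a b c ^ 2 * 1 ^ 2 = modulus₂ a b c ^ 2 from
      mul_left_cancel₀ (show a - c ≠ 0 by linarith) (by linarith),
    Real.sqrt_sq (modulus₂_mem hcb hba).1.le]

/-- The semi-axes of the hyperboloid with parameter `u₂(s₂)`. -/
lemma sqrt_paramU₂ (hcb : c < b) (hba : b < a) {s : ℝ}
    (hs : s ∈ Icc 0 (ellipticK (modulus₂ a b c))) :
    Real.sqrt (paramU₂ a b c s + a) = Real.sqrt (a - c) * jacobiDn s (modulus₂ a b c) ∧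
    Real.sqrt (paramU₂ a b c s + b) =
      Real.sqrt (a - c) * (modulus₂ a b c * jacobiCn s (modulus₂ a b c)) ∧
    Real.sqrt (-(paramU₂ a b c s + c)) =
      Real.sqrt (a - c) * (modulus₂ a b c * jacobiSn s (modulus₂ a b c)) := by
  have hk := modulus₂_mem hcb hba
  have h2 := modulus₂_sq hcb hba
  obtain ⟨-, -, h3, h4⟩ := ellipticK_jacobi_nonneg hk hs
  have hac : 0 ≤ a - c := by linarith
  have key : ∀ {x y : ℝ}, 0 ≤ y → x = (a - c) * y ^ 2 →
      Real.sqrt x = Real.sqrt (a - c) * y := by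
    rintro x y hy rfl
    rw [Real.sqrt_mul hac, Real.sqrt_sq hy]
  refine ⟨key (jacobiDn_pos hk s).le ?_, key (mul_nonneg hk.1.le h4) ?_,
    key (mul_nonneg hk.1.le h3) ?_⟩
  · rw [jacobiDn_sq hk, paramU₂]
    linear_combination jacobiSn s (modulus₂ a b c) ^ 2 * h2
  · rw [mul_pow, jacobiCn_sq, paramU₂]
    linear_combination -(1 - jacobiSn s (modulus₂ a b c) ^ 2) * h2
  · rw [mul_pow, paramU₂]
    linear_combination -jacobiSn s (modulus₂ a b c) ^ 2 * h2

/-- The vertices of AC-grids in the parametrisation by elliptic functions, where the third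
parameter is half the difference of the parameters of the lines, shifted by a quarter period. -/
lemma confocalPoint_eq (hcb : c < b) (hba : b < a) {s₂ : ℝ}
    (hs : s₂ ∈ Icc 0 (ellipticK (modulus₂ a b c))) {s m : ℝ}
    (hf : FinPar (modulus₁ a b c) (s + m) (s - m)) :
    confocalPoint a b c s s₂ (m + ellipticK (modulus₁ a b c)) =
      rulingVertex (Real.sqrt (paramU₂ a b c s₂ + a)) (Real.sqrt (paramU₂ a b c s₂ + b))
        (Real.sqrt (-(paramU₂ a b c s₂ + c))) 1
        (jacobiAm (modulus₁ a b c) (s + m)) (jacobiAm (modulus₁ a b c) (s - m)) := by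
  have hk := modulus₁_mem hcb hba
  obtain ⟨c0, hv⟩ := rulingVertex_eq_jacobi hk (Real.sqrt (paramU₂ a b c s₂ + a))
    (Real.sqrt (paramU₂ a b c s₂ + b)) (Real.sqrt (-(paramU₂ a b c s₂ + c))) 1 hf
  obtain ⟨r1, r2, r3⟩ := sqrt_paramU₂ hcb hba hs
  have d0 := (jacobiDn_pos hk m).ne'
  have e1 := jacobiSn_add_K hk m
  have e2 := jacobiCn_add_K hk m
  have e3 := jacobiDn_add_K hk m
  rw [jacobiDn_K_modulus hcb hba] at e2 e3
  rw [← eq_div_iff d0] at e1 e2 e3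
  rw [hv, r1, r2, r3, confocalPoint, e1, e2, e3]
  apply E3.ext
  · simp only [PiLp.smul_apply, smul_eq_mul, Matrix.cons_val]
    field_simp
  · simp only [PiLp.smul_apply, smul_eq_mul, Matrix.cons_val]
    field_simp
  · simp only [PiLp.smul_apply, smul_eq_mul, Matrix.cons_val]
    field_simp

/-- The grid points as intersections of lines with arithmetic progressions as parameters. -/
lemma gridPoint_eq (hcb : c < b) (hba : b < a) {δ s₁ s₃ s₂ : ℝ}
    (hs : s₂ ∈ Icc 0 (ellipticK (modulus₂ a b c))) {n n' : ℤ} {τ σ : ℝ}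
    (hτ : SamePar (modulus₁ a b c) τ (s₁ + (s₃ - ellipticK (modulus₁ a b c)) + n * (2 * δ)))
    (hσ : SamePar (modulus₁ a b c) σ (s₁ - (s₃ - ellipticK (modulus₁ a b c)) + n' * (2 * δ)))
    (h : ∀ n j : ℤ, δ * n + s₃ ≠ 2 * j * ellipticK (modulus₁ a b c)) :
    rulingVertex (Real.sqrt (paramU₂ a b c s₂ + a)) (Real.sqrt (paramU₂ a b c s₂ + b))
        (Real.sqrt (-(paramU₂ a b c s₂ + c))) 1
        (jacobiAm (modulus₁ a b c) τ) (jacobiAm (modulus₁ a b c) σ) =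
      gridPoint a b c δ s₁ s₃ s₂ n n' := by
  have hk := modulus₁_mem hcb hba
  have e1 : s₁ + (s₃ - ellipticK (modulus₁ a b c)) + n * (2 * δ) = (δ * ((n : ℝ) + n') + s₁) +
      (δ * ((n : ℝ) - n') + s₃ - ellipticK (modulus₁ a b c)) := by ring
  have e2 : s₁ - (s₃ - ellipticK (modulus₁ a b c)) + n' * (2 * δ) = (δ * ((n : ℝ) + n') + s₁) -
      (δ * ((n : ℝ) - n') + s₃ - ellipticK (modulus₁ a b c)) := by ring
  rw [rulingVertex_congr hk _ _ _ _ hτ hσ, e1, e2, ← confocalPoint_eq hcb hba hs, sub_add_cancel,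
    gridPoint]
  intro h0
  obtain ⟨j, hj⟩ := (cos_half_sub_eq_zero_iff hk).1 h0
  refine h (n - n') (j + 1) ?_
  push_cast
  linarith

/-- Every AC-grid is represented by elliptic functions, after interchanging the two sequences and
reversing one of them if necessary. -/
theorem MeshPair.exists_gridPoint (hcb : c < b) (hba : b < a) {u ε : ℝ} (hu : u ∈ Ioo (-b) (-c))
    (hε : ε = 1 ∨ ε = -1) {τ σ : ℤ → ℝ} (h : MeshPair (modulus₁ a b c) τ σ) {G : LineGrid E3}
    (hG : G = acGrid a b c u ε (fun n => jacobiAm (modulus₁ a b c) (τ n))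
      fun n => jacobiAm (modulus₁ a b c) (σ n)) :
    ∃ δ s₁₀ s₃₀ : ℝ, AdmissibleConstants a b c δ s₃₀ ∧
      ∃ G' : LineGrid E3,
        (G' = G ∨ G' = G.reverse ∨ G' = G.swap ∨ G' = G.swap.reverse) ∧
        ∀ s₂ ∈ Icc 0 (ellipticK (modulus₂ a b c)), ∀ n₁ n₃ : ℤ,
          (G'.map (deform a b c u (paramU₂ a b c s₂))).vertex n₁ n₃ =
            gridPoint a b c δ s₁₀ s₃₀ s₂ n₁ n₃ := by
  have hk := modulus₁_mem hcb hba
  -- after an interchange of the two sequences, it may be assumed that `ε = 1`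
  obtain ⟨H, hH, τ, σ, h, hv⟩ : ∃ H, (H = G ∨ H = G.swap) ∧ ∃ τ σ,
      MeshPair (modulus₁ a b c) τ σ ∧ ∀ n n', H.vertex n n' =
        rulingVertex (Real.sqrt (u + a)) (Real.sqrt (u + b)) (Real.sqrt (-(u + c))) 1
          (jacobiAm (modulus₁ a b c) (τ n)) (jacobiAm (modulus₁ a b c) (σ n')) := by
    rcases hε with rfl | rfl
    · exact ⟨G, Or.inl rfl, τ, σ, h, fun n n' => by rw [hG]; rfl⟩
    · refine ⟨G.swap, Or.inr rfl, σ, τ, h.symm, fun n n' => ?_⟩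
      rw [← rulingVertex_swap, hG]
      rfl
  obtain ⟨δ, h1, h2, h3, h4⟩ := h.exists_progression hk
  have e1 : τ 0 = (τ 0 + σ 0) / 2 + ((τ 0 - σ 0) / 2 + ellipticK (modulus₁ a b c) -
      ellipticK (modulus₁ a b c)) := by ring
  have e2 : σ 0 = (τ 0 + σ 0) / 2 - ((τ 0 - σ 0) / 2 + ellipticK (modulus₁ a b c) -
      ellipticK (modulus₁ a b c)) := by ring
  refine ⟨δ, (τ 0 + σ 0) / 2, (τ 0 - σ 0) / 2 + ellipticK (modulus₁ a b c), ⟨h1, h2⟩, ?_⟩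
  rcases h4 with h4 | h4
  · refine ⟨H, by tauto, fun s₂ hs n₁ n₃ => ?_⟩
    change deform a b c u (paramU₂ a b c s₂) (H.vertex n₁ n₃) = _
    rw [hv, deform_rulingVertex hba hu ((bijOn_paramU₂ hcb hba).mapsTo hs)]
    exact gridPoint_eq hcb hba hs (e1 ▸ h3 n₁) (e2 ▸ h4 n₃) h2
  · refine ⟨H.reverse, ?_, fun s₂ hs n₁ n₃ => ?_⟩
    · rcases hH with rfl | rfl <;> simp
    · change deform a b c u (paramU₂ a b c s₂) (H.vertex n₁ (-n₃)) = _
      rw [hv, deform_rulingVertex hba hu ((bijOn_paramU₂ hcb hba).mapsTo hs)]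
      exact gridPoint_eq hcb hba hs (e1 ▸ h3 n₁) (e2 ▸ h4 n₃) h2

/-- All admissible constants give rise to AC-grids. -/
theorem exists_isACGrid_gridPoint (hcb : c < b) (hba : b < a) {δ s₁₀ s₃₀ : ℝ}
    (h : AdmissibleConstants a b c δ s₃₀) {s₂ : ℝ}
    (hs : s₂ ∈ Ioo 0 (ellipticK (modulus₂ a b c))) :
    ∃ G : LineGrid E3, IsACGrid a b c (paramU₂ a b c s₂) G ∧
      (∀ n₁ n₃ : ℤ, G.vertex n₁ n₃ = gridPoint a b c δ s₁₀ s₃₀ s₂ n₁ n₃) ∧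
      ∀ s₂' ∈ Icc 0 (ellipticK (modulus₂ a b c)), ∀ n₁ n₃ : ℤ,
        (G.map (deform a b c (paramU₂ a b c s₂) (paramU₂ a b c s₂'))).vertex n₁ n₃ =
          gridPoint a b c δ s₁₀ s₃₀ s₂' n₁ n₃ := by
  have hk := modulus₁_mem hcb hba
  have hu := paramU₂_mem_Ioo hcb hba hs
  refine ⟨_, (meshPair_of_progression hk (s₁ := s₁₀) h.1 h.2).isACGrid hk (modulus₁_sq hcb hba)
    hcb hba hu (Or.inl rfl), fun n₁ n₃ => ?_, fun s₂' hs' n₁ n₃ => ?_⟩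
  · exact gridPoint_eq hcb hba (Ioo_subset_Icc_self hs) ⟨rfl, rfl⟩ ⟨rfl, rfl⟩ h.2
  · rw [acGrid_map_deform hba hu ((bijOn_paramU₂ hcb hba).mapsTo hs')]
    exact gridPoint_eq hcb hba hs' ⟨rfl, rfl⟩ ⟨rfl, rfl⟩ h.2

end Parametrisation

end

theorem mainTheorem6 :
    (∀ a b c : ℝ, c < b → b < a →
      -- deformation of an arbitrary AC-grid
      (∀ u ∈ Ioo (-b) (-c), ∀ G : LineGrid E3, IsACGrid a b c u G →
        -- the deformation starts at `G`, is continuous, and AC-grids are preserved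
        (G.map (deform a b c u u) = G ∧
          (∀ P : E3, ContinuousOn (fun v => deform a b c u v P) (Icc (-b) (-c))) ∧
          ∀ v ∈ Ioo (-b) (-c), IsACGrid a b c v (G.map (deform a b c u v))) ∧
        -- the lengths of the edges are preserved
        (∀ v ∈ Icc (-b) (-c), ∀ n n' : ℤ,
          dist (deform a b c u v (G.vertex n n')) (deform a b c u v (G.vertex n (n' + 1))) =
            dist (G.vertex n n') (G.vertex n (n' + 1)) ∧
          dist (deform a b c u v (G.vertex n n')) (deform a b c u v (G.vertex (n + 1) n')) =
            dist (G.vertex n n') (G.vertex (n + 1) n')) ∧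
        -- the quadrilaterals are folded: they are skew, and both diagonals change monotonically
        (∀ n n' : ℤ,
          (∀ v ∈ Ioo (-b) (-c), AffineIndependent ℝ
            ![deform a b c u v (G.vertex n n'), deform a b c u v (G.vertex (n + 1) n'),
              deform a b c u v (G.vertex (n + 1) (n' + 1)),
              deform a b c u v (G.vertex n (n' + 1))]) ∧
          (StrictMonoOn (fun v => dist (deform a b c u v (G.vertex n n'))
              (deform a b c u v (G.vertex (n + 1) (n' + 1)))) (Icc (-b) (-c)) ∨
            StrictAntiOn (fun v => dist (deform a b c u v (G.vertex n n'))
              (deform a b c u v (G.vertex (n + 1) (n' + 1)))) (Icc (-b) (-c))) ∧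
          (StrictMonoOn (fun v => dist (deform a b c u v (G.vertex (n + 1) n'))
              (deform a b c u v (G.vertex n (n' + 1)))) (Icc (-b) (-c)) ∨
            StrictAntiOn (fun v => dist (deform a b c u v (G.vertex (n + 1) n'))
              (deform a b c u v (G.vertex n (n' + 1)))) (Icc (-b) (-c)))) ∧
        -- planar limits: IC-nets whose lines touch the focal ellipse and the focal hyperbola
        (∃ N : LineGrid E2, G.map (deform a b c u (-c)) = N.map embXY ∧
          IsICeNet N ∧ IsICNetOn (a - c) (b - c) N) ∧
        (∃ N : LineGrid E2, G.map (deform a b c u (-b)) = N.map embXZ ∧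
          IsIChNet N ∧ IsICNetOn (a - b) (c - b) N) ∧
        -- representation of the AC-grid and its deformation
        (∃ δ s₁₀ s₃₀ : ℝ, AdmissibleConstants a b c δ s₃₀ ∧
          ∃ G' : LineGrid E3,
            (G' = G ∨ G' = G.reverse ∨ G' = G.swap ∨ G' = G.swap.reverse) ∧
            ∀ s₂ ∈ Icc 0 (ellipticK (modulus₂ a b c)), ∀ n₁ n₃ : ℤ,
              (G'.map (deform a b c u (paramU₂ a b c s₂))).vertex n₁ n₃ =
                gridPoint a b c δ s₁₀ s₃₀ s₂ n₁ n₃)) ∧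
      -- the parameter `s₂` labels all stages of the deformation
      BijOn (paramU₂ a b c) (Icc 0 (ellipticK (modulus₂ a b c))) (Icc (-b) (-c)) ∧
      -- all admissible constants give rise to AC-grids
      (∀ δ s₁₀ s₃₀ : ℝ, AdmissibleConstants a b c δ s₃₀ →
        ∀ s₂ ∈ Ioo 0 (ellipticK (modulus₂ a b c)),
          ∃ G : LineGrid E3, IsACGrid a b c (paramU₂ a b c s₂) G ∧
            (∀ n₁ n₃ : ℤ, G.vertex n₁ n₃ = gridPoint a b c δ s₁₀ s₃₀ s₂ n₁ n₃) ∧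
            ∀ s₂' ∈ Icc 0 (ellipticK (modulus₂ a b c)), ∀ n₁ n₃ : ℤ,
              (G.map (deform a b c (paramU₂ a b c s₂) (paramU₂ a b c s₂'))).vertex n₁ n₃ =
                gridPoint a b c δ s₁₀ s₃₀ s₂' n₁ n₃)) ∧
    -- any IC-net bounded by an ellipse is transformed into one bounded by a hyperbola ...
    (∀ N : LineGrid E2, IsICeNet N →
      ∃ (a b c u : ℝ) (G : LineGrid E3) (φ : E2 ≃ᵃⁱ[ℝ] E2) (N' : LineGrid E2),
        IsIChNet N' ∧ ACDeformation a b c u G (N.map φ.toAffineIsometry.toAffineMap) N') ∧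
    -- ... and vice versa
    (∀ N : LineGrid E2, IsIChNet N →
      ∃ (a b c u : ℝ) (G : LineGrid E3) (φ : E2 ≃ᵃⁱ[ℝ] E2) (N' : LineGrid E2),
        IsICeNet N' ∧ ACDeformation a b c u G N' (N.map φ.toAffineIsometry.toAffineMap)) := by
  refine ⟨fun a b c hcb hba => ⟨fun u hu G hG => ?_, bijOn_paramU₂ hcb hba,
    fun δ s₁₀ s₃₀ h s₂ hs => exists_isACGrid_gridPoint hcb hba h hs⟩,
    fun N hN => hN.exists_acDeformation, fun N hN => hN.exists_acDeformation⟩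
  have hk := modulus₁_mem hcb hba
  have hk2 := modulus₁_sq hcb hba
  obtain ⟨hp, hq, hr⟩ := acGrid_axes_pos hba hu
  obtain ⟨ε, τ, σ, hε, h, hGeq⟩ := hG.exists_meshPair hk hk2 hcb hba hu
  have hD := h.acDeformation hk hk2 hcb hba hu hε
  rw [← hGeq] at hD
  have hv : ∀ n n', G.vertex n n' =
      rulingVertex (Real.sqrt (u + a)) (Real.sqrt (u + b)) (Real.sqrt (-(u + c))) ε
        (jacobiAm (modulus₁ a b c) (τ n)) (jacobiAm (modulus₁ a b c) (σ n')) := fun n n' => by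
    rw [hGeq]; rfl
  refine ⟨⟨hD.start, hD.continuous, hD.isACGrid⟩, fun v hv n n' => ⟨?_, ?_⟩,
    fun n n' => ⟨fun v hv' => ?_, ?_, ?_⟩, ⟨_, hD.limit_c, ?_, ?_⟩, ⟨_, hD.limit_b, ?_, ?_⟩,
    h.exists_gridPoint hcb hba hu hε hGeq⟩
  · exact (hD.isometric v hv).1 n _ (hG.grid.vertex_fst _ _) _ (hG.grid.vertex_fst _ _)
  · exact (hD.isometric v hv).2 n' _ (hG.grid.vertex_snd _ _) _ (hG.grid.vertex_snd _ _)
  · obtain ⟨hp', hq', hr'⟩ := acGrid_axes_pos hba hv'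
    simp only [hv, deform_rulingVertex hba hu (Ioo_subset_Icc_self hv')]
    have hm := fun i j => rulingVertex_mem (p := Real.sqrt (v + a)) (q := Real.sqrt (v + b))
      (r := Real.sqrt (-(v + c))) hε (h.fin i j)
    exact affineIndependent_vertices hp'.ne' hq'.ne' hr'.ne' hε (hm n n').1 (hm n n').2
      (hm (n + 1) n').1 (hm (n + 1) n').2 (hm (n + 1) (n' + 1)).1 (hm (n + 1) (n' + 1)).2
      (hm n (n' + 1)).1 (hm n (n' + 1)).2 (h.fst_ne_one n) (h.snd_ne_one n')
  · exact strictMono_or_strictAnti_diagonal hba hu hε (h.fin _ _) (h.fin _ _) (h.fst_ne_one n)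
      (h.snd_ne_one n') (hv _ _) (hv _ _)
  · exact strictMono_or_strictAnti_diagonal hba hu hε (h.fin _ _) (h.fin _ _)
      (fun hs => h.fst_ne_one n hs.symm) (h.snd_ne_one n') (hv _ _) (hv _ _)
  · exact (h.isICNetOn_focalEllipse hk hk2 hcb hba hε).isICeNet (by linarith) (by linarith)
  · exact h.isICNetOn_focalEllipse hk hk2 hcb hba hε
  · exact (h.isICNetOn_focalHyperbola hk hk2 hcb hba hε).isIChNet (by linarith) (by linarith)
  · exact h.isICNetOn_focalHyperbola hk hk2 hcb hba hε
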